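/- Let $n \ge 0$, and write $\langle a, b\rangle = \sum_i a_i b_i \in \mathbb{Z}_2$ for $a,b\in\mathbb{Z}_2^n$. Let $M = (|M|, \mathcal{O}_M)$ be a smooth $\mathbb{Z}_2^n$-manifold of dimension $p|\mathbf{q}$: a second-countable Hausdorff space $|M|$ with a sheaf $\mathcal{O}_M$ of $\mathbb{Z}_2^n$-graded associative unital $\mathbb{R}$-algebras that are $\mathbb{Z}_2^n$-commutative ($st = (-1)^{\langle \deg s, \deg t\rangle}\, ts$ for homogeneous $s,t$), whose stalks are local rings, and which is locally isomorphic to $(\mathbb{R}^p, C^\infty_{\mathbb{R}^p}(-)[[\xi]])$, where $\xi$ consists of finitely many formal variables of non-zero degrees ($q_\gamma$ of them of degree $\gamma$) with $\xi^A\xi^B = (-1)^{\langle \deg A,\deg B\rangle}\xi^B\xi^A$. Let $\mathcal{T}M(U) = \mathrm{Der}(\mathcal{O}_M(U))$ be the sheaf of graded derivations, $C^\infty(M) = \mathcal{O}_M(|M|)$ and $\mathrm{Vect}(M) = \mathcal{T}M(|M|)$. Let $g$ be a Riemannian metric on $M$ of arbitrary degree $\deg(g)\in\mathbb{Z}_2^n$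 (even or odd), that is, a morphism of sheaves $\langle - | - \rangle_g : \mathcal{T}M \otimes_{\mathcal{O}_M}\mathcal{T}M \to \mathcal{O}_M$ which is - homogeneous: $\deg\langle X|Y\rangle_g = \deg X + \deg Y + \deg(g)$ for homogeneous $X, Y$; - $\mathbb{Z}_2^n$-symmetric: $\langle X|Y\rangle_g = (-1)^{\langle \deg X,\deg Y\rangle}\langle Y|X\rangle_g$ for homogeneous $X, Y$; - $\mathcal{O}_M$-linear: biadditive with $\langle fX|Y\rangle_g = f\langle X|Y\rangle_g$; - non-degenerate at every point: if $m\in U$ and $X\in\mathcal{T}M(U)$ are such that the value of $\langle X|Y\rangle_g$ at $m$ is zero for all $Y\in \mathcal{T}M(U)$, then the value of $X f$ at $m$ is zero for all $f\in\mathcal{O}_M(U)$ (equivalently, in local coordinates the matrix $\langle\partial_I|\partial_J\rangle_g$ is invertible). Then there is exactly one affine connection on $M$, that is, exactly one biadditive map $\nabla : \mathrm{Vect}(M)\times\mathrm{Vect}(M)\to\mathrm{Vect}(M)$, $(X,Y)\mapsto\nabla_XY$, with $\deg(\nabla_X Y) = \deg X+\deg Y$, $\nabla_{fX}Y = f\nabla_XY$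 and $\nabla_X(fY) = X(f)Y + (-1)^{\langle\deg X,\deg f\rangle} f\nabla_XY$, which is - symmetric (torsion-free): $\nabla_XY - (-1)^{\langle\deg X,\deg Y\rangle}\nabla_YX = [X,Y] := X\circ Y - (-1)^{\langle\deg X,\deg Y\rangle}\, Y\circ X$, and - metric compatible: $X\langle Y|Z\rangle_g = \langle\nabla_XY|Z\rangle_g + (-1)^{\langle\deg X,\deg Y\rangle}\langle Y|\nabla_XZ\rangle_g$, for all homogeneous $X,Y,Z\in\mathrm{Vect}(M)$ and $f\in C^\infty(M)$. -/

import Mathlib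

open TopologicalSpace Matrix
open scoped Manifold ContDiff

universe u v

/-- The group `ℤ₂ⁿ` of degrees. -/
abbrev Z2n (n : ℕ) : Type := Fin n → ZMod 2

/-- The commutation factor `(-1)^⟨a, b⟩`, with the standard scalar product of `ℤ₂ⁿ`. -/
def sgn {n : ℕ} (a b : Z2n n) : ℤ := (-1) ^ (a ⬝ᵥ b).val

theorem sgn_add_left {n : ℕ} (a b c : Z2n n) : sgn (a + b) c = sgn a c * sgn b c := by
  unfold sgn
  rw [add_dotProduct, ← pow_add, ZMod.val_add]
  exact (neg_one_pow_eq_pow_mod_two _).symm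

theorem sgn_comm {n : ℕ} (a b : Z2n n) : sgn a b = sgn b a := by
  unfold sgn
  rw [dotProduct_comm]

/-! ### Formal power series in `ℤ₂ⁿ`-commuting variables -/

section Series

variable {n r : ℕ}

/-- Exponents `α` with `ξ^α ≠ 0`: a variable `ξ_i` with `⟨deg ξ_i, deg ξ_i⟩ = 1` anticommutes with
itself, hence squares to zero. -/
def AdmissibleExp (d : Fin r → Z2n n) (α : Fin r →₀ ℕ) : Prop :=
  ∀ i, d i ⬝ᵥ d i = 1 → α i ≤ 1

/-- The degree of the ordered monomial `ξ^α = ξ_0^{α_0} ξ_1^{α_1} ⋯`. -/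
def expDegree (d : Fin r → Z2n n) (α : Fin r →₀ ℕ) : Z2n n := ∑ i, α i • d i

/-- The sign in `ξ^α ξ^β = ± ξ^(α+β)`: every `ξ_j^{β_j}` moves to the left across all
`ξ_i^{α_i}` with `i > j`. -/
def expSign (d : Fin r → Z2n n) (α β : Fin r →₀ ℕ) : ℤ :=
  ∏ i, ∏ j ∈ Finset.Iio i, sgn (d i) (d j) ^ (α i * β j)

theorem expSign_add_left (d : Fin r → Z2n n) (α β γ : Fin r →₀ ℕ) :
    expSign d (α + β) γ = expSign d α γ * expSign d β γ := by
  simp [expSign, add_mul, pow_add, Finset.prod_mul_distrib]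

theorem expSign_add_right (d : Fin r → Z2n n) (α β γ : Fin r →₀ ℕ) :
    expSign d α (β + γ) = expSign d α β * expSign d α γ := by
  simp [expSign, mul_add, pow_add, Finset.prod_mul_distrib]

theorem AdmissibleExp.mono {d : Fin r → Z2n n} {α β : Fin r →₀ ℕ} (h : AdmissibleExp d β)
    (hle : α ≤ β) : AdmissibleExp d α :=
  fun i hi => (hle i).trans (h i hi)

theorem admissibleExp_zero (d : Fin r → Z2n n) : AdmissibleExp d 0 := fun _ _ => by simp

/-- The families of coefficients of the series `∑_α ξ^α f_α`. -/
def seriesSubmodule (d : Fin r → Z2n n) (R : Type*) [CommRing R] [Algebra ℝ R] :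
    Submodule ℝ ((Fin r →₀ ℕ) → R) where
  carrier := {f | ∀ α, ¬ AdmissibleExp d α → f α = 0}
  add_mem' hf hg α hα := by simp [hf α hα, hg α hα]
  zero_mem' _ _ := rfl
  smul_mem' c f hf α hα := by simp [hf α hα]

/-- `R[[ξ]]`: formal power series `∑_α ξ^α f_α` with coefficients in `R` in variables
`ξ_0, …, ξ_{r-1}` of degrees `d 0, …, d (r-1)`, with `ξ_i ξ_j = (-1)^⟨d i, d j⟩ ξ_j ξ_i`; the
coefficients are central. -/
def Series (d : Fin r → Z2n n) (R : Type*) [CommRing R] [Algebra ℝ R] : Type _ :=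
  ↥(seriesSubmodule d R)

namespace Series

variable {d : Fin r → Z2n n} {R : Type*} [CommRing R] [Algebra ℝ R]

instance : AddCommGroup (Series d R) := inferInstanceAs (AddCommGroup ↥(seriesSubmodule d R))

instance : Module ℝ (Series d R) := inferInstanceAs (Module ℝ ↥(seriesSubmodule d R))

/-- The coefficient `f_α` of `ξ^α`. -/
def coeff (f : Series d R) (α : Fin r →₀ ℕ) : R := f.1 α

@[ext]
theorem ext {f g : Series d R} (h : ∀ α, f.coeff α = g.coeff α) : f = g :=
  Subtype.ext (funext h)

theorem coeff_of_not {f : Series d R} {α : Fin r →₀ ℕ} (h : ¬ AdmissibleExp d α) :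
    f.coeff α = 0 := f.2 α h

@[simp] theorem coeff_add (f g : Series d R) (α) : (f + g).coeff α = f.coeff α + g.coeff α := rfl
@[simp] theorem coeff_zero (α) : (0 : Series d R).coeff α = 0 := rfl
@[simp] theorem coeff_smul (c : ℝ) (f : Series d R) (α) : (c • f).coeff α = c • f.coeff α := rfl

open Classical in
noncomputable instance : One (Series d R) :=
  ⟨⟨fun α => if α = 0 then 1 else 0, fun _ hα =>
    if_neg fun h => hα (by rw [h]; exact admissibleExp_zero d)⟩⟩

open Classical in
noncomputable instance : Mul (Series d R) :=
  ⟨fun f g => ⟨fun δ => if AdmissibleExp d δ then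
      ∑ x ∈ Finset.HasAntidiagonal.antidiagonal δ, expSign d x.1 x.2 • (f.coeff x.1 * g.coeff x.2) else 0,
    fun _ hδ => if_neg hδ⟩⟩

open Classical in
theorem coeff_one (α : Fin r →₀ ℕ) : (1 : Series d R).coeff α = if α = 0 then 1 else 0 := rfl

theorem coeff_mul (f g : Series d R) {δ : Fin r →₀ ℕ} (hδ : AdmissibleExp d δ) :
    (f * g).coeff δ =
      ∑ x ∈ Finset.HasAntidiagonal.antidiagonal δ, expSign d x.1 x.2 • (f.coeff x.1 * g.coeff x.2) :=
  if_pos hδ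

theorem ext_admissible {f g : Series d R}
    (h : ∀ α, AdmissibleExp d α → f.coeff α = g.coeff α) : f = g := by
  ext α
  by_cases hα : AdmissibleExp d α
  · exact h α hα
  · rw [coeff_of_not hα, coeff_of_not hα]

theorem expSign_zero_left (β : Fin r →₀ ℕ) : expSign d 0 β = 1 := by simp [expSign]

theorem expSign_zero_right (β : Fin r →₀ ℕ) : expSign d β 0 = 1 := by simp [expSign]

theorem one_mul' (f : Series d R) : 1 * f = f := by
  classical
  refine ext_admissible fun δ hδ => ?_
  rw [coeff_mul _ _ hδ, Finset.sum_eq_single (0, δ)]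
  · simp [coeff_one, expSign_zero_left]
  · rintro ⟨a, b⟩ hab hne
    have : a ≠ 0 := by
      rintro rfl
      apply hne
      simpa using hab
    simp [coeff_one, this]
  · simp

theorem mul_one' (f : Series d R) : f * 1 = f := by
  classical
  refine ext_admissible fun δ hδ => ?_
  rw [coeff_mul _ _ hδ, Finset.sum_eq_single (δ, 0)]
  · simp [coeff_one, expSign_zero_right]
  · rintro ⟨a, b⟩ hab hne
    have : b ≠ 0 := by
      rintro rfl
      apply hne
      simpa using hab
    simp [coeff_one, this]
  · simp

theorem mul_assoc' (f g h : Series d R) : f * g * h = f * (g * h) := by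
  classical
  refine ext_admissible fun δ hδ => ?_
  rw [coeff_mul _ _ hδ, coeff_mul _ _ hδ]
  have e1 : ∀ x ∈ Finset.HasAntidiagonal.antidiagonal δ,
      expSign d x.1 x.2 • ((f * g).coeff x.1 * h.coeff x.2) =
      ∑ y ∈ Finset.HasAntidiagonal.antidiagonal x.1, (expSign d y.1 x.2 * expSign d y.2 x.2 * expSign d y.1 y.2) •
        (f.coeff y.1 * (g.coeff y.2 * h.coeff x.2)) := by
    intro x hx
    have hx' : AdmissibleExp d x.1 := hδ.mono
      (le_self_add.trans_eq (Finset.HasAntidiagonal.mem_antidiagonal.1 hx))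
    rw [coeff_mul _ _ hx', Finset.sum_mul, Finset.smul_sum]
    refine Finset.sum_congr rfl fun y hy => ?_
    rw [← Finset.HasAntidiagonal.mem_antidiagonal.1 hy, expSign_add_left, smul_mul_assoc, smul_smul]
    simp only [mul_assoc]
  have e2 : ∀ x ∈ Finset.HasAntidiagonal.antidiagonal δ,
      expSign d x.1 x.2 • (f.coeff x.1 * (g * h).coeff x.2) =
      ∑ y ∈ Finset.HasAntidiagonal.antidiagonal x.2, (expSign d x.1 y.2 * expSign d y.1 y.2 * expSign d x.1 y.1) •
        (f.coeff x.1 * (g.coeff y.1 * h.coeff y.2)) := by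
    intro x hx
    have hx' : AdmissibleExp d x.2 := hδ.mono
      (le_add_self.trans_eq (Finset.HasAntidiagonal.mem_antidiagonal.1 hx))
    rw [coeff_mul _ _ hx', Finset.mul_sum, Finset.smul_sum]
    refine Finset.sum_congr rfl fun y hy => ?_
    rw [← Finset.HasAntidiagonal.mem_antidiagonal.1 hy, expSign_add_right, mul_smul_comm, smul_smul]
    congr 1
    ring
  rw [Finset.sum_congr rfl e1, Finset.sum_congr rfl e2]
  exact aux f g h δ
where
  aux (f g h : Series d R) (δ : Fin r →₀ ℕ) :
      (∑ x ∈ Finset.HasAntidiagonal.antidiagonal δ, ∑ y ∈ Finset.HasAntidiagonal.antidiagonal x.1,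
        (expSign d y.1 x.2 * expSign d y.2 x.2 * expSign d y.1 y.2) •
        (f.coeff y.1 * (g.coeff y.2 * h.coeff x.2))) =
      ∑ x ∈ Finset.HasAntidiagonal.antidiagonal δ, ∑ y ∈ Finset.HasAntidiagonal.antidiagonal x.2,
        (expSign d x.1 y.2 * expSign d y.1 y.2 * expSign d x.1 y.1) •
        (f.coeff x.1 * (g.coeff y.1 * h.coeff y.2)) := by
    rw [Finset.sum_sigma', Finset.sum_sigma']
    refine Finset.sum_nbij' (fun x => ⟨(x.2.1, x.2.2 + x.1.2), (x.2.2, x.1.2)⟩)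
      (fun x => ⟨(x.1.1 + x.2.1, x.2.2), (x.1.1, x.2.1)⟩) ?_ ?_ ?_ ?_ ?_
    · rintro ⟨⟨a, b⟩, ⟨p, q⟩⟩ hx
      simp only [Finset.mem_sigma, Finset.HasAntidiagonal.mem_antidiagonal] at hx ⊢
      obtain ⟨h1, h2⟩ := hx
      exact ⟨by rw [← add_assoc, h2, h1], trivial⟩
    · rintro ⟨⟨a, b⟩, ⟨p, q⟩⟩ hx
      simp only [Finset.mem_sigma, Finset.HasAntidiagonal.mem_antidiagonal] at hx ⊢
      obtain ⟨h1, h2⟩ := hx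
      exact ⟨by rw [add_assoc, h2, h1], trivial⟩
    · rintro ⟨⟨a, b⟩, ⟨p, q⟩⟩ hx
      simp only [Finset.mem_sigma, Finset.HasAntidiagonal.mem_antidiagonal] at hx
      obtain ⟨h1, h2⟩ := hx
      simp [h2]
    · rintro ⟨⟨a, b⟩, ⟨p, q⟩⟩ hx
      simp only [Finset.mem_sigma, Finset.HasAntidiagonal.mem_antidiagonal] at hx
      obtain ⟨h1, h2⟩ := hx
      simp [h2]
    · rintro ⟨⟨a, b⟩, ⟨p, q⟩⟩ hx
      rfl

noncomputable instance : Ring (Series d R) :=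
  { (inferInstance : AddCommGroup (Series d R)) with
    mul := (· * ·)
    one := 1
    one_mul := one_mul'
    mul_one := mul_one'
    mul_assoc := mul_assoc'
    zero_mul := fun f => ext_admissible fun δ hδ => by simp [coeff_mul _ _ hδ]
    mul_zero := fun f => ext_admissible fun δ hδ => by simp [coeff_mul _ _ hδ]
    left_distrib := fun f g h => ext_admissible fun δ hδ => by
      simp [coeff_mul _ _ hδ, mul_add, Finset.sum_add_distrib]
    right_distrib := fun f g h => ext_admissible fun δ hδ => by
      simp [coeff_mul _ _ hδ, add_mul, Finset.sum_add_distrib] }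

noncomputable instance : Algebra ℝ (Series d R) :=
  Algebra.ofModule
    (fun c f g => ext_admissible fun δ hδ => by
      simp only [coeff_mul _ _ hδ, coeff_smul, Finset.smul_sum, smul_mul_assoc]
      exact Finset.sum_congr rfl fun _ _ => smul_comm _ _ _)
    (fun c f g => ext_admissible fun δ hδ => by
      simp only [coeff_mul _ _ hδ, coeff_smul, Finset.smul_sum, mul_smul_comm]
      exact Finset.sum_congr rfl fun _ _ => smul_comm _ _ _)

/-- `f` is homogeneous of degree `γ`: only monomials of degree `γ` occur. -/
def IsHomogeneous (f : Series d R) (γ : Z2n n) : Prop :=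
  ∀ α, expDegree d α ≠ γ → f.coeff α = 0

/-- Apply a ring homomorphism to all coefficients. -/
def mapCoeff {S : Type*} [CommRing S] [Algebra ℝ S] (φ : R →+* S) (f : Series d R) :
    Series d S :=
  ⟨fun α => φ (f.coeff α), fun _ hα => (congrArg φ (coeff_of_not hα)).trans (map_zero φ)⟩

end Series

end Series

/-! ### `ℤ₂ⁿ`-ringed spaces and `ℤ₂ⁿ`-manifolds -/

/-- A second-countable Hausdorff space with a sheaf of `ℤ₂ⁿ`-graded, `ℤ₂ⁿ`-commutative,
associative unital real algebras. -/
structure Z2nRingedSpace (n : ℕ) where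
  /-- the points -/
  carrier : Type u
  [top : TopologicalSpace carrier]
  [hausdorff : T2Space carrier]
  [secondCountable : SecondCountableTopology carrier]
  /-- the sections over an open set -/
  sec : Opens carrier → Type v
  [ring : ∀ U, Ring (sec U)]
  [algebra : ∀ U, Algebra ℝ (sec U)]
  /-- the homogeneous parts -/
  grade : ∀ U, Z2n n → Submodule ℝ (sec U)
  [graded : ∀ U, GradedAlgebra (grade U)]
  comm : ∀ (U : Opens carrier) (a b : Z2n n) (s t : sec U), s ∈ grade U a → t ∈ grade U b →
    s * t = sgn a b • (t * s)
  /-- the restriction maps -/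
  res : ∀ {U V : Opens carrier}, V ≤ U → (sec U →ₐ[ℝ] sec V)
  res_self : ∀ {U : Opens carrier} (s : sec U), res (le_refl U) s = s
  res_res : ∀ {U V W : Opens carrier} (hVU : V ≤ U) (hWV : W ≤ V) (s : sec U),
    res hWV (res hVU s) = res (hWV.trans hVU) s
  res_grade : ∀ {U V : Opens carrier} (hVU : V ≤ U) (a : Z2n n) (s : sec U),
    s ∈ grade U a → res hVU s ∈ grade V a
  existsUnique_glue : ∀ {ι : Type u} (U : Opens carrier) (W : ι → Opens carrier)
    (hW : ∀ i, W i ≤ U), U ≤ ⨆ i, W i → ∀ s : ∀ i, sec (W i),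
    (∀ i j, res (inf_le_left : W i ⊓ W j ≤ W i) (s i) =
      res (inf_le_right : W i ⊓ W j ≤ W j) (s j)) →
    ∃! t : sec U, ∀ i, res (hW i) t = s i

attribute [instance] Z2nRingedSpace.top Z2nRingedSpace.hausdorff Z2nRingedSpace.secondCountable
  Z2nRingedSpace.ring Z2nRingedSpace.algebra Z2nRingedSpace.graded

namespace Z2nRingedSpace

variable {n : ℕ} (S : Z2nRingedSpace.{u, v} n)

/-- The germ of the section `f` at the point `m` is invertible in the stalk at `m`. -/
def GermIsUnit {U : Opens S.carrier} (f : S.sec U) (m : S.carrier) : Prop :=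
  ∃ (V : Opens S.carrier) (hVU : V ≤ U), m ∈ V ∧ IsUnit (S.res hVU f)

/-- All stalks are local rings: they are nonzero, and whenever two germs add up to `1`, one of
them is invertible. -/
structure HasLocalStalks : Prop where
  nontrivial : ∀ (U : Opens S.carrier), ∀ m ∈ U, (1 : S.sec U) ≠ 0
  isUnit_or_isUnit : ∀ (U : Opens S.carrier) (f g : S.sec U), f + g = 1 → ∀ m ∈ U,
    S.GermIsUnit f m ∨ S.GermIsUnit g m

/-- The germ of `f` at `m` lies in the maximal ideal of the (local) stalk at `m`, that is, the
value of `f` at `m` is zero. -/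
def VanishesAt {U : Opens S.carrier} (f : S.sec U) (m : S.carrier) : Prop :=
  ¬ S.GermIsUnit f m

end Z2nRingedSpace

/-- The open subset of the domain of `h` that corresponds to `W`. -/
def chartPreimage {X E : Type*} [TopologicalSpace X] [TopologicalSpace E]
    (h : OpenPartialHomeomorph X E) (W : Opens E) : Opens X :=
  ⟨h.source ∩ h ⁻¹' W, h.isOpen_inter_preimage W.isOpen⟩

theorem chartPreimage_mono {X E : Type*} [TopologicalSpace X] [TopologicalSpace E]
    (h : OpenPartialHomeomorph X E) {W W' : Opens E} (hW : W' ≤ W) :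
    chartPreimage h W' ≤ chartPreimage h W :=
  fun _ hx => ⟨hx.1, hW hx.2⟩

/-- The algebra of smooth real functions on an open subset of `ℝᵖ`. -/
abbrev SmoothFun {p : ℕ} (W : Opens (EuclideanSpace ℝ (Fin p))) : Type :=
  C^∞⟮𝓘(ℝ, EuclideanSpace ℝ (Fin p)), W; 𝓘(ℝ, ℝ), ℝ⟯

/-- Restriction of smooth functions. -/
noncomputable abbrev SmoothFun.restrict {p : ℕ} {W W' : Opens (EuclideanSpace ℝ (Fin p))} (hW : W' ≤ W) :
    SmoothFun W →+* SmoothFun W' :=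
  ContMDiffMap.restrictRingHom 𝓘(ℝ, EuclideanSpace ℝ (Fin p)) 𝓘(ℝ, ℝ) ℝ hW

/-- A coordinate chart: an isomorphism of `ℤ₂ⁿ`-ringed spaces from an open part of `S` to an open
part of the model space `(ℝᵖ, C^∞(-)[[ξ]])`, the variables `ξ_i` having degrees `d i`. -/
structure Z2nChart {n : ℕ} (S : Z2nRingedSpace.{u, v} n) (p : ℕ) {r : ℕ} (d : Fin r → Z2n n) where
  /-- the homeomorphism -/
  homeo : OpenPartialHomeomorph S.carrier (EuclideanSpace ℝ (Fin p))
  /-- the pull-back of functions -/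
  pullback : ∀ W : Opens (EuclideanSpace ℝ (Fin p)), (W : Set _) ⊆ homeo.target →
    (Series d (SmoothFun W) ≃ₐ[ℝ] S.sec (chartPreimage homeo W))
  pullback_grade : ∀ W hW (f : Series d (SmoothFun W)) (γ : Z2n n),
    pullback W hW f ∈ S.grade _ γ ↔ f.IsHomogeneous γ
  pullback_res : ∀ W hW W' hW' (h : W' ≤ W) (f : Series d (SmoothFun W)),
    S.res (chartPreimage_mono homeo h) (pullback W hW f) =
      pullback W' hW' (f.mapCoeff (SmoothFun.restrict h))

/-- A smooth `ℤ₂ⁿ`-manifold of dimension `p|q`. The tuple `q` is given by listing the nonzero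
degrees of the `r` formal coordinates: `q_γ` is the number of `i` with `formalDegree i = γ`. -/
structure Z2nManifold (n : ℕ) extends Z2nRingedSpace.{u, v} n where
  localStalks : toZ2nRingedSpace.HasLocalStalks
  /-- the number of ordinary coordinates -/
  p : ℕ
  /-- the number of formal coordinates -/
  r : ℕ
  /-- the degrees of the formal coordinates -/
  formalDegree : Fin r → Z2n n
  formalDegree_ne_zero : ∀ i, formalDegree i ≠ 0
  exists_chart : ∀ m : carrier, ∃ c : Z2nChart toZ2nRingedSpace p formalDegree,
    m ∈ c.homeo.source

/-! ### Graded derivations, vector fields -/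

section Derivations

variable {n : ℕ} {A : Type*} [Ring A] [Algebra ℝ A]

/-- `D` is a derivation, homogeneous of degree `γ`, of the graded algebra `A = ⨁ 𝒜 α`. -/
structure IsGradedDerivation (𝒜 : Z2n n → Submodule ℝ A) (γ : Z2n n) (D : A →ₗ[ℝ] A) : Prop where
  map_grade : ∀ (α : Z2n n) (f : A), f ∈ 𝒜 α → D f ∈ 𝒜 (γ + α)
  leibniz : ∀ (α : Z2n n) (f g : A), f ∈ 𝒜 α → D (f * g) = D f * g + sgn γ α • (f * D g)

variable {𝒜 : Z2n n → Submodule ℝ A} [GradedAlgebra 𝒜]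

theorem IsGradedDerivation.smul
    (hcomm : ∀ (a b : Z2n n) (s t : A), s ∈ 𝒜 a → t ∈ 𝒜 b → s * t = sgn a b • (t * s))
    {a γ : Z2n n} {f : A} {D : A →ₗ[ℝ] A} (hf : f ∈ 𝒜 a) (hD : IsGradedDerivation 𝒜 γ D) :
    IsGradedDerivation 𝒜 (a + γ) (f • D) where
  map_grade α g hg := by
    rw [add_assoc]
    exact SetLike.mul_mem_graded hf (hD.map_grade α g hg)
  leibniz α g h hg := by
    simp only [LinearMap.smul_apply, smul_eq_mul]
    rw [hD.leibniz α g h hg, mul_add, mul_smul_comm, ← mul_assoc f g, hcomm a α f g hf hg,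
      sgn_add_left, mul_assoc f, smul_mul_assoc, smul_smul, mul_assoc g, mul_comm (sgn γ α)]

end Derivations

namespace Z2nRingedSpace

variable {n : ℕ} (S : Z2nRingedSpace.{u, v} n)

/-- The module of derivations of the graded algebra of sections over `U` (the sections of the
tangent sheaf over `U`): sums of homogeneous graded derivations, with `(f X)(h) = f * X h`. -/
def Vect (U : Opens S.carrier) : Submodule (S.sec U) (S.sec U →ₗ[ℝ] S.sec U) where
  carrier := AddSubmonoid.closure {D | ∃ γ, IsGradedDerivation (S.grade U) γ D}
  add_mem' := add_mem
  zero_mem' := zero_mem _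
  smul_mem' f D hD := by
    induction hD using AddSubmonoid.closure_induction with
    | mem D hD =>
      obtain ⟨γ, hD⟩ := hD
      induction f using DirectSum.Decomposition.inductionOn (S.grade U) with
      | zero => rw [zero_smul]; exact zero_mem _
      | @homogeneous a f =>
        exact AddSubmonoid.subset_closure ⟨a + γ, hD.smul (S.comm U) f.2⟩
      | add f g hf hg => rw [add_smul]; exact add_mem hf hg
    | zero => rw [smul_zero]; exact zero_mem _
    | add D E _ _ hD hE => rw [smul_add]; exact add_mem hD hE

/-- `X` is homogeneous of degree `a`. -/
def IsHomVect {U : Opens S.carrier} (X : S.Vect U) (a : Z2n n) : Prop :=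
  IsGradedDerivation (S.grade U) a (X : S.sec U →ₗ[ℝ] S.sec U)

/-- `Y` is the restriction of `X` to the smaller open set `V`. -/
def IsRestriction {U V : Opens S.carrier} (hVU : V ≤ U) (X : S.Vect U) (Y : S.Vect V) : Prop :=
  ∀ f : S.sec U, Y.1 (S.res hVU f) = S.res hVU (X.1 f)

end Z2nRingedSpace

/-! ### Riemannian metrics and affine connections -/

/-- A Riemannian metric: a `ℤ₂ⁿ`-homogeneous, `ℤ₂ⁿ`-symmetric, non-degenerate, `𝒪`-linear morphism
of sheaves `𝒯M ⊗ 𝒯M → 𝒪`. Linearity in the second argument, with the sign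
`⟨X|fY⟩ = (-1)^⟨deg X, deg f⟩ f ⟨X|Y⟩`, follows from symmetry. The degree of the metric is
arbitrary. -/
structure RiemannianZ2nMetric {n : ℕ} (M : Z2nManifold.{u, v} n) where
  /-- the degree of the metric -/
  deg : Z2n n
  /-- the pairing `⟨X|Y⟩` over an open set -/
  pair : ∀ U : Opens M.carrier, M.Vect U → M.Vect U → M.sec U
  pair_add_left : ∀ U X Y Z, pair U (X + Y) Z = pair U X Z + pair U Y Z
  pair_add_right : ∀ U X Y Z, pair U X (Y + Z) = pair U X Y + pair U X Z
  pair_smul_left : ∀ U (f : M.sec U) X Y, pair U (f • X) Y = f * pair U X Y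
  pair_grade : ∀ U X Y a b, M.IsHomVect X a → M.IsHomVect Y b →
    pair U X Y ∈ M.grade U (a + b + deg)
  pair_symm : ∀ U X Y a b, M.IsHomVect X a → M.IsHomVect Y b →
    pair U X Y = sgn a b • pair U Y X
  pair_res : ∀ {U V : Opens M.carrier} (hVU : V ≤ U) (X Y : M.Vect U) (X' Y' : M.Vect V),
    M.IsRestriction hVU X X' → M.IsRestriction hVU Y Y' →
    pair V X' Y' = M.res hVU (pair U X Y)
  /-- Non-degeneracy at every point `m`: if the value of `⟨X|Y⟩` at `m` is zero for all `Y`, then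
  the tangent vector `f ↦ (X f)(m)` is zero. In local coordinates: the real matrix of the values
  at `m` of the components `⟨∂_I|∂_J⟩` is invertible. -/
  nondegenerate : ∀ (U : Opens M.carrier), ∀ m ∈ U, ∀ X : M.Vect U,
    (∀ Y : M.Vect U, M.VanishesAt (pair U X Y) m) → ∀ f : M.sec U, M.VanishesAt (X.1 f) m

/-- An affine connection on a `ℤ₂ⁿ`-manifold; `⊤` is the whole space, so `M.Vect ⊤` is the module
of vector fields and `M.sec ⊤` the algebra of functions. -/
@[ext]
structure AffineConnection {n : ℕ} (M : Z2nManifold.{u, v} n) where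
  /-- the map `(X, Y) ↦ ∇_X Y` -/
  nabla : M.Vect ⊤ → M.Vect ⊤ → M.Vect ⊤
  nabla_grade : ∀ X Y a b, M.IsHomVect X a → M.IsHomVect Y b →
    M.IsHomVect (nabla X Y) (a + b)
  nabla_add_left : ∀ X Y Z, nabla (X + Y) Z = nabla X Z + nabla Y Z
  nabla_add_right : ∀ X Y Z, nabla X (Y + Z) = nabla X Y + nabla X Z
  nabla_smul_left : ∀ (f : M.sec ⊤) X Y, nabla (f • X) Y = f • nabla X Y
  nabla_leibniz : ∀ X Y a b (f : M.sec ⊤), M.IsHomVect X a → f ∈ M.grade ⊤ b →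
    nabla X (f • Y) = X.1 f • Y + sgn a b • (f • nabla X Y)

namespace AffineConnection

variable {n : ℕ} {M : Z2nManifold.{u, v} n}

/-- The torsion `∇_X Y - (-1)^⟨a, b⟩ ∇_Y X - [X, Y]` of vector fields of degrees `a` and `b`,
where `[X, Y] = X ∘ Y - (-1)^⟨a, b⟩ Y ∘ X`, as an operator on functions. -/
def torsion (D : AffineConnection M) (a b : Z2n n) (X Y : M.Vect ⊤) :
    M.sec ⊤ →ₗ[ℝ] M.sec ⊤ :=
  (D.nabla X Y).1 - sgn a b • (D.nabla Y X).1 - (X.1 ∘ₗ Y.1 - sgn a b • (Y.1 ∘ₗ X.1))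

/-- The connection is symmetric, that is, torsion-free. -/
def IsSymmetric (D : AffineConnection M) : Prop :=
  ∀ X Y a b, M.IsHomVect X a → M.IsHomVect Y b → D.torsion a b X Y = 0

/-- The connection is compatible with the metric `g`. -/
def IsMetricCompatible (D : AffineConnection M) (g : RiemannianZ2nMetric M) : Prop :=
  ∀ X Y Z a b, M.IsHomVect X a → M.IsHomVect Y b →
    X.1 (g.pair ⊤ Y Z) = g.pair ⊤ (D.nabla X Y) Z + sgn a b • g.pair ⊤ Y (D.nabla X Z)

end AffineConnection

/-! As in the classical case, everything rests on the Koszul formula. Torsion-freeness and metric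
compatibility, written for the permutations of `X, Y, Z` with their commutation signs, determine
`2⟨∇_X Y|Z⟩` by the metric and brackets alone (`pair_nabla_add_self`). Non-degeneracy then gives
uniqueness. For existence, the Koszul expression is corrected by a sign to become `𝒪`-linear in `Z`
(`koszulFunctional_smul`), represented as `⟨Z|V⟩`, and `V` is taken for `∇_X Y`. The axioms of the
connection are identities of the Koszul expression (`koszul_smul_left`, `koszul_smul_mid`,
`koszul_torsion`, `koszul_compatible`).

The degree of the metric does no harm: the functional has degree `a + b + deg g`, representing it
adds `deg g` once more, and `deg g + deg g = 0` in `ℤ₂ⁿ`. The signs in symmetry and left linearity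
do not involve `deg g` at all.

The analytic content is `exists_representative`: every homogeneous `𝒪`-linear functional on vector
fields is represented by the metric. Cutoff sections make derivations and functionals local. Near a
point the coordinate fields span (`vectEqOn_sum_frame`), because a derivation killing all
coordinates vanishes: Hadamard's lemma puts its values into arbitrarily high powers of the ideal of
each point. Pointwise non-degeneracy makes the real Gram matrix invertible
(`det_value_gram_ne_zero`), continuity spreads this to a neighbourhood, and a geometric series lifts
invertibility from constant terms to matrices of formal series
(`isUnit_matrix_of_isUnit_constCoeff`). The resulting linear systems are solved locally, and the
solutions glue because they are unique. -/

/-! ### Signs -/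

section Signs

variable {n : ℕ}

theorem sgn_add_right (a b c : Z2n n) : sgn a (b + c) = sgn a b * sgn a c := by
  rw [sgn_comm, sgn_add_left, sgn_comm b, sgn_comm c]

theorem sgn_eq_one_or (a b : Z2n n) : sgn a b = 1 ∨ sgn a b = -1 := neg_one_pow_eq_or ℤ _

@[simp] theorem sgn_mul_self (a b : Z2n n) : sgn a b * sgn a b = 1 := by
  rcases sgn_eq_one_or a b with h | h <;> simp [h]

@[simp] theorem sgn_zero_left (a : Z2n n) : sgn 0 a = 1 := by simp [sgn]

@[simp] theorem sgn_zero_right (a : Z2n n) : sgn a 0 = 1 := by simp [sgn]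

theorem sgn_nsmul_right (a b : Z2n n) (k : ℕ) : sgn a (k • b) = sgn a b ^ k := by
  induction k with
  | zero => simp
  | succ k ih => rw [succ_nsmul, sgn_add_right, ih, pow_succ]

theorem sgn_sum_right {ι : Type*} (s : Finset ι) (a : Z2n n) (f : ι → Z2n n) :
    sgn a (∑ i ∈ s, f i) = ∏ i ∈ s, sgn a (f i) := by
  classical
  induction s using Finset.induction_on with
  | empty => simp
  | insert i s hi ih => rw [Finset.sum_insert hi, Finset.prod_insert hi, sgn_add_right, ih]

theorem Z2n.add_self (a : Z2n n) : a + a = 0 := by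
  ext i
  exact CharTwo.add_self_eq_zero _

/-- `sgn a a` is `-1` exactly for the degrees of variables that anticommute with themselves. -/
theorem sgn_self_eq_neg_one {a : Z2n n} (h : a ⬝ᵥ a = 1) : sgn a a = -1 := by
  unfold sgn
  rw [h]
  rfl

end Signs

/-! ### Calculus of formal power series -/

section Series

variable {n r : ℕ} {d : Fin r → Z2n n}

theorem expDegree_add (α β : Fin r →₀ ℕ) :
    expDegree d (α + β) = expDegree d α + expDegree d β := by
  simp [expDegree, add_smul, Finset.sum_add_distrib]

theorem expDegree_single (j : Fin r) : expDegree d (Finsupp.single j 1) = d j := by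
  unfold expDegree
  rw [Finset.sum_eq_single j] <;> simp +contextual [eq_comm]

theorem expSign_single_left (j : Fin r) (α : Fin r →₀ ℕ) :
    expSign d (Finsupp.single j 1) α = ∏ k ∈ Finset.Iio j, sgn (d j) (d k) ^ α k := by
  unfold expSign
  rw [Finset.prod_eq_single j]
  · simp
  · intro i _ hi
    simp [hi.symm]
  · simp

theorem expSign_single_right (j : Fin r) (α : Fin r →₀ ℕ) :
    expSign d α (Finsupp.single j 1) = ∏ k ∈ Finset.Ioi j, sgn (d j) (d k) ^ α k := by
  classical
  unfold expSign
  have : ∀ i, ∏ l ∈ Finset.Iio i, sgn (d i) (d l) ^ (α i * (Finsupp.single j 1 : Fin r →₀ ℕ) l)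
      = if j < i then sgn (d j) (d i) ^ α i else 1 := by
    intro i
    split_ifs with h
    · rw [Finset.prod_eq_single j]
      · simp [sgn_comm]
      · intro l _ hl
        simp [hl.symm]
      · simp [h]
    · refine Finset.prod_eq_one fun l hl => ?_
      have : j ≠ l := by
        rintro rfl
        exact h (Finset.mem_Iio.1 hl)
      simp [this]
  simp_rw [this]
  rw [Finset.prod_ite]
  simp [Finset.filter_lt_eq_Ioi]

theorem expSign_mul_self (α β : Fin r →₀ ℕ) : expSign d α β * expSign d α β = 1 := by
  unfold expSign
  simp_rw [← Finset.prod_mul_distrib, ← mul_pow, sgn_mul_self]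
  simp

/-- Moving `ξ_j` across the whole monomial `ξ^α`. -/
theorem expSign_single_swap (j : Fin r) (α : Fin r →₀ ℕ) :
    expSign d (Finsupp.single j 1) α * expSign d α (Finsupp.single j 1) * sgn (d j) (d j) ^ α j
      = sgn (d j) (expDegree d α) := by
  classical
  -- Crossing the variables below `j` gives the first factor, crossing those above `j` the second,
  -- and crossing `ξ_j` itself the power of `sgn (d j) (d j)`.
  have h : (Finset.univ : Finset (Fin r)) = insert j (Finset.Iio j ∪ Finset.Ioi j) := by
    ext i
    simp only [Finset.mem_univ, Finset.mem_insert, Finset.mem_union, Finset.mem_Iio,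
      Finset.mem_Ioi, true_iff]
    rcases lt_trichotomy i j with h | h | h <;> simp [h]
  rw [expSign_single_left, expSign_single_right, expDegree, sgn_sum_right, h,
    Finset.prod_insert (by simp), Finset.prod_union, mul_comm]
  · simp_rw [sgn_nsmul_right]
  · rw [Finset.disjoint_left]
    intro i hi hi'
    exact lt_asymm (Finset.mem_Iio.1 hi) (Finset.mem_Ioi.1 hi')

namespace Series

variable {R : Type*} [CommRing R] [Algebra ℝ R]

@[simp] theorem coeff_neg (f : Series d R) (α) : (-f).coeff α = -f.coeff α := rfl
@[simp] theorem coeff_sub (f g : Series d R) (α) : (f - g).coeff α = f.coeff α - g.coeff α := rfl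

/-- The series with given coefficients. -/
def ofCoeff (F : (Fin r →₀ ℕ) → R) (hF : ∀ α, ¬ AdmissibleExp d α → F α = 0) : Series d R :=
  ⟨F, hF⟩

@[simp] theorem coeff_ofCoeff (F : (Fin r →₀ ℕ) → R) (hF : ∀ α, ¬ AdmissibleExp d α → F α = 0)
    (α) : (ofCoeff F hF).coeff α = F α := rfl

theorem coeff_zsmul (k : ℤ) (f : Series d R) (α) : (k • f).coeff α = k • f.coeff α := rfl

@[simp] theorem coeff_sum {ι : Type*} (s : Finset ι) (f : ι → Series d R) (α) :
    (∑ i ∈ s, f i).coeff α = ∑ i ∈ s, (f i).coeff α := by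
  classical
  induction s using Finset.induction_on with
  | empty => simp
  | insert i s hi ih => rw [Finset.sum_insert hi, Finset.sum_insert hi, coeff_add, ih]

@[simp] theorem coeff_zero_one : (1 : Series d R).coeff 0 = 1 := by
  classical
  simp [coeff_one]

@[simp] theorem coeff_zero_mul (f g : Series d R) :
    (f * g).coeff 0 = f.coeff 0 * g.coeff 0 := by
  rw [coeff_mul _ _ (admissibleExp_zero d)]
  simp [expSign_zero_left]

/-- The projection to the constant coefficient. -/
noncomputable def constCoeff : Series d R →+* R where
  toFun f := f.coeff 0
  map_one' := coeff_zero_one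
  map_mul' := coeff_zero_mul
  map_zero' := rfl
  map_add' _ _ := rfl

@[simp] theorem constCoeff_apply (f : Series d R) : constCoeff f = f.coeff 0 := rfl

open Classical in
/-- The monomial `ξ^α c` of an admissible exponent. -/
noncomputable def monomial (α : Fin r →₀ ℕ) (hα : AdmissibleExp d α) (c : R) : Series d R :=
  ofCoeff (fun β => if β = α then c else 0) fun _ hβ => if_neg fun h => hβ (by rwa [h])

open Classical in
theorem coeff_monomial (α : Fin r →₀ ℕ) (hα : AdmissibleExp d α) (c : R) (β) :
    (monomial α hα c).coeff β = if β = α then c else 0 := rfl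

theorem coeff_monomial_mul_add {α β : Fin r →₀ ℕ} (hα : AdmissibleExp d α)
    (h : AdmissibleExp d (α + β)) (c : R) (f : Series d R) :
    (monomial α hα c * f).coeff (α + β) = expSign d α β • (c * f.coeff β) := by
  classical
  rw [coeff_mul _ _ h, Finset.sum_eq_single (α, β)]
  · simp [coeff_monomial]
  · rintro ⟨a, b⟩ hab hne
    have : a ≠ α := by
      rintro rfl
      apply hne
      simpa using hab
    simp [coeff_monomial, this]
  · simp

theorem coeff_monomial_mul_of_not_le {α δ : Fin r →₀ ℕ} (hα : AdmissibleExp d α)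
    (h : ¬ α ≤ δ) (c : R) (f : Series d R) :
    (monomial α hα c * f).coeff δ = 0 := by
  classical
  by_cases hδ : AdmissibleExp d δ
  · rw [coeff_mul _ _ hδ]
    refine Finset.sum_eq_zero fun x hx => ?_
    have : x.1 ≠ α := by
      rintro rfl
      exact h (le_self_add.trans_eq (Finset.HasAntidiagonal.mem_antidiagonal.1 hx))
    simp [coeff_monomial, this]
  · exact coeff_of_not hδ

/-- The constant series. -/
noncomputable def C : R →+* Series d R where
  toFun := monomial 0 (admissibleExp_zero d)
  map_one' := by
    classical
    ext α
    rw [coeff_monomial, coeff_one]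
  map_mul' a b := by
    classical
    refine ext_admissible fun α hα => ?_
    have := coeff_monomial_mul_add (admissibleExp_zero d) (β := α) (by rwa [zero_add]) a
      (monomial 0 (admissibleExp_zero d) b)
    rw [zero_add, expSign_zero_left, one_smul] at this
    rw [this, coeff_monomial, coeff_monomial, mul_ite, mul_zero]
  map_zero' := by
    classical
    ext α
    rw [coeff_monomial, ite_self, coeff_zero]
  map_add' a b := by
    classical
    ext α
    rw [coeff_add, coeff_monomial, coeff_monomial, coeff_monomial]
    split_ifs <;> simp

open Classical in
theorem coeff_C (c : R) (β) : (C c : Series d R).coeff β = if β = 0 then c else 0 := rfl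

@[simp] theorem coeff_zero_C (c : R) : (C c : Series d R).coeff 0 = c := by
  classical
  simp [coeff_C]

@[simp] theorem coeff_C_mul (c : R) (f : Series d R) (α) : (C c * f).coeff α = c * f.coeff α := by
  by_cases hα : AdmissibleExp d α
  · have := coeff_monomial_mul_add (admissibleExp_zero d) (β := α) (by rwa [zero_add]) c f
    rwa [zero_add, expSign_zero_left, one_smul] at this
  · rw [coeff_of_not hα, coeff_of_not hα, mul_zero]

@[simp] theorem coeff_mul_C (c : R) (f : Series d R) (α) : (f * C c).coeff α = f.coeff α * c := by
  classical
  by_cases hα : AdmissibleExp d α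
  · rw [coeff_mul _ _ hα, Finset.sum_eq_single (α, 0)]
    · simp [expSign_zero_right]
    · rintro ⟨a, b⟩ hab hne
      have : b ≠ 0 := by
        rintro rfl
        apply hne
        simpa using hab
      simp [coeff_C, this]
    · simp
  · rw [coeff_of_not hα, coeff_of_not hα, zero_mul]

theorem C_mul_comm (c : R) (f : Series d R) : C c * f = f * C c := by
  ext α
  rw [coeff_C_mul, coeff_mul_C, mul_comm]

theorem isHomogeneous_C (c : R) : (C c : Series d R).IsHomogeneous 0 := by
  classical
  intro α hα
  rw [coeff_C, if_neg]
  rintro rfl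
  exact hα (by simp [expDegree])

theorem IsHomogeneous.C_mul {f : Series d R} {γ : Z2n n} (hf : f.IsHomogeneous γ) (c : R) :
    (C c * f).IsHomogeneous γ := fun α hα => by rw [coeff_C_mul, hf α hα, mul_zero]

theorem algebraMap_eq_C (t : ℝ) :
    algebraMap ℝ (Series d R) t = C (algebraMap ℝ R t) := by
  classical
  ext α
  rw [Algebra.algebraMap_eq_smul_one, coeff_smul, coeff_one, coeff_C]
  split_ifs <;> simp [Algebra.algebraMap_eq_smul_one]

theorem admissibleExp_single (j : Fin r) : AdmissibleExp d (Finsupp.single j 1) := by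
  classical
  intro i _
  rw [Finsupp.single_apply]
  split_ifs <;> simp

/-- The formal variable `ξ_j`. -/
noncomputable def X (j : Fin r) : Series d R :=
  monomial (Finsupp.single j 1) (admissibleExp_single j) 1

open Classical in
theorem coeff_X (j : Fin r) (β) :
    (X j : Series d R).coeff β = if β = Finsupp.single j 1 then 1 else 0 := rfl

theorem isHomogeneous_X (j : Fin r) : (X j : Series d R).IsHomogeneous (d j) := by
  classical
  intro α hα
  rw [coeff_X, if_neg]
  rintro rfl
  exact hα (expDegree_single j)

theorem coeff_X_mul_add {j : Fin r} {β : Fin r →₀ ℕ}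
    (h : AdmissibleExp d (Finsupp.single j 1 + β)) (f : Series d R) :
    (X j * f).coeff (Finsupp.single j 1 + β) =
      expSign d (Finsupp.single j 1) β • f.coeff β := by
  rw [X, coeff_monomial_mul_add _ h, one_mul]

theorem coeff_X_mul_of_eq_zero {j : Fin r} {α : Fin r →₀ ℕ} (h : α j = 0) (f : Series d R) :
    (X j * f).coeff α = 0 := by
  refine coeff_monomial_mul_of_not_le _ (fun hle => ?_) _ _
  have := hle j
  simp [h] at this

/-- A series without constant term is a combination of the formal variables. -/
theorem exists_eq_sum_X_mul (f : Series d R) (hf : f.coeff 0 = 0) :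
    ∃ k : Fin r → Series d R, f = ∑ j, X j * k j := by
  classical
  -- Each monomial is assigned to its variable of smallest index. This uses it exactly once, and
  -- pulling that variable out to the left crosses nothing, so no sign appears.
  refine ⟨fun j => ofCoeff (fun β => if ∀ i < j, β i = 0 then f.coeff (Finsupp.single j 1 + β)
    else 0) fun β hβ => ?_, ext_admissible fun α hα => ?_⟩
  · split_ifs with h
    · exact coeff_of_not fun h' => hβ (h'.mono le_add_self)
    · rfl
  · rw [coeff_sum]
    by_cases h0 : α = 0
    · subst h0
      rw [hf]
      refine (Finset.sum_eq_zero fun j _ => coeff_X_mul_of_eq_zero rfl _).symm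
    · have hne : (Finset.univ.filter fun i => α i ≠ 0).Nonempty := by
        by_contra h
        rw [Finset.not_nonempty_iff_eq_empty, Finset.filter_eq_empty_iff] at h
        exact h0 (Finsupp.ext fun i => by simpa using h (Finset.mem_univ i))
      set j := (Finset.univ.filter fun i => α i ≠ 0).min' hne with hj
      have hj0 : α j ≠ 0 := (Finset.mem_filter.1 (Finset.min'_mem _ hne)).2
      have hlt : ∀ i < j, α i = 0 := fun i hi => by
        by_contra h
        exact absurd (Finset.min'_le _ i (by simp [h])) (not_le.2 hi)
      have key : ∀ i, α i ≠ 0 → ∃ β, α = Finsupp.single i 1 + β := fun i hi =>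
        ⟨α - Finsupp.single i 1, by
          rw [add_tsub_cancel_of_le]
          intro l
          rw [Finsupp.single_apply]
          split_ifs with h
          · subst h
            omega
          · exact Nat.zero_le _⟩
      rw [Finset.sum_eq_single j]
      · obtain ⟨β, hβ⟩ := key j hj0
        have hβ' : ∀ i < j, β i = 0 := fun i hi => by
          have := hlt i hi
          rw [hβ, Finsupp.add_apply] at this
          omega
        rw [hβ] at hα ⊢
        rw [coeff_X_mul_add hα, expSign_single_left, Finset.prod_eq_one, one_smul,
          coeff_ofCoeff, if_pos hβ']
        · intro i hi
          rw [hβ' i (Finset.mem_Iio.1 hi), pow_zero]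
      · intro i _ hij
        by_cases hi : α i = 0
        · exact coeff_X_mul_of_eq_zero hi _
        · obtain ⟨β, hβ⟩ := key i hi
          have hji : j < i := lt_of_le_of_ne (Finset.min'_le _ i (by simp [hi])) hij.symm
          rw [hβ] at hα ⊢
          have hβj : β j ≠ 0 := by
            have := hj0
            rw [hβ, Finsupp.add_apply, Finsupp.single_apply, if_neg hij] at this
            omega
          rw [coeff_X_mul_add hα, coeff_ofCoeff, if_neg fun h => hβj (h j hji), smul_zero]
      · simp

/-- The `q`-integer `1 + q + ⋯ + q^(k-1)` for `q = sgn a a`. -/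
def qInt (a : Z2n n) (k : ℕ) : ℤ := ∑ i ∈ Finset.range k, sgn a a ^ i

theorem qInt_add (a : Z2n n) (k l : ℕ) :
    qInt a (k + l) = qInt a k + sgn a a ^ k * qInt a l := by
  simp [qInt, Finset.sum_range_add, pow_add, Finset.mul_sum]

/-- The derivative with respect to the formal variable `ξ_j`. -/
noncomputable def pderivX (j : Fin r) : Series d R →ₗ[ℝ] Series d R where
  -- The derivative crosses the variables before `ξ_j`, which gives `expSign`, and then acts on a
  -- power of `ξ_j`, where each further factor crossed contributes `sgn (d j) (d j)`; these sum up
  -- to the `q`-integer.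
  toFun f := ofCoeff (fun α => (expSign d (Finsupp.single j 1) α * qInt (d j) (α j + 1)) •
      f.coeff (Finsupp.single j 1 + α)) fun α hα => by
    rw [coeff_of_not fun h => hα (h.mono le_add_self), smul_zero]
  map_add' f g := by
    ext α
    exact smul_add _ _ _
  map_smul' t f := by
    ext α
    exact smul_comm _ _ _

theorem coeff_pderivX (j : Fin r) (f : Series d R) (α) :
    (pderivX j f).coeff α = (expSign d (Finsupp.single j 1) α * qInt (d j) (α j + 1)) •
      f.coeff (Finsupp.single j 1 + α) := rfl

theorem IsHomogeneous.pderivX {f : Series d R} {γ : Z2n n} (hf : f.IsHomogeneous γ) (j : Fin r) :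
    (pderivX j f).IsHomogeneous (d j + γ) := fun α hα => by
  rw [coeff_pderivX, hf, smul_zero]
  rintro rfl
  apply hα
  rw [expDegree_add, expDegree_single, ← add_assoc, Z2n.add_self, zero_add]

/-- Reindexing for one half of the product rule: there the summand carries the weight `qInt (d j) (a
j)`, which is zero for `a j = 0`. -/
theorem sum_antidiagonal_add_single {M : Type*} [AddCommMonoid M] (j : Fin r) (δ : Fin r →₀ ℕ)
    (F : (Fin r →₀ ℕ) → (Fin r →₀ ℕ) → M) (hF : ∀ a b, a j = 0 → F a b = 0) :
    ∑ x ∈ Finset.HasAntidiagonal.antidiagonal (Finsupp.single j 1 + δ), F x.1 x.2 =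
      ∑ x ∈ Finset.HasAntidiagonal.antidiagonal δ, F (Finsupp.single j 1 + x.1) x.2 := by
  classical
  symm
  refine Finset.sum_of_injOn (fun x => (Finsupp.single j 1 + x.1, x.2)) ?_ ?_ ?_ ?_
  · rintro ⟨a, b⟩ _ ⟨a', b'⟩ _ h
    simpa using h
  · rintro ⟨a, b⟩ h
    simp only [Finset.mem_coe, Finset.HasAntidiagonal.mem_antidiagonal] at h ⊢
    rw [add_assoc, h]
  · rintro ⟨a, b⟩ h h'
    refine hF a b ?_
    by_contra h0
    have hle : Finsupp.single j 1 ≤ a := by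
      intro l
      rw [Finsupp.single_apply]
      split_ifs with hl
      · subst hl
        omega
      · exact Nat.zero_le _
    refine h' ⟨(a - Finsupp.single j 1, b), ?_, ?_⟩
    · simp only [Finset.mem_coe, Finset.HasAntidiagonal.mem_antidiagonal] at h ⊢
      have : Finsupp.single j 1 + (a - Finsupp.single j 1 + b) = Finsupp.single j 1 + δ := by
        rw [← add_assoc, add_tsub_cancel_of_le hle, h]
      exact add_left_cancel this
    · simp [add_tsub_cancel_of_le hle]
  · rintro ⟨a, b⟩ _
    rfl

theorem sum_antidiagonal_add_single' {M : Type*} [AddCommMonoid M] (j : Fin r) (δ : Fin r →₀ ℕ)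
    (F : (Fin r →₀ ℕ) → (Fin r →₀ ℕ) → M) (hF : ∀ a b, b j = 0 → F a b = 0) :
    ∑ x ∈ Finset.HasAntidiagonal.antidiagonal (Finsupp.single j 1 + δ), F x.1 x.2 =
      ∑ x ∈ Finset.HasAntidiagonal.antidiagonal δ, F x.1 (Finsupp.single j 1 + x.2) := by
  classical
  have e : ∀ (δ : Fin r →₀ ℕ) (F : (Fin r →₀ ℕ) → (Fin r →₀ ℕ) → M),
      ∑ x ∈ Finset.HasAntidiagonal.antidiagonal δ, F x.1 x.2 =
      ∑ x ∈ Finset.HasAntidiagonal.antidiagonal δ, F x.2 x.1 := fun δ F => by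
    rw [← Finset.HasAntidiagonal.map_swap_antidiagonal (n := δ), Finset.sum_map]
    simp [Finset.HasAntidiagonal.map_swap_antidiagonal]
  rw [e, sum_antidiagonal_add_single j δ (fun a b => F b a) (fun a b h => hF b a h),
    e δ fun a b => F b (Finsupp.single j 1 + a)]

/-- The exponent of `ξ_j` in a product of monomials is the sum of two exponents, and `qInt_add`
splits its `q`-integer into the part that differentiates `f` and the part that differentiates `g`.
-/
theorem pderivX_mul (j : Fin r) {f : Series d R} {γ : Z2n n} (hf : f.IsHomogeneous γ)
    (g : Series d R) :
    pderivX j (f * g) = pderivX j f * g + sgn (d j) γ • (f * pderivX j g) := by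
  classical
  refine ext_admissible fun δ hδ => ?_
  set e : Fin r →₀ ℕ := Finsupp.single j 1 with he
  have hej : e j = 1 := by simp [he]
  have e1 : (pderivX j (f * g)).coeff δ = ∑ x ∈ Finset.HasAntidiagonal.antidiagonal (e + δ),
      (expSign d e δ * (qInt (d j) (x.1 j) + sgn (d j) (d j) ^ (x.1 j) * qInt (d j) (x.2 j)) *
        expSign d x.1 x.2) • (f.coeff x.1 * g.coeff x.2) := by
    have hw : ∀ x ∈ Finset.HasAntidiagonal.antidiagonal (e + δ), qInt (d j) (x.1 j) +
        sgn (d j) (d j) ^ (x.1 j) * qInt (d j) (x.2 j) = qInt (d j) (δ j + 1) := by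
      intro x hx
      rw [← qInt_add, ← Finsupp.add_apply, Finset.HasAntidiagonal.mem_antidiagonal.1 hx,
        Finsupp.add_apply, hej, add_comm]
    rw [Finset.sum_congr rfl fun x hx => by rw [hw x hx], coeff_pderivX]
    by_cases ha : AdmissibleExp d (e + δ)
    · rw [coeff_mul _ _ ha, Finset.smul_sum]
      exact Finset.sum_congr rfl fun x _ => by rw [smul_smul]
    -- If `ξ^(e + δ) = 0` although `ξ^δ ≠ 0`, then `ξ_j` squares to zero and already occurs in
    -- `ξ^δ`. The coefficient formula survives because its `q`-integer is `1 - 1 = 0`.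
    · have h1 : d j ⬝ᵥ d j = 1 ∧ δ j = 1 := by
        by_contra h
        refine ha fun i hi => ?_
        rw [Finsupp.add_apply]
        by_cases hij : i = j
        · subst hij
          have := hδ i hi
          have : δ i ≠ 1 := fun h' => h ⟨hi, h'⟩
          omega
        · have : e i = 0 := by simp [he, Ne.symm hij]
          rw [this, zero_add]
          exact hδ i hi
      have h2 : qInt (d j) (δ j + 1) = 0 := by
        simp [h1.2, qInt, Finset.sum_range_succ, sgn_self_eq_neg_one h1.1]
      simp [h2]
  rw [e1, coeff_add, coeff_zsmul, coeff_mul _ _ hδ, coeff_mul _ _ hδ]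
  simp_rw [mul_add, add_mul, add_smul, Finset.sum_add_distrib]
  congr 1
  · rw [sum_antidiagonal_add_single j δ (fun a b => (expSign d e δ * qInt (d j) (a j) *
      expSign d a b) • (f.coeff a * g.coeff b)) (fun a b h => by simp [h, qInt])]
    refine Finset.sum_congr rfl fun x hx => ?_
    rw [coeff_pderivX, smul_mul_assoc, smul_smul,
      ← Finset.HasAntidiagonal.mem_antidiagonal.1 hx, ← he, expSign_add_left, expSign_add_right,
      Finsupp.add_apply, hej, add_comm 1 (x.1 j)]
    congr 1
    linear_combination (expSign d e x.1 * expSign d x.1 x.2 * qInt (d j) (x.1 j + 1)) *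
      expSign_mul_self (d := d) e x.2
  · rw [sum_antidiagonal_add_single' j δ (fun a b => (expSign d e δ * (sgn (d j) (d j) ^ (a j) *
      qInt (d j) (b j)) * expSign d a b) • (f.coeff a * g.coeff b)) (fun a b h => by simp [h, qInt]),
      Finset.smul_sum]
    refine Finset.sum_congr rfl fun x hx => ?_
    -- Only monomials of degree `γ` occur in `f`; for those, moving `ξ_j` across `ξ^x.1` produces
    -- exactly `sgn (d j) γ`.
    by_cases hx1 : expDegree d x.1 = γ
    · rw [coeff_pderivX, mul_smul_comm, smul_smul, smul_smul,
        ← Finset.HasAntidiagonal.mem_antidiagonal.1 hx, ← he, expSign_add_right, expSign_add_right,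
        Finsupp.add_apply, hej, add_comm 1 (x.2 j), ← hx1]
      congr 1
      linear_combination (expSign d e x.2 * expSign d x.1 x.2 * qInt (d j) (x.2 j + 1)) *
        expSign_single_swap (d := d) j x.1
    · simp [hf _ hx1]

theorem pderivX_X_self (j : Fin r) : pderivX j (X j : Series d R) = 1 := by
  classical
  ext α
  rw [coeff_pderivX, coeff_X, coeff_one]
  by_cases h : α = 0
  · subst h
    simp [qInt, expSign_zero_right]
  · simp [h]

theorem pderivX_X_of_ne {i j : Fin r} (h : i ≠ j) : pderivX j (X i : Series d R) = 0 := by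
  classical
  ext α
  rw [coeff_pderivX, coeff_X, if_neg, smul_zero, coeff_zero]
  intro h'
  have := DFunLike.congr_fun h' j
  simp [h] at this

theorem pderivX_C (j : Fin r) (c : R) : pderivX j (C c : Series d R) = 0 := by
  classical
  ext α
  rw [coeff_pderivX, coeff_C, if_neg, smul_zero, coeff_zero]
  intro h'
  have := DFunLike.congr_fun h' j
  simp at this

/-- A derivation of the coefficients, extended to all series. -/
noncomputable def mapDerivation (D : Derivation ℝ R R) : Series d R →ₗ[ℝ] Series d R where
  toFun f := ofCoeff (fun α => D (f.coeff α)) fun α hα => by rw [coeff_of_not hα, map_zero]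
  map_add' f g := by
    ext α
    exact D.map_add _ _
  map_smul' t f := by
    ext α
    exact D.map_smul _ _

theorem coeff_mapDerivation (D : Derivation ℝ R R) (f : Series d R) (α) :
    (mapDerivation D f).coeff α = D (f.coeff α) := rfl

theorem IsHomogeneous.mapDerivation {f : Series d R} {γ : Z2n n} (hf : f.IsHomogeneous γ)
    (D : Derivation ℝ R R) : (mapDerivation D f).IsHomogeneous γ := fun α hα => by
  rw [coeff_mapDerivation, hf α hα, map_zero]

theorem mapDerivation_mul (D : Derivation ℝ R R) (f g : Series d R) :
    mapDerivation D (f * g) = mapDerivation D f * g + f * mapDerivation D g := by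
  refine ext_admissible fun δ hδ => ?_
  rw [coeff_add, coeff_mul _ _ hδ, coeff_mul _ _ hδ, coeff_mapDerivation, coeff_mul _ _ hδ,
    map_sum, ← Finset.sum_add_distrib]
  refine Finset.sum_congr rfl fun x _ => ?_
  rw [map_zsmul, D.leibniz, coeff_mapDerivation, coeff_mapDerivation, smul_add, add_comm,
    smul_eq_mul, smul_eq_mul, mul_comm (g.coeff _)]

theorem mapDerivation_C (D : Derivation ℝ R R) (c : R) :
    mapDerivation D (C c : Series d R) = C (D c) := by
  classical
  ext α
  rw [coeff_mapDerivation, coeff_C, coeff_C]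
  split_ifs <;> simp

theorem mapDerivation_X (D : Derivation ℝ R R) (j : Fin r) :
    mapDerivation D (X j : Series d R) = 0 := by
  classical
  ext α
  rw [coeff_mapDerivation, coeff_X]
  split_ifs <;> simp

/-! ### Change of the coefficient ring -/

section MapCoeff

variable {S : Type*} [CommRing S] [Algebra ℝ S]

@[simp] theorem coeff_mapCoeff (φ : R →+* S) (f : Series d R) (α) :
    (f.mapCoeff φ).coeff α = φ (f.coeff α) := rfl

/-- `mapCoeff` as a ring homomorphism. -/
noncomputable def mapCoeffHom (φ : R →+* S) : Series d R →+* Series d S where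
  toFun := mapCoeff φ
  map_one' := by
    classical
    ext α
    rw [coeff_mapCoeff, coeff_one, coeff_one]
    split_ifs <;> simp
  map_mul' f g := by
    refine ext_admissible fun δ hδ => ?_
    rw [coeff_mapCoeff, coeff_mul _ _ hδ, coeff_mul _ _ hδ, map_sum]
    exact Finset.sum_congr rfl fun x _ => by simp
  map_zero' := by
    ext α
    simp
  map_add' f g := by
    ext α
    simp

theorem mapCoeff_mul (φ : R →+* S) (f g : Series d R) :
    (f * g).mapCoeff φ = f.mapCoeff φ * g.mapCoeff φ := (mapCoeffHom φ).map_mul f g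

theorem mapCoeff_add (φ : R →+* S) (f g : Series d R) :
    (f + g).mapCoeff φ = f.mapCoeff φ + g.mapCoeff φ := (mapCoeffHom φ).map_add f g

theorem mapCoeff_sum {ι : Type*} (s : Finset ι) (φ : R →+* S) (f : ι → Series d R) :
    (∑ i ∈ s, f i).mapCoeff φ = ∑ i ∈ s, (f i).mapCoeff φ := map_sum (mapCoeffHom φ) f s

theorem mapCoeff_C (φ : R →+* S) (c : R) : (C c : Series d R).mapCoeff φ = C (φ c) := by
  classical
  ext α
  rw [coeff_mapCoeff, coeff_C, coeff_C]
  split_ifs <;> simp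

theorem mapCoeff_X (φ : R →+* S) (j : Fin r) : (X j : Series d R).mapCoeff φ = X j := by
  classical
  ext α
  rw [coeff_mapCoeff, coeff_X, coeff_X]
  split_ifs <;> simp

theorem IsHomogeneous.mapCoeff {f : Series d R} {γ : Z2n n} (hf : f.IsHomogeneous γ)
    (φ : R →+* S) : (f.mapCoeff φ).IsHomogeneous γ := fun α hα => by
  rw [coeff_mapCoeff, hf α hα, map_zero]

end MapCoeff

/-! ### Invertible matrices of formal series -/

section Matrix

variable {ι : Type*} [Fintype ι]

/-- This allows an infinite sum to be replaced by a partial sum when a single coefficient of a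
product is computed. -/
theorem coeff_mul_congr {f f' g g' : Series d R} {δ : Fin r →₀ ℕ}
    (hf : ∀ α ≤ δ, f.coeff α = f'.coeff α) (hg : ∀ α ≤ δ, g.coeff α = g'.coeff α) :
    (f * g).coeff δ = (f' * g').coeff δ := by
  by_cases hδ : AdmissibleExp d δ
  · rw [coeff_mul _ _ hδ, coeff_mul _ _ hδ]
    refine Finset.sum_congr rfl fun x hx => ?_
    rw [hf _ (le_self_add.trans_eq (Finset.HasAntidiagonal.mem_antidiagonal.1 hx)),
      hg _ (le_add_self.trans_eq (Finset.HasAntidiagonal.mem_antidiagonal.1 hx))]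
  · rw [coeff_of_not hδ, coeff_of_not hδ]

theorem coeff_matrix_mul_congr {A A' B B' : Matrix ι ι (Series d R)} {δ : Fin r →₀ ℕ}
    (hA : ∀ α ≤ δ, ∀ i j, (A i j).coeff α = (A' i j).coeff α)
    (hB : ∀ α ≤ δ, ∀ i j, (B i j).coeff α = (B' i j).coeff α) (i j : ι) :
    ((A * B) i j).coeff δ = ((A' * B') i j).coeff δ := by
  rw [Matrix.mul_apply, Matrix.mul_apply, coeff_sum, coeff_sum]
  exact Finset.sum_congr rfl fun k _ =>
    coeff_mul_congr (fun α hα => hA α hα i k) (fun α hα => hB α hα k j)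

variable [DecidableEq ι]

/-- Every factor `N` contributes at least one formal variable to each monomial of the product. -/
theorem coeff_matrix_pow_eq_zero {N : Matrix ι ι (Series d R)}
    (hN : ∀ i j, (N i j).coeff 0 = 0) (k : ℕ) (α : Fin r →₀ ℕ) (hα : α.degree < k) (i j : ι) :
    ((N ^ k) i j).coeff α = 0 := by
  induction k generalizing α i j with
  | zero => exact absurd hα (Nat.not_lt_zero _)
  | succ k ih =>
    rw [pow_succ, Matrix.mul_apply, coeff_sum]
    refine Finset.sum_eq_zero fun l _ => ?_
    by_cases had : AdmissibleExp d α
    · rw [coeff_mul _ _ had]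
      refine Finset.sum_eq_zero fun x hx => ?_
      have hx' := Finset.HasAntidiagonal.mem_antidiagonal.1 hx
      by_cases h2 : x.2 = 0
      · rw [h2, hN, mul_zero, smul_zero]
      · have : x.1.degree + x.2.degree = α.degree := by rw [← hx', map_add]
        have h3 : x.2.degree ≠ 0 := fun h => h2 ((Finsupp.degree_eq_zero_iff _).1 h)
        rw [ih x.1 (by omega), zero_mul, smul_zero]
    · exact coeff_of_not had

/-- A matrix of series whose constant terms are those of the identity matrix is invertible. -/
theorem isUnit_one_sub_of_coeff_zero {N : Matrix ι ι (Series d R)}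
    (hN : ∀ i j, (N i j).coeff 0 = 0) : IsUnit (1 - N) := by
  -- Partial sums of the geometric series. The coefficient of `ξ^α` is constant from `K = |α|` on,
  -- so the inverse `T` is the coefficientwise limit, without any topology.
  let P (K : ℕ) : Matrix ι ι (Series d R) := ∑ k ∈ Finset.range (K + 1), N ^ k
  have hP : ∀ α : Fin r →₀ ℕ, ∀ K, α.degree ≤ K → ∀ i j,
      (P α.degree i j).coeff α = (P K i j).coeff α := by
    intro α K hK i j
    obtain ⟨l, rfl⟩ := Nat.exists_eq_add_of_le hK
    clear hK
    induction l with
    | zero => rfl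
    | succ l ih =>
      rw [ih]
      change _ = ((∑ k ∈ Finset.range (α.degree + l + 1 + 1), N ^ k) i j).coeff α
      rw [Finset.sum_range_succ, Matrix.add_apply, coeff_add,
        coeff_matrix_pow_eq_zero hN _ _ (by omega), add_zero]
  let T : Matrix ι ι (Series d R) := fun i j => ofCoeff
    (fun α => (P α.degree i j).coeff α) fun α hα => coeff_of_not hα
  have hT : ∀ δ : Fin r →₀ ℕ, ∀ α ≤ δ, ∀ i j, (T i j).coeff α = (P δ.degree i j).coeff α := by
    intro δ α hα i j
    obtain ⟨β, rfl⟩ := exists_add_of_le hα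
    exact hP α _ (by rw [map_add]; omega) i j
  have key : ∀ δ : Fin r →₀ ℕ, ∀ i j, ((1 - N ^ (δ.degree + 1)) i j).coeff δ =
      ((1 : Matrix ι ι (Series d R)) i j).coeff δ := fun δ i j => by
    rw [Matrix.sub_apply, coeff_sub, coeff_matrix_pow_eq_zero hN _ _ (Nat.lt_succ_self _),
      sub_zero]
  refine ⟨⟨1 - N, T, ?_, ?_⟩, rfl⟩
  · ext i j δ
    rw [coeff_matrix_mul_congr (fun _ _ _ _ => rfl) (hT δ), mul_neg_geom_sum, key]
  · ext i j δ
    rw [coeff_matrix_mul_congr (hT δ) (fun _ _ _ _ => rfl), geom_sum_mul_neg, key]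

/-- A matrix of series is invertible if its matrix of constant terms is. -/
theorem isUnit_matrix_of_isUnit_constCoeff {G : Matrix ι ι (Series d R)}
    (hG : IsUnit (G.map constCoeff)) : IsUnit G := by
  obtain ⟨⟨G₀, H₀, h1, h2⟩, rfl : G₀ = _⟩ := hG
  let c : Matrix ι ι (Series d R) →+* Matrix ι ι R := constCoeff.mapMatrix
  have hone : ∀ N : Matrix ι ι (Series d R), c N = 1 → IsUnit N := fun N hN => by
    have := isUnit_one_sub_of_coeff_zero (N := 1 - N) fun i j => by
      have h : c (1 - N) = 0 := by rw [map_sub, map_one, hN, sub_self]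
      exact congrFun (congrFun h i) j
    rwa [sub_sub_cancel] at this
  -- Series do not commute, so determinants are unavailable. The inverse of the constant terms is
  -- lifted instead: `G * H` and `H * G` have constant term `1`, hence are units, which yields a
  -- right and a left inverse of `G`.
  let H : Matrix ι ι (Series d R) := H₀.map C
  have hH : c H = H₀ := by
    ext i j
    exact coeff_zero_C (d := d) (H₀ i j)
  have u1 : IsUnit (G * H) := hone _ (by rw [map_mul, hH]; exact h1)
  have u2 : IsUnit (H * G) := hone _ (by rw [map_mul, hH]; exact h2)
  obtain ⟨A, hA, _⟩ := isUnit_iff_exists.1 u1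
  obtain ⟨B, _, hB⟩ := isUnit_iff_exists.1 u2
  rw [mul_assoc] at hA
  rw [← mul_assoc] at hB
  exact isUnit_iff_exists_and_exists.2 ⟨⟨_, hA⟩, ⟨_, hB⟩⟩

end Matrix

end Series

end Series

/-! ### Smooth functions on open subsets of `ℝᵖ` -/

section Hadamard

open MeasureTheory

/-- Smooth dependence of `∫₀¹ F(x, t) dt` on the parameter `x`. -/
theorem contDiff_integral_unitInterval {E G : Type*} [NormedAddCommGroup E] [NormedSpace ℝ E]
    [NormedAddCommGroup G] [NormedSpace ℝ G] [CompleteSpace G] {F : E → ℝ → G}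
    (hF : ContDiff ℝ ∞ (fun q : E × ℝ => F q.1 q.2)) :
    ContDiff ℝ ∞ fun x => ∫ t in (0 : ℝ)..1, F x t := by
  -- The integral is the value at `0` of the convolution of the indicator of `(0, 1]` with `t ↦ χ t
  -- • F x (-t)`. The bump is `1` where the indicator sees it and gives the compact support that
  -- smoothness of convolutions with a parameter requires.
  let χ : ContDiffBump (0 : ℝ) := ⟨1, 2, one_pos, one_lt_two⟩
  let f : ℝ → ℝ := Set.indicator (Set.Ioc 0 1) fun _ => 1
  have hf : LocallyIntegrable f volume :=
    (locallyIntegrable_const (1 : ℝ)).indicator measurableSet_Ioc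
  let g : E → ℝ → G := fun x t => χ t • F x (-t)
  have hg : ContDiff ℝ ∞ (fun q : E × ℝ => g q.1 q.2) := by
    refine (χ.contDiff.comp contDiff_snd).smul (hF.comp (contDiff_fst.prodMk contDiff_snd.neg))
  have := contDiffOn_convolution_right_with_param (μ := volume) (f := f) (g := g) (s := Set.univ)
    (n := ⊤) (k := Metric.closedBall 0 2) (ContinuousLinearMap.lsmul ℝ ℝ) isOpen_univ
    (isCompact_closedBall _ _) (fun p x _ hx => by
      have : χ x = 0 := χ.zero_of_le_dist (by
        rw [Metric.mem_closedBall, not_le] at hx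
        exact hx.le)
      simp [g, this]) hf hg.contDiffOn
  rw [Set.univ_prod_univ, contDiffOn_univ] at this
  have h2 := this.comp (contDiff_id.prodMk (contDiff_const (c := (0 : ℝ))) : ContDiff ℝ ∞
    fun x : E => (x, (0 : ℝ)))
  convert h2 using 1
  funext x
  simp only [Function.comp, convolution, ContinuousLinearMap.lsmul_apply]
  rw [intervalIntegral.integral_of_le zero_le_one, ← integral_indicator measurableSet_Ioc]
  congr 1
  funext t
  by_cases ht : t ∈ Set.Ioc (0 : ℝ) 1
  · have h1 : χ (0 - t) = 1 := χ.one_of_mem_closedBall (by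
      simpa [abs_le] using ⟨by linarith [ht.1], ht.2⟩)
    have h3 : f t = 1 := Set.indicator_of_mem ht _
    simp only [Set.indicator_of_mem ht, h3, g]
    erw [h1]
    simp
  · have h3 : f t = 0 := Set.indicator_of_notMem ht _
    simp [Set.indicator_of_notMem ht, h3]

/-- Hadamard's lemma. -/
theorem exists_eq_add_sum_sub_mul {p : ℕ} {F : EuclideanSpace ℝ (Fin p) → ℝ}
    (hF : ContDiff ℝ ∞ F) (c : EuclideanSpace ℝ (Fin p)) :
    ∃ h : Fin p → EuclideanSpace ℝ (Fin p) → ℝ, (∀ i, ContDiff ℝ ∞ (h i)) ∧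
      ∀ x, F x = F c + ∑ i, (x i - c i) * h i x := by
  have hF' : ContDiff ℝ ∞ (fderiv ℝ F) := hF.fderiv_right (by simp)
  have hγ : ContDiff ℝ ∞ fun q : EuclideanSpace ℝ (Fin p) × ℝ => c + q.2 • (q.1 - c) :=
    contDiff_const.add (contDiff_snd.smul (contDiff_fst.sub contDiff_const))
  -- The mean of the derivative over the segment from `c` to `x`; the fundamental theorem of
  -- calculus gives `F x - F c = H x (x - c)`.
  let H := fun x => ∫ t in (0 : ℝ)..1, fderiv ℝ F (c + t • (x - c))
  have hH : ContDiff ℝ ∞ H :=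
    contDiff_integral_unitInterval (F := fun x t => fderiv ℝ F (c + t • (x - c))) (hF'.comp hγ)
  refine ⟨fun i x => H x (EuclideanSpace.single i 1), fun i => hH.clm_apply contDiff_const,
    fun x => ?_⟩
  have hcont : Continuous fun t : ℝ => fderiv ℝ F (c + t • (x - c)) :=
    hF'.continuous.comp (by fun_prop)
  have h1 : F x - F c = H x (x - c) := by
    have hd : ∀ t : ℝ, HasDerivAt (fun t : ℝ => F (c + t • (x - c)))
        (fderiv ℝ F (c + t • (x - c)) (x - c)) t := fun t => by
      have h2 : HasDerivAt (fun t : ℝ => c + t • (x - c)) (x - c) t := by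
        simpa using ((hasDerivAt_id t).smul_const (x - c)).const_add c
      exact ((hF.differentiable (by simp)) _).hasFDerivAt.comp_hasDerivAt t h2
    have := intervalIntegral.integral_eq_sub_of_hasDerivAt (a := 0) (b := 1) (fun t _ => hd t)
      ((hcont.clm_apply continuous_const).intervalIntegrable _ _)
    rw [ContinuousLinearMap.intervalIntegral_apply (hcont.intervalIntegrable _ _), this]
    simp
  have h2 : x - c = ∑ i, (x i - c i) • EuclideanSpace.single i (1 : ℝ) := by
    ext j
    simp [Finset.sum_apply, Pi.single_apply]
  rw [← sub_eq_iff_eq_add', h1]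
  conv_lhs => rw [h2]
  simp [map_sum]

end Hadamard

namespace SmoothFun

variable {p : ℕ} {W : Opens (EuclideanSpace ℝ (Fin p))}

/-- The restriction to `W` of a function that is smooth on `W`. -/
def ofContDiffOn (F : EuclideanSpace ℝ (Fin p) → ℝ) (hF : ContDiffOn ℝ ∞ F W) : SmoothFun W :=
  ⟨fun w => F w, fun w => contMDiffAt_subtype_iff.2
    (hF.contDiffAt (W.isOpen.mem_nhds w.2)).contMDiffAt⟩

@[simp] theorem ofContDiffOn_apply (F : EuclideanSpace ℝ (Fin p) → ℝ) (hF : ContDiffOn ℝ ∞ F W)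
    (w : W) : ofContDiffOn F hF w = F w := rfl

/-- Extension by zero, as a bare function. -/
noncomputable def extend (f : SmoothFun W) : EuclideanSpace ℝ (Fin p) → ℝ :=
  Function.extend Subtype.val f 0

@[simp] theorem extend_coe (f : SmoothFun W) (w : W) : f.extend w = f w :=
  Subtype.val_injective.extend_apply _ _ _

theorem contDiffAt_extend (f : SmoothFun W) (w : W) : ContDiffAt ℝ ∞ f.extend w := by
  rw [← contMDiffAt_iff_contDiffAt, ← contMDiffAt_subtype_iff]
  simpa using f.contMDiff.contMDiffAt

theorem contDiffOn_extend (f : SmoothFun W) : ContDiffOn ℝ ∞ f.extend W :=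
  fun w hw => (f.contDiffAt_extend ⟨w, hw⟩).contDiffWithinAt

theorem extend_eventuallyEq {f : SmoothFun W} {F : EuclideanSpace ℝ (Fin p) → ℝ}
    (h : ∀ w : W, f w = F w) (w : W) : f.extend =ᶠ[nhds (w : EuclideanSpace ℝ (Fin p))] F := by
  filter_upwards [W.isOpen.mem_nhds w.2] with x hx
  rw [← h ⟨x, hx⟩, ← extend_coe]

theorem fderiv_extend {f : SmoothFun W} {F : EuclideanSpace ℝ (Fin p) → ℝ}
    (h : ∀ w : W, f w = F w) (w : W) : fderiv ℝ f.extend w = fderiv ℝ F w :=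
  (extend_eventuallyEq h w).fderiv_eq

theorem differentiableAt_extend (f : SmoothFun W) (w : W) : DifferentiableAt ℝ f.extend w :=
  (f.contDiffAt_extend w).differentiableAt (by simp)

/-- The partial derivative. -/
noncomputable def pderiv (i : Fin p) : Derivation ℝ (SmoothFun W) (SmoothFun W) :=
  Derivation.mk'
    { toFun := fun f => ofContDiffOn (fun x => fderiv ℝ f.extend x (EuclideanSpace.single i 1))
        ((f.contDiffOn_extend.fderiv_of_isOpen W.isOpen (by simp)).clm_apply contDiffOn_const)
      map_add' := fun f g => by
        ext w
        change fderiv ℝ (f + g).extend w _ = fderiv ℝ f.extend w _ + fderiv ℝ g.extend w _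
        rw [fderiv_extend (F := f.extend + g.extend) (fun w => by simp),
          fderiv_add (f.differentiableAt_extend w) (g.differentiableAt_extend w)]
        rfl
      map_smul' := fun t f => by
        ext w
        change fderiv ℝ (t • f).extend w _ = t • fderiv ℝ f.extend w _
        rw [fderiv_extend (F := t • f.extend) (fun w => by simp),
          fderiv_const_smul (f.differentiableAt_extend w)]
        rfl }
    fun f g => by
      ext w
      change fderiv ℝ (f * g).extend w _ =
        f w * fderiv ℝ g.extend w _ + g w * fderiv ℝ f.extend w _
      rw [fderiv_extend (F := f.extend * g.extend) (fun w => by simp),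
        fderiv_mul (f.differentiableAt_extend w) (g.differentiableAt_extend w)]
      simp

theorem pderiv_apply (i : Fin p) (f : SmoothFun W) (w : W) :
    pderiv i f w = fderiv ℝ f.extend w (EuclideanSpace.single i 1) := rfl

/-- The coordinate functions. -/
noncomputable def coord (i : Fin p) : SmoothFun W :=
  ofContDiffOn (fun x => x i) (by fun_prop)

@[simp] theorem coord_apply (i : Fin p) (w : W) : coord i w = (w : EuclideanSpace ℝ (Fin p)) i :=
  rfl

theorem pderiv_coord (i j : Fin p) :
    pderiv i (coord j : SmoothFun W) = if i = j then 1 else 0 := by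
  ext w
  rw [pderiv_apply, fderiv_extend (F := EuclideanSpace.proj (𝕜 := ℝ) j) (fun w => by simp),
    ContinuousLinearMap.fderiv]
  split_ifs with h
  · subst h
    simp
  · simp [h]

/-- Evaluation at a point. -/
noncomputable def eval (w : W) : SmoothFun W →+* ℝ where
  toFun f := f w
  map_one' := rfl
  map_mul' _ _ := rfl
  map_zero' := rfl
  map_add' _ _ := rfl

@[simp] theorem eval_apply (w : W) (f : SmoothFun W) : eval w f = f w := rfl

@[simp] theorem restrict_apply {W' : Opens (EuclideanSpace ℝ (Fin p))} (h : W' ≤ W)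
    (f : SmoothFun W) (w : W') : SmoothFun.restrict h f w = f ⟨w, h w.2⟩ := rfl

theorem isUnit_of_ne_zero {f : SmoothFun W} (hf : ∀ w, f w ≠ 0) : IsUnit f := by
  refine IsUnit.of_mul_eq_one (ofContDiffOn (fun x => (f.extend x)⁻¹)
    (f.contDiffOn_extend.inv fun w hw => ?_)) ?_
  · rw [← Subtype.coe_mk w hw, extend_coe]
    exact hf _
  · ext w
    simp [hf w]

/-- Hadamard's lemma for the product of a smooth function on `W` with a cutoff function. -/
theorem exists_cutoff_mul_eq {ρ : EuclideanSpace ℝ (Fin p) → ℝ} (hρ : ContDiff ℝ ∞ ρ)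
    (hsupp : tsupport ρ ⊆ W) (f : SmoothFun W) (c : W) :
    ∃ h : Fin p → SmoothFun W, ∀ w : W, ρ w * f w =
      ρ c * f c + ∑ i, ((w : EuclideanSpace ℝ (Fin p)) i - (c : EuclideanSpace ℝ (Fin p)) i) *
        h i w := by
  -- The cutoff makes the extension by zero smooth on the whole space, where all segments to `c` are
  -- available.
  have hF : ContDiff ℝ ∞ fun x => ρ x * f.extend x := by
    rw [contDiff_iff_contDiffAt]
    intro x
    by_cases hx : x ∈ W
    · exact hρ.contDiffAt.mul (f.contDiffAt_extend ⟨x, hx⟩)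
    · have h0 : ρ =ᶠ[nhds x] 0 := notMem_tsupport_iff_eventuallyEq.1 fun h => hx (hsupp h)
      refine (contDiffAt_const (c := (0 : ℝ))).congr_of_eventuallyEq ?_
      filter_upwards [h0] with y hy
      simp [hy]
  obtain ⟨h, hh, hsum⟩ := exists_eq_add_sum_sub_mul hF c
  refine ⟨fun i => ofContDiffOn (h i) (hh i).contDiffOn, fun w => ?_⟩
  have := hsum w
  simpa using this

end SmoothFun

/-! ### Sections of `ℤ₂ⁿ`-ringed spaces -/

namespace Z2nRingedSpace

variable {n : ℕ} {S : Z2nRingedSpace.{u, v} n}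

theorem res_congr {U V W : Opens S.carrier} (hVU : V ≤ U) (hWV : W ≤ V) {s t : S.sec U}
    (h : S.res hVU s = S.res hVU t) : S.res (hWV.trans hVU) s = S.res (hWV.trans hVU) t := by
  rw [← S.res_res hVU hWV, h, S.res_res]

/-- Sections that agree locally are equal. -/
theorem sec_ext {U : Opens S.carrier} {s t : S.sec U}
    (h : ∀ m ∈ U, ∃ (V : Opens S.carrier) (hVU : V ≤ U), m ∈ V ∧ S.res hVU s = S.res hVU t) :
    s = t := by
  choose V hVU hm hV using h
  refine (S.existsUnique_glue U (fun m : U => V m.1 m.2) (fun m => hVU _ _)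
    (fun m hmU => Opens.mem_iSup.2 ⟨⟨m, hmU⟩, hm m hmU⟩) (fun m => S.res (hVU m.1 m.2) t)
    fun m m' => by rw [S.res_res, S.res_res]).unique (fun m => hV _ _) fun m => rfl

/-- Gluing of a family of sections over neighbourhoods of the points. -/
theorem exists_glue {U : Opens S.carrier} (V : U → Opens S.carrier) (hVU : ∀ m, V m ≤ U)
    (hm : ∀ m : U, m.1 ∈ V m) (s : ∀ m, S.sec (V m))
    (hs : ∀ m m', S.res (inf_le_left : V m ⊓ V m' ≤ V m) (s m) =
      S.res (inf_le_right : V m ⊓ V m' ≤ V m') (s m')) :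
    ∃ t : S.sec U, ∀ m, S.res (hVU m) t = s m :=
  (S.existsUnique_glue U V hVU (fun m hmU => Opens.mem_iSup.2 ⟨⟨m, hmU⟩, hm ⟨m, hmU⟩⟩) s hs).exists

/-- Extension of a section by zero. -/
theorem exists_extend_zero {U N : Opens S.carrier} (hUN : U ⊔ N = ⊤) (s : S.sec U)
    (hs : S.res (inf_le_left : U ⊓ N ≤ U) s = 0) :
    ∃ t : S.sec ⊤, S.res le_top t = s ∧ S.res (le_top : N ≤ ⊤) t = 0 := by
  classical
  -- The lift is needed because the gluing axiom takes index types in the universe of the points.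
  let W : ULift.{u} Bool → Opens S.carrier := fun b => bif b.down then U else N
  let t : ∀ b, S.sec (W b) := fun b => match b with
    | ⟨true⟩ => s
    | ⟨false⟩ => 0
  have hcov : (⊤ : Opens S.carrier) ≤ ⨆ b, W b := by
    rw [← hUN]
    exact sup_le (le_iSup W ⟨true⟩) (le_iSup W ⟨false⟩)
  obtain ⟨x, hx, -⟩ := S.existsUnique_glue ⊤ W (fun _ => le_top) hcov t (by
    rintro ⟨_ | _⟩ ⟨_ | _⟩
    · rfl
    · change S.res _ (0 : S.sec N) = S.res (inf_le_right : N ⊓ U ≤ U) s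
      rw [map_zero, ← S.res_res (inf_le_left : U ⊓ N ≤ U) (by rw [inf_comm]), hs, map_zero]
    · change S.res (inf_le_left : U ⊓ N ≤ U) s = S.res _ (0 : S.sec N)
      rw [hs, map_zero]
    · rfl)
  exact ⟨x, hx ⟨true⟩, hx ⟨false⟩⟩

theorem sec_ext_of_sup {U N : Opens S.carrier} (hUN : U ⊔ N = ⊤) {s t : S.sec ⊤}
    (hU : S.res (le_top : U ≤ ⊤) s = S.res le_top t)
    (hN : S.res (le_top : N ≤ ⊤) s = S.res le_top t) : s = t := by
  refine sec_ext fun m _ => ?_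
  have : m ∈ U ⊔ N := hUN ▸ Opens.mem_top m
  rcases this with h | h
  exacts [⟨U, le_top, h, hU⟩, ⟨N, le_top, h, hN⟩]

/-- The homogeneous component of a section. -/
noncomputable def proj {U : Opens S.carrier} (a : Z2n n) : S.sec U →ₗ[ℝ] S.sec U :=
  GradedAlgebra.proj (S.grade U) a

variable {U : Opens S.carrier}

theorem proj_mem (a : Z2n n) (s : S.sec U) : proj a s ∈ S.grade U a := by
  rw [proj, GradedAlgebra.proj_apply]
  exact SetLike.coe_mem _

theorem proj_of_mem {a : Z2n n} {s : S.sec U} (h : s ∈ S.grade U a) : proj a s = s := by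
  rw [proj, GradedAlgebra.proj_apply, DirectSum.decompose_of_mem_same _ h]

theorem proj_of_mem_ne {a b : Z2n n} {s : S.sec U} (h : s ∈ S.grade U a) (hab : a ≠ b) :
    proj b s = 0 := by
  rw [proj, GradedAlgebra.proj_apply, DirectSum.decompose_of_mem_ne _ h hab]

theorem sum_proj (s : S.sec U) : ∑ a, proj a s = s := by
  classical
  conv_rhs => rw [← DirectSum.sum_support_decompose (S.grade U) s]
  symm
  refine Finset.sum_subset (Finset.subset_univ _) fun a _ ha => ?_
  simpa using ha

theorem proj_sum_of_mem {t : Z2n n → S.sec U} (ht : ∀ a, t a ∈ S.grade U a) (a : Z2n n) :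
    proj a (∑ b, t b) = t a := by
  rw [map_sum, Finset.sum_eq_single a (fun b _ hb => proj_of_mem_ne (ht b) hb) (by simp),
    proj_of_mem (ht a)]

theorem res_proj {V : Opens S.carrier} (hVU : V ≤ U) (a : Z2n n) (s : S.sec U) :
    S.res hVU (proj a s) = proj a (S.res hVU s) := by
  conv_rhs => rw [← sum_proj s, map_sum, proj_sum_of_mem fun b => S.res_grade hVU b _ (proj_mem b s)]

/-- Homogeneity is a local property. -/
theorem mem_grade_of_local {a : Z2n n} {s : S.sec U}
    (h : ∀ m ∈ U, ∃ (V : Opens S.carrier) (hVU : V ≤ U), m ∈ V ∧ S.res hVU s ∈ S.grade V a) :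
    s ∈ S.grade U a := by
  have : proj a s = s := sec_ext fun m hm => by
    obtain ⟨V, hVU, hmV, hV⟩ := h m hm
    exact ⟨V, hVU, hmV, by rw [res_proj, proj_of_mem hV]⟩
  rw [← this]
  exact proj_mem a s

theorem one_mem_grade : (1 : S.sec U) ∈ S.grade U 0 := SetLike.GradedOne.one_mem

theorem algebraMap_mem_grade (t : ℝ) : algebraMap ℝ (S.sec U) t ∈ S.grade U 0 :=
  SetLike.algebraMap_mem_graded _ t

end Z2nRingedSpace

/-! ### Local models -/

namespace Z2nChart

variable {n : ℕ} {S : Z2nRingedSpace.{u, v} n} {p r : ℕ} {d : Fin r → Z2n n} (c : Z2nChart S p d)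

/-- The coordinate expression of a global section over an open part of the chart. -/
noncomputable def expand (W : Opens (EuclideanSpace ℝ (Fin p)))
    (hW : (W : Set _) ⊆ c.homeo.target) : S.sec ⊤ →ₐ[ℝ] Series d (SmoothFun W) :=
  (c.pullback W hW).symm.toAlgHom.comp (S.res le_top)

theorem expand_eq_iff {W : Opens (EuclideanSpace ℝ (Fin p))}
    {hW : (W : Set _) ⊆ c.homeo.target} {f : S.sec ⊤} {h : Series d (SmoothFun W)} :
    c.expand W hW f = h ↔ S.res le_top f = c.pullback W hW h :=
  (c.pullback W hW).symm_apply_eq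

theorem pullback_expand {W : Opens (EuclideanSpace ℝ (Fin p))}
    {hW : (W : Set _) ⊆ c.homeo.target} (f : S.sec ⊤) :
    c.pullback W hW (c.expand W hW f) = S.res le_top f := (c.expand_eq_iff.1 rfl).symm

theorem expand_eq_expand_iff {W : Opens (EuclideanSpace ℝ (Fin p))}
    {hW : (W : Set _) ⊆ c.homeo.target} {f g : S.sec ⊤} :
    c.expand W hW f = c.expand W hW g ↔
      S.res (le_top : chartPreimage c.homeo W ≤ ⊤) f = S.res le_top g := by
  rw [expand_eq_iff, pullback_expand]

theorem expand_restrict {W W' : Opens (EuclideanSpace ℝ (Fin p))}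
    (hW : (W : Set _) ⊆ c.homeo.target) (hW' : (W' : Set _) ⊆ c.homeo.target) (h : W' ≤ W)
    (f : S.sec ⊤) :
    c.expand W' hW' f = (c.expand W hW f).mapCoeff (SmoothFun.restrict h) := by
  rw [expand_eq_iff, ← c.pullback_res W hW W' hW' h, pullback_expand, S.res_res]

theorem isHomogeneous_expand {W : Opens (EuclideanSpace ℝ (Fin p))}
    (hW : (W : Set _) ⊆ c.homeo.target) {f : S.sec ⊤} {γ : Z2n n} (hf : f ∈ S.grade ⊤ γ) :
    (c.expand W hW f).IsHomogeneous γ := by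
  rw [← c.pullback_grade W hW, pullback_expand]
  exact S.res_grade _ _ _ hf

end Z2nChart

/-- A chart with a pair of concentric balls. -/
structure LocalModel {n : ℕ} (M : Z2nManifold.{u, v} n) where
  /-- the chart -/
  chart : Z2nChart M.toZ2nRingedSpace M.p M.formalDegree
  /-- the centre of the balls -/
  center : EuclideanSpace ℝ (Fin M.p)
  /-- the radius of the smaller ball -/
  radius : ℝ
  radius_pos : 0 < radius
  subset_target : Metric.ball center (3 * radius) ⊆ chart.homeo.target

namespace LocalModel

variable {n : ℕ} {M : Z2nManifold.{u, v} n} (L : LocalModel M)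

/-- The larger ball. -/
def outer : Opens (EuclideanSpace ℝ (Fin M.p)) :=
  ⟨Metric.ball L.center (3 * L.radius), Metric.isOpen_ball⟩

/-- The smaller ball. -/
def inner : Opens (EuclideanSpace ℝ (Fin M.p)) := ⟨Metric.ball L.center L.radius, Metric.isOpen_ball⟩

theorem inner_le_outer : L.inner ≤ L.outer :=
  Metric.ball_subset_ball (by linarith [L.radius_pos])

theorem outer_subset : (L.outer : Set _) ⊆ L.chart.homeo.target := L.subset_target

theorem inner_subset : (L.inner : Set _) ⊆ L.chart.homeo.target :=
  (SetLike.coe_subset_coe.2 L.inner_le_outer).trans L.outer_subset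

theorem center_mem_inner : L.center ∈ L.inner := Metric.mem_ball_self L.radius_pos

/-- The domain of the larger ball. -/
abbrev dom : Opens M.carrier := chartPreimage L.chart.homeo L.outer

/-- The domain of the smaller ball. -/
abbrev core : Opens M.carrier := chartPreimage L.chart.homeo L.inner

theorem core_le_dom : L.core ≤ L.dom := chartPreimage_mono _ L.inner_le_outer

/-- The cutoff function. -/
def bump : ContDiffBump L.center :=
  -- Radii in ratio 1 : 2 : 3: the cutoff is `1` on the smaller ball, and its support is a closed
  -- ball inside the open larger ball.
  ⟨L.radius, 2 * L.radius, L.radius_pos, by linarith [L.radius_pos]⟩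

theorem tsupport_bump : tsupport L.bump ⊆ L.outer := by
  rw [ContDiffBump.tsupport_eq]
  exact Metric.closedBall_subset_ball (by
    change 2 * L.radius < 3 * L.radius
    linarith [L.radius_pos])

theorem bump_eq_one {x : EuclideanSpace ℝ (Fin M.p)} (hx : x ∈ L.inner) : L.bump x = 1 :=
  L.bump.one_of_mem_closedBall (Metric.ball_subset_closedBall hx)

/-- The cutoff function as a smooth function on the larger ball. -/
noncomputable def cutoff : SmoothFun L.outer :=
  SmoothFun.ofContDiffOn L.bump L.bump.contDiff.contDiffOn

/-- The complement of the support of the cutoff function. -/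
def far : Opens M.carrier :=
  ⟨(L.chart.homeo.symm '' tsupport L.bump)ᶜ, by
    rw [isOpen_compl_iff]
    -- Here the Hausdorff property enters: the compact image of the support is closed in all of `M`,
    -- not merely in the chart domain.
    exact (L.bump.hasCompactSupport.isCompact.image_of_continuousOn
      (L.chart.homeo.continuousOn_symm.mono (L.tsupport_bump.trans L.outer_subset))).isClosed⟩

theorem dom_sup_far : L.dom ⊔ L.far = ⊤ := by
  refine top_le_iff.1 fun m _ => ?_
  by_cases h : m ∈ L.chart.homeo.symm '' tsupport L.bump
  · obtain ⟨x, hx, rfl⟩ := h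
    have hx' := L.tsupport_bump hx
    refine Or.inl ⟨L.chart.homeo.map_target (L.outer_subset hx'), ?_⟩
    change L.chart.homeo (L.chart.homeo.symm x) ∈ L.outer
    rwa [L.chart.homeo.right_inv (L.outer_subset hx')]
  · exact Or.inr h

/-- The coordinate expression on the larger ball. -/
noncomputable def onOuter : M.sec ⊤ →ₐ[ℝ] Series M.formalDegree (SmoothFun L.outer) :=
  L.chart.expand L.outer L.outer_subset

/-- The coordinate expression on the smaller ball. -/
noncomputable def onInner : M.sec ⊤ →ₐ[ℝ] Series M.formalDegree (SmoothFun L.inner) :=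
  L.chart.expand L.inner L.inner_subset

theorem onInner_eq (f : M.sec ⊤) :
    L.onInner f = (L.onOuter f).mapCoeff (SmoothFun.restrict L.inner_le_outer) :=
  L.chart.expand_restrict _ _ _ f

theorem onInner_eq_iff {f g : M.sec ⊤} :
    L.onInner f = L.onInner g ↔ M.res (le_top : L.core ≤ ⊤) f = M.res le_top g :=
  L.chart.expand_eq_expand_iff

/-- Since `dom` and `far` cover `M`, a global identity splits into one in coordinates and one away
from the support of the cutoff, where extended sections are zero. -/
theorem hom_ext {f g : M.sec ⊤} (h1 : L.onOuter f = L.onOuter g)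
    (h2 : M.res (le_top : L.far ≤ ⊤) f = M.res le_top g) : f = g :=
  Z2nRingedSpace.sec_ext_of_sup L.dom_sup_far (L.chart.expand_eq_expand_iff.1 h1) h2

/-- On the overlap of `dom` and `far` the cutoff vanishes, so the cut-off series glues with the zero
section. -/
theorem exists_extension (h : Series M.formalDegree (SmoothFun L.outer)) :
    ∃ t : M.sec ⊤, L.onOuter t = Series.C L.cutoff * h ∧
      M.res (le_top : L.far ≤ ⊤) t = 0 := by
  let W₀ : Opens (EuclideanSpace ℝ (Fin M.p)) :=
    ⟨L.outer \ tsupport L.bump, L.outer.isOpen.sdiff (isClosed_tsupport _)⟩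
  have hW₀ : W₀ ≤ L.outer := fun x hx => hx.1
  have hW₀t : (W₀ : Set _) ⊆ L.chart.homeo.target := fun x hx => L.outer_subset hx.1
  have hle : L.dom ⊓ L.far ≤ chartPreimage L.chart.homeo W₀ := by
    rintro m ⟨⟨hm1, hm2⟩, hm3⟩
    refine ⟨hm1, hm2, fun h => hm3 ⟨_, h, L.chart.homeo.left_inv hm1⟩⟩
  obtain ⟨t, ht1, ht2⟩ := Z2nRingedSpace.exists_extend_zero L.dom_sup_far
    (L.chart.pullback L.outer L.outer_subset (Series.C L.cutoff * h)) (by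
      rw [← M.res_res (chartPreimage_mono _ hW₀) hle,
        L.chart.pullback_res _ _ W₀ hW₀t hW₀]
      have : (Series.C L.cutoff * h).mapCoeff (SmoothFun.restrict hW₀) = 0 := by
        ext α w
        have : L.bump w.1 = 0 := image_eq_zero_of_notMem_tsupport w.2.2
        simp [cutoff, this]
      rw [this, map_zero, map_zero])
  exact ⟨t, L.chart.expand_eq_iff.2 ht1, ht2⟩

/-- Multiplication by the cutoff function and extension by zero. -/
noncomputable def extension : Series M.formalDegree (SmoothFun L.outer) →ₗ[ℝ] M.sec ⊤ where
  toFun h := (L.exists_extension h).choose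
  map_add' g h := L.hom_ext
    (by rw [map_add, (L.exists_extension _).choose_spec.1, (L.exists_extension _).choose_spec.1,
      (L.exists_extension _).choose_spec.1, mul_add])
    (by rw [map_add, (L.exists_extension _).choose_spec.2, (L.exists_extension _).choose_spec.2,
      (L.exists_extension _).choose_spec.2, add_zero])
  map_smul' t h := L.hom_ext
    (by rw [map_smul, (L.exists_extension _).choose_spec.1, (L.exists_extension _).choose_spec.1,
      mul_smul_comm, RingHom.id_apply])
    (by rw [map_smul, (L.exists_extension _).choose_spec.2, (L.exists_extension _).choose_spec.2,
      smul_zero])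

theorem onOuter_extension (h : Series M.formalDegree (SmoothFun L.outer)) :
    L.onOuter (L.extension h) = Series.C L.cutoff * h := (L.exists_extension h).choose_spec.1

theorem res_far_extension (h : Series M.formalDegree (SmoothFun L.outer)) :
    M.res (le_top : L.far ≤ ⊤) (L.extension h) = 0 := (L.exists_extension h).choose_spec.2

theorem onInner_extension (h : Series M.formalDegree (SmoothFun L.outer)) :
    L.onInner (L.extension h) = h.mapCoeff (SmoothFun.restrict L.inner_le_outer) := by
  rw [onInner_eq, onOuter_extension]
  ext α w
  simp [cutoff, L.bump_eq_one w.2]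

theorem extension_mem_grade {h : Series M.formalDegree (SmoothFun L.outer)} {γ : Z2n n}
    (hh : h.IsHomogeneous γ) : L.extension h ∈ M.grade ⊤ γ := by
  refine Z2nRingedSpace.mem_grade_of_local fun m _ => ?_
  have : m ∈ L.dom ⊔ L.far := L.dom_sup_far ▸ Opens.mem_top m
  rcases this with hm | hm
  · refine ⟨L.dom, le_top, hm, ?_⟩
    rw [L.chart.expand_eq_iff.1 (L.onOuter_extension h)]
    exact (L.chart.pullback_grade _ _ _ _).2 (hh.C_mul _)
  · refine ⟨L.far, le_top, hm, ?_⟩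
    rw [res_far_extension]
    exact zero_mem _

theorem exists_of_mem_nhds (c : Z2nChart M.toZ2nRingedSpace M.p M.formalDegree)
    {x : EuclideanSpace ℝ (Fin M.p)} (hx : x ∈ c.homeo.target)
    {O : Set (EuclideanSpace ℝ (Fin M.p))} (hO : O ∈ nhds x) :
    ∃ L : LocalModel M, L.chart = c ∧ L.center = x ∧ (L.outer : Set _) ⊆ O := by
  obtain ⟨ε, hε, h⟩ := Metric.mem_nhds_iff.1
    (Filter.inter_mem (c.homeo.open_target.mem_nhds hx) hO)
  refine ⟨⟨c, x, ε / 3, by positivity, ?_⟩, rfl, rfl, ?_⟩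
  · rw [mul_div_cancel₀ _ three_ne_zero]
    exact h.trans Set.inter_subset_left
  · change Metric.ball x (3 * (ε / 3)) ⊆ O
    rw [mul_div_cancel₀ _ three_ne_zero]
    exact h.trans Set.inter_subset_right

/-- Local models exist in every neighbourhood of every point. -/
theorem exists_mem_core {m : M.carrier} {O : Opens M.carrier} (hm : m ∈ O) :
    ∃ L : LocalModel M, L.dom ≤ O ∧ m ∈ L.core ∧ L.chart.homeo m = L.center := by
  obtain ⟨c, hc⟩ := M.exists_chart m
  have hO : c.homeo.target ∩ c.homeo.symm ⁻¹' O ∈ nhds (c.homeo m) :=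
    (c.homeo.isOpen_inter_preimage_symm O.isOpen).mem_nhds
      ⟨c.homeo.map_source hc, by rwa [Set.mem_preimage, c.homeo.left_inv hc]⟩
  obtain ⟨L, rfl, h2, h3⟩ := exists_of_mem_nhds c (c.homeo.map_source hc) hO
  refine ⟨L, fun y hy => ?_, ⟨hc, ?_⟩, h2.symm⟩
  · have := (h3 hy.2).2
    rwa [Set.mem_preimage, L.chart.homeo.left_inv hy.1] at this
  · change L.chart.homeo m ∈ L.inner
    rw [← h2]
    exact L.center_mem_inner

end LocalModel

/-- Cutoff sections. -/
theorem Z2nManifold.exists_cutoff {n : ℕ} (M : Z2nManifold.{u, v} n) {m : M.carrier}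
    {O : Opens M.carrier} (hm : m ∈ O) :
    ∃ χ ∈ M.grade ⊤ 0, ∃ V ≤ O, ∃ N : Opens M.carrier, m ∈ V ∧ O ⊔ N = ⊤ ∧
      M.res (le_top : V ≤ ⊤) χ = 1 ∧ M.res (le_top : N ≤ ⊤) χ = 0 := by
  obtain ⟨L, hL, hmL, -⟩ := LocalModel.exists_mem_core hm
  have h1 : (1 : Series M.formalDegree (SmoothFun L.outer)).IsHomogeneous 0 := by
    classical
    intro α hα
    rw [Series.coeff_one, if_neg]
    rintro rfl
    exact hα (by simp [expDegree])
  refine ⟨L.extension 1, L.extension_mem_grade h1, L.core, L.core_le_dom.trans hL, L.far, hmL,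
    top_le_iff.1 (L.dom_sup_far ▸ sup_le_sup_right hL _), ?_, L.res_far_extension 1⟩
  rw [← map_one (M.res (le_top : L.core ≤ ⊤)), ← L.onInner_eq_iff, L.onInner_extension, map_one]
  exact (Series.mapCoeffHom _).map_one

/-! ### Graded derivations -/

section Derivations

variable {n : ℕ} {A : Type*} [Ring A] [Algebra ℝ A] {𝒜 : Z2n n → Submodule ℝ A}

theorem IsGradedDerivation.zero (γ : Z2n n) : IsGradedDerivation 𝒜 γ (0 : A →ₗ[ℝ] A) where
  map_grade _ _ _ := zero_mem _
  leibniz _ _ _ _ := by simp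

theorem IsGradedDerivation.add {γ : Z2n n} {D E : A →ₗ[ℝ] A} (hD : IsGradedDerivation 𝒜 γ D)
    (hE : IsGradedDerivation 𝒜 γ E) : IsGradedDerivation 𝒜 γ (D + E) where
  map_grade α f hf := add_mem (hD.map_grade α f hf) (hE.map_grade α f hf)
  leibniz α f g hf := by
    simp only [LinearMap.add_apply, hD.leibniz α f g hf, hE.leibniz α f g hf, add_mul, mul_add,
      smul_add]
    abel

theorem IsGradedDerivation.zsmul {γ : Z2n n} {D : A →ₗ[ℝ] A} (k : ℤ)
    (hD : IsGradedDerivation 𝒜 γ D) : IsGradedDerivation 𝒜 γ (k • D) where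
  map_grade α f hf := zsmul_mem (hD.map_grade α f hf) k
  leibniz α f g hf := by
    simp only [LinearMap.smul_apply, hD.leibniz α f g hf, smul_add, smul_mul_assoc,
      mul_smul_comm, smul_comm k]

/-- The graded commutator of graded derivations. -/
theorem IsGradedDerivation.commutator {a b : Z2n n} {D E : A →ₗ[ℝ] A}
    (hD : IsGradedDerivation 𝒜 a D) (hE : IsGradedDerivation 𝒜 b E) :
    IsGradedDerivation 𝒜 (a + b) (D ∘ₗ E - sgn a b • (E ∘ₗ D)) where
  map_grade α f hf := by
    refine sub_mem ?_ (zsmul_mem ?_ _)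
    · rw [add_assoc]
      exact hD.map_grade _ _ (hE.map_grade _ _ hf)
    · rw [add_comm a, add_assoc]
      exact hE.map_grade _ _ (hD.map_grade _ _ hf)
  leibniz α f g hf := by
    simp only [LinearMap.sub_apply, LinearMap.smul_apply, LinearMap.comp_apply,
      hD.leibniz α f _ hf, hE.leibniz α f _ hf, map_add, map_zsmul,
      hD.leibniz _ _ _ (hE.map_grade α f hf), hE.leibniz _ _ _ (hD.map_grade α f hf),
      sgn_add_right, sgn_add_left, sub_mul, mul_sub, smul_mul_assoc, mul_smul_comm, sgn_comm b a]
    rcases sgn_eq_one_or a b with h1 | h1 <;> rcases sgn_eq_one_or a α with h2 | h2 <;>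
      rcases sgn_eq_one_or b α with h3 | h3 <;> simp only [h1, h2, h3, one_smul, neg_smul,
        mul_one, mul_neg, neg_neg] <;> abel

end Derivations

namespace Z2nRingedSpace

variable {n : ℕ} {S : Z2nRingedSpace.{u, v} n} {U : Opens S.carrier}

/-! ### Operations on homogeneous vector fields -/

namespace IsHomVect

variable {a b : Z2n n} {X Y : S.Vect U}

theorem apply_mem (hX : S.IsHomVect X a) {f : S.sec U} (hf : f ∈ S.grade U b) :
    X.1 f ∈ S.grade U (a + b) := IsGradedDerivation.map_grade hX b f hf

theorem leibniz (hX : S.IsHomVect X a) {f : S.sec U} (hf : f ∈ S.grade U b) (g : S.sec U) :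
    X.1 (f * g) = X.1 f * g + sgn a b • (f * X.1 g) := IsGradedDerivation.leibniz hX b f g hf

theorem zero (a : Z2n n) : S.IsHomVect (0 : S.Vect U) a := IsGradedDerivation.zero a

theorem add (hX : S.IsHomVect X a) (hY : S.IsHomVect Y a) : S.IsHomVect (X + Y) a :=
  IsGradedDerivation.add hX hY

theorem zsmul (k : ℤ) (hX : S.IsHomVect X a) : S.IsHomVect (k • X) a := by
  have h : (k • X).1 = k • X.1 := map_zsmul (S.Vect U).subtype k X
  unfold IsHomVect
  rw [h]
  exact IsGradedDerivation.zsmul k hX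

theorem sub (hX : S.IsHomVect X a) (hY : S.IsHomVect Y a) : S.IsHomVect (X - Y) a := by
  have h : (X - Y).1 = X.1 + (-1 : ℤ) • Y.1 := by
    rw [neg_smul, one_smul, ← sub_eq_add_neg]
    rfl
  unfold IsHomVect
  rw [h]
  exact IsGradedDerivation.add hX (IsGradedDerivation.zsmul (-1) hY)

theorem smul {f : S.sec U} (hf : f ∈ S.grade U b) (hX : S.IsHomVect X a) :
    S.IsHomVect (f • X) (b + a) := IsGradedDerivation.smul (S.comm U) hf hX

theorem sum {ι : Type*} {s : Finset ι} {X : ι → S.Vect U} (h : ∀ i ∈ s, S.IsHomVect (X i) a) :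
    S.IsHomVect (∑ i ∈ s, X i) a :=
  Finset.sum_induction X (S.IsHomVect · a) (fun _ _ => add) (zero a) h

end IsHomVect

/-- The homogeneous component of degree `a` of a linear operator. -/
noncomputable def opProj (a : Z2n n) (T : S.sec U →ₗ[ℝ] S.sec U) : S.sec U →ₗ[ℝ] S.sec U :=
  ∑ b, proj (a + b) ∘ₗ T ∘ₗ proj b

theorem opProj_apply_of_mem (a : Z2n n) (T : S.sec U →ₗ[ℝ] S.sec U) {b : Z2n n} {f : S.sec U}
    (hf : f ∈ S.grade U b) : opProj a T f = proj (a + b) (T f) := by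
  simp only [opProj, LinearMap.sum_apply, LinearMap.comp_apply]
  rw [Finset.sum_eq_single b (fun c _ hc => by rw [proj_of_mem_ne hf hc.symm, map_zero, map_zero])
    (by simp), proj_of_mem hf]

theorem opProj_add (a : Z2n n) (T T' : S.sec U →ₗ[ℝ] S.sec U) :
    opProj a (T + T') = opProj a T + opProj a T' := by
  simp [opProj, LinearMap.add_comp, LinearMap.comp_add, Finset.sum_add_distrib]

theorem linearMap_ext_grade {T T' : S.sec U →ₗ[ℝ] S.sec U}
    (h : ∀ b, ∀ f ∈ S.grade U b, T f = T' f) : T = T' := by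
  ext f
  rw [← sum_proj f, map_sum, map_sum]
  exact Finset.sum_congr rfl fun b _ => h b _ (proj_mem b f)

theorem opProj_of_isGradedDerivation {a : Z2n n} {T : S.sec U →ₗ[ℝ] S.sec U}
    (hT : IsGradedDerivation (S.grade U) a T) : opProj a T = T :=
  linearMap_ext_grade fun b f hf => by
    rw [opProj_apply_of_mem a T hf, proj_of_mem (hT.map_grade b f hf)]

theorem opProj_of_isGradedDerivation_ne {a b : Z2n n} {T : S.sec U →ₗ[ℝ] S.sec U}
    (hT : IsGradedDerivation (S.grade U) a T) (hab : a ≠ b) : opProj b T = 0 :=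
  linearMap_ext_grade fun c f hf => by
    rw [opProj_apply_of_mem b T hf, proj_of_mem_ne (hT.map_grade c f hf)
      fun h => hab (add_right_cancel h), LinearMap.zero_apply]

/-- A vector field is a finite sum of homogeneous derivations, and the projection keeps exactly
those of degree `a`. -/
theorem isGradedDerivation_opProj (a : Z2n n) (X : S.Vect U) :
    IsGradedDerivation (S.grade U) a (opProj a X.1) := by
  obtain ⟨X, hX⟩ := X
  change X ∈ AddSubmonoid.closure _ at hX
  induction hX using AddSubmonoid.closure_induction with
  | mem D hD =>
    obtain ⟨γ, hD⟩ := hD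
    by_cases h : γ = a
    · subst h
      simpa only [opProj_of_isGradedDerivation hD]
    · simpa only [opProj_of_isGradedDerivation_ne hD h] using IsGradedDerivation.zero a
  | zero =>
    have : opProj a (0 : S.sec U →ₗ[ℝ] S.sec U) = 0 := by simp [opProj]
    simpa only [this] using IsGradedDerivation.zero a
  | add D E _ _ hD hE =>
    simpa only [opProj_add] using hD.add hE

/-- A homogeneous graded derivation as a vector field. -/
def Vect.of {γ : Z2n n} {D : S.sec U →ₗ[ℝ] S.sec U} (hD : IsGradedDerivation (S.grade U) γ D) :
    S.Vect U := ⟨D, AddSubmonoid.subset_closure ⟨γ, hD⟩⟩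

/-- The homogeneous component of a vector field. -/
noncomputable def vproj (a : Z2n n) : S.Vect U →+ S.Vect U where
  toFun X := Vect.of (isGradedDerivation_opProj a X)
  map_zero' := Subtype.ext (opProj_of_isGradedDerivation (IsGradedDerivation.zero a))
  map_add' X Y := Subtype.ext (opProj_add a X.1 Y.1)

theorem isHomVect_vproj (a : Z2n n) (X : S.Vect U) : S.IsHomVect (vproj a X) a :=
  isGradedDerivation_opProj a X

theorem vproj_apply_of_mem (a : Z2n n) (X : S.Vect U) {b : Z2n n} {f : S.sec U}
    (hf : f ∈ S.grade U b) : (vproj a X).1 f = proj (a + b) (X.1 f) :=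
  opProj_apply_of_mem a X.1 hf

theorem vproj_of_isHom {a : Z2n n} {X : S.Vect U} (hX : S.IsHomVect X a) : vproj a X = X :=
  Subtype.ext (opProj_of_isGradedDerivation hX)

theorem vproj_of_isHom_ne {a b : Z2n n} {X : S.Vect U} (hX : S.IsHomVect X a) (hab : a ≠ b) :
    vproj b X = 0 :=
  Subtype.ext (opProj_of_isGradedDerivation_ne hX hab)

theorem coe_sum_vect {ι : Type*} (s : Finset ι) (X : ι → S.Vect U) (f : S.sec U) :
    (∑ i ∈ s, X i).1 f = ∑ i ∈ s, (X i).1 f := by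
  rw [← Submodule.subtype_apply, map_sum, LinearMap.sum_apply]
  rfl

theorem sum_vproj (X : S.Vect U) : ∑ a, vproj a X = X := by
  refine Subtype.ext (linearMap_ext_grade fun b f hf => ?_)
  rw [coe_sum_vect, Finset.sum_congr rfl fun a _ => vproj_apply_of_mem a X hf,
    Fintype.sum_equiv (Equiv.addRight b) (fun a => proj (a + b) (X.1 f)) (fun a => proj a (X.1 f))
      fun _ => rfl, sum_proj]

/-- Every vector field is a sum of homogeneous ones. -/
theorem vect_induction {P : S.Vect U → Prop} (hom : ∀ a X, S.IsHomVect X a → P X)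
    (add : ∀ X Y, P X → P Y → P (X + Y)) (X : S.Vect U) : P X := by
  rw [← sum_vproj X]
  exact Finset.sum_induction _ P add (hom 0 0 (.zero 0)) fun a _ => hom a _ (isHomVect_vproj a X)

/-- Every section is a sum of homogeneous ones. -/
theorem sec_induction {P : S.sec U → Prop} (hom : ∀ a, ∀ f ∈ S.grade U a, P f)
    (add : ∀ f g, P f → P g → P (f + g)) (f : S.sec U) : P f := by
  rw [← sum_proj f]
  exact Finset.sum_induction _ P add (hom 0 0 (zero_mem _)) fun a _ => hom a _ (proj_mem a f)

@[simp] theorem vect_add_apply (X Y : S.Vect U) (f : S.sec U) :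
    (X + Y).1 f = X.1 f + Y.1 f := rfl

@[simp] theorem vect_sub_apply (X Y : S.Vect U) (f : S.sec U) :
    (X - Y).1 f = X.1 f - Y.1 f := rfl

@[simp] theorem vect_zsmul_apply (k : ℤ) (X : S.Vect U) (f : S.sec U) :
    (k • X).1 f = k • X.1 f := by
  have h : (k • X).1 = k • X.1 := map_zsmul (S.Vect U).subtype k X
  rw [h, LinearMap.smul_apply]

@[simp] theorem vect_smul_apply (g : S.sec U) (X : S.Vect U) (f : S.sec U) :
    (g • X).1 f = g * X.1 f := rfl

@[simp] theorem vect_zero_apply (f : S.sec U) : (0 : S.Vect U).1 f = 0 := rfl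

/-- Degree zero makes the sign trivial, so `X` need not be homogeneous; cutoff sections are used in
this way. -/
theorem vect_leibniz_zero (X : S.Vect U) {f : S.sec U} (hf : f ∈ S.grade U 0) (g : S.sec U) :
    X.1 (f * g) = X.1 f * g + f * X.1 g := by
  induction X using vect_induction with
  | hom a X hX => rw [hX.leibniz hf, sgn_zero_right, one_smul]
  | add X Y hX hY =>
    rw [vect_add_apply, vect_add_apply, vect_add_apply, hX, hY, add_mul, mul_add]
    abel

theorem vect_apply_algebraMap (X : S.Vect U) (t : ℝ) : X.1 (algebraMap ℝ (S.sec U) t) = 0 := by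
  have h1 : X.1 (1 : S.sec U) = 0 := by
    have := vect_leibniz_zero X one_mem_grade (1 : S.sec U)
    rwa [one_mul, mul_one, one_mul, left_eq_add] at this
  rw [Algebra.algebraMap_eq_smul_one, map_smul, h1, smul_zero]

end Z2nRingedSpace

/-! ### Locality -/

namespace Z2nManifold

open Z2nRingedSpace

variable {n : ℕ} {M : Z2nManifold.{u, v} n} {V : Opens M.carrier}

/-- A section vanishes on `V` if its products with cutoff sections supported in `V` do. -/
theorem res_eq_zero_of_cutoff {t : M.sec ⊤}
    (h : ∀ χ ∈ M.grade ⊤ 0, (∃ N : Opens M.carrier, V ⊔ N = ⊤ ∧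
      M.res (le_top : N ≤ ⊤) χ = 0) → ∃ s, χ * t = s ∧ M.res (le_top : V ≤ ⊤) s = 0) :
    M.res (le_top : V ≤ ⊤) t = 0 := by
  refine sec_ext fun m hm => ?_
  obtain ⟨χ, hχ, V', hV', N, hmV', hN, h1, h2⟩ := M.exists_cutoff hm
  refine ⟨V', hV', hmV', ?_⟩
  obtain ⟨s, hs, hs0⟩ := h χ hχ ⟨N, hN, h2⟩
  rw [M.res_res, map_zero, ← one_mul (M.res _ t), ← h1, ← map_mul, hs,
    ← M.res_res (le_top : V ≤ ⊤) hV', hs0, map_zero]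

theorem cutoff_mul_eq_zero {χ f : M.sec ⊤} {N : Opens M.carrier} (hN : V ⊔ N = ⊤)
    (hχ : M.res (le_top : N ≤ ⊤) χ = 0) (hf : M.res (le_top : V ≤ ⊤) f = 0) : χ * f = 0 :=
  sec_ext_of_sup hN (by rw [map_mul, hf, mul_zero, map_zero])
    (by rw [map_mul, hχ, zero_mul, map_zero])

/-- Derivations are local. -/
theorem res_vect_apply_eq_zero (X : M.Vect ⊤) {f : M.sec ⊤}
    (hf : M.res (le_top : V ≤ ⊤) f = 0) : M.res (le_top : V ≤ ⊤) (X.1 f) = 0 := by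
  refine res_eq_zero_of_cutoff fun χ hχ ⟨N, hN, h2⟩ => ⟨-(X.1 χ * f), ?_, ?_⟩
  -- As `χ * f = 0`, the Leibniz rule gives `χ * X f = -(X χ * f)`, and the right-hand side vanishes
  -- where `f` does.
  · have := vect_leibniz_zero X hχ f
    rw [cutoff_mul_eq_zero hN h2 hf, map_zero] at this
    exact (neg_eq_of_add_eq_zero_right this.symm).symm
  · rw [map_neg, map_mul, hf, mul_zero, neg_zero]

theorem res_vect_apply_congr (X : M.Vect ⊤) {f g : M.sec ⊤}
    (h : M.res (le_top : V ≤ ⊤) f = M.res le_top g) :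
    M.res (le_top : V ≤ ⊤) (X.1 f) = M.res le_top (X.1 g) := by
  rw [← sub_eq_zero, ← map_sub, ← map_sub]
  exact res_vect_apply_eq_zero X (by rw [map_sub, h, sub_self])

/-- The vector fields `X` and `Y` agree on `V`. -/
def VectEqOn (V : Opens M.carrier) (X Y : M.Vect ⊤) : Prop :=
  ∀ f, M.res (le_top : V ≤ ⊤) (X.1 f) = M.res le_top (Y.1 f)

/-- Functionals on vector fields that are linear over the sections of degree zero are local. -/
theorem res_functional_congr {φ : M.Vect ⊤ →+ M.sec ⊤}
    (hφ : ∀ f ∈ M.grade ⊤ 0, ∀ X, φ (f • X) = f * φ X) {X Y : M.Vect ⊤} (h : VectEqOn V X Y) :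
    M.res (le_top : V ≤ ⊤) (φ X) = M.res le_top (φ Y) := by
  rw [← sub_eq_zero, ← map_sub, ← map_sub]
  refine res_eq_zero_of_cutoff fun χ hχ ⟨N, hN, h2⟩ => ⟨0, ?_, map_zero _⟩
  have : χ • (X - Y) = 0 := Subtype.ext <| LinearMap.ext fun f => by
    rw [vect_smul_apply, vect_sub_apply]
    exact cutoff_mul_eq_zero hN h2 (by rw [map_sub, h f, sub_self])
  rw [← hφ χ hχ, this, map_zero]

end Z2nManifold

/-! ### Coordinate vector fields -/

/-! ### Order of vanishing of a series -/

section Order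

variable {n r : ℕ} {d : Fin r → Z2n n} {R : Type*} [CommRing R] [Algebra ℝ R]

/-- The series whose coefficients `f_α` lie in `I^(k - |α|)`. -/
def Series.orderGE (d : Fin r → Z2n n) (I : Ideal R) (k : ℕ) : AddSubgroup (Series d R) where
  -- The subtraction is truncated: coefficients with `|α| ≥ k` are unrestricted, since `I ^ 0 = ⊤`.
  carrier := {f | ∀ α, f.coeff α ∈ I ^ (k - α.degree)}
  add_mem' hf hg α := add_mem (hf α) (hg α)
  zero_mem' _ := zero_mem _
  neg_mem' hf α := neg_mem (hf α)

theorem Series.C_mul_mem_orderGE {I : Ideal R} {k : ℕ} {f : Series d R} {c : R} (hc : c ∈ I)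
    (hf : f ∈ orderGE d I k) : C c * f ∈ orderGE d I (k + 1) := fun α => by
  rw [coeff_C_mul]
  refine Ideal.pow_le_pow_right (n := k - α.degree + 1) (by omega) ?_
  rw [pow_succ']
  exact Ideal.mul_mem_mul hc (hf α)

theorem Series.X_mul_mem_orderGE {I : Ideal R} {k : ℕ} {f : Series d R} (j : Fin r)
    (hf : f ∈ orderGE d I k) : X j * f ∈ orderGE d I (k + 1) := fun α => by
  by_cases had : AdmissibleExp d α
  · by_cases h : Finsupp.single j 1 ≤ α
    · obtain ⟨β, rfl⟩ := exists_add_of_le h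
      rw [coeff_X_mul_add had, map_add, Finsupp.degree_single]
      have := zsmul_mem (hf β) (expSign d (Finsupp.single j 1) β)
      rwa [show k - β.degree = k + 1 - (1 + β.degree) by omega] at this
    · rw [X, coeff_monomial_mul_of_not_le _ h]
      exact zero_mem _
  · rw [coeff_of_not had]
    exact zero_mem _

end Order

namespace Series

variable {n p r : ℕ} {d : Fin r → Z2n n} {W : Opens (EuclideanSpace ℝ (Fin p))}

/-- The degrees of the coordinates, ordinary and formal. -/
def coordDegree (d : Fin r → Z2n n) : Fin p ⊕ Fin r → Z2n n := Sum.elim 0 d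

/-- The coordinates, ordinary and formal. -/
noncomputable def coordinate : Fin p ⊕ Fin r → Series d (SmoothFun W) :=
  Sum.elim (fun i => C (SmoothFun.coord i)) X

/-- The coordinate derivations, ordinary and formal. -/
noncomputable def coordDerivation :
    Fin p ⊕ Fin r → Series d (SmoothFun W) →ₗ[ℝ] Series d (SmoothFun W) :=
  Sum.elim (fun i => mapDerivation (SmoothFun.pderiv i)) pderivX

theorem isHomogeneous_coordinate (I : Fin p ⊕ Fin r) :
    (coordinate I : Series d (SmoothFun W)).IsHomogeneous (coordDegree d I) := by
  rcases I with i | j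
  exacts [isHomogeneous_C _, isHomogeneous_X j]

theorem IsHomogeneous.coordDerivation {f : Series d (SmoothFun W)} {γ : Z2n n}
    (hf : f.IsHomogeneous γ) (I : Fin p ⊕ Fin r) :
    (coordDerivation I f).IsHomogeneous (coordDegree d I + γ) := by
  rcases I with i | j
  · have := hf.mapDerivation (SmoothFun.pderiv i)
    rwa [← zero_add γ] at this
  · exact hf.pderivX j

theorem coordDerivation_mul {f : Series d (SmoothFun W)} {γ : Z2n n}
    (hf : f.IsHomogeneous γ) (g : Series d (SmoothFun W)) (I : Fin p ⊕ Fin r) :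
    coordDerivation I (f * g) = coordDerivation I f * g +
      sgn (coordDegree d I) γ • (f * coordDerivation I g) := by
  rcases I with i | j
  · change mapDerivation _ _ = _ * _ + sgn 0 γ • (f * _)
    rw [sgn_zero_left, one_smul]
    exact mapDerivation_mul _ f g
  · exact pderivX_mul j hf g

theorem coordDerivation_coordinate (I J : Fin p ⊕ Fin r) :
    coordDerivation I (coordinate J : Series d (SmoothFun W)) = if I = J then 1 else 0 := by
  rcases I with i | i <;> rcases J with j | j
  · refine (mapDerivation_C _ _).trans ?_
    rw [SmoothFun.pderiv_coord]
    by_cases h : i = j <;> simp [h]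
  · refine (mapDerivation_X _ _).trans ?_
    simp
  · refine (pderivX_C _ _).trans ?_
    simp
  · change pderivX i (X j) = _
    by_cases h : i = j
    · subst h
      simp [pderivX_X_self]
    · rw [pderivX_X_of_ne (Ne.symm h), if_neg (by simpa using h)]

end Series

namespace LocalModel

open Z2nRingedSpace Z2nManifold Series

variable {n : ℕ} {M : Z2nManifold.{u, v} n} (L : LocalModel M)

theorem isHomogeneous_onOuter {f : M.sec ⊤} {γ : Z2n n} (hf : f ∈ M.grade ⊤ γ) :
    (L.onOuter f).IsHomogeneous γ := L.chart.isHomogeneous_expand L.outer_subset hf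

/-- A coordinate derivation times the cutoff is a global derivation: on `dom` the Leibniz rule is
multiplied by the cutoff, which is central, and on `far` all terms are zero. -/
theorem isGradedDerivation_extension_coordDerivation (I : Fin M.p ⊕ Fin M.r) :
    IsGradedDerivation (M.grade ⊤) (coordDegree M.formalDegree I)
      (L.extension ∘ₗ coordDerivation I ∘ₗ L.onOuter.toLinearMap) where
  map_grade _ _ hf :=
    L.extension_mem_grade ((L.isHomogeneous_onOuter hf).coordDerivation I)
  leibniz α f g hf := by
    have hf' := L.isHomogeneous_onOuter hf
    refine L.hom_ext ?_ ?_
    · simp only [LinearMap.comp_apply, AlgHom.toLinearMap_apply, map_add, map_mul, map_zsmul,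
        onOuter_extension]
      rw [coordDerivation_mul hf', mul_add, mul_smul_comm, mul_assoc,
        ← mul_assoc (L.onOuter f), ← C_mul_comm, mul_assoc (C _)]
    · simp only [LinearMap.comp_apply, map_add, map_mul, map_zsmul, res_far_extension, zero_mul,
        mul_zero, smul_zero, add_zero]

/-- The coordinate vector fields, cut off outside of the local model. -/
noncomputable def frame (I : Fin M.p ⊕ Fin M.r) : M.Vect ⊤ :=
  Vect.of (L.isGradedDerivation_extension_coordDerivation I)

/-- The coordinates, cut off outside of the local model. -/
noncomputable def coordSec (I : Fin M.p ⊕ Fin M.r) : M.sec ⊤ := L.extension (coordinate I)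

theorem isHomVect_frame (I : Fin M.p ⊕ Fin M.r) :
    M.IsHomVect (L.frame I) (coordDegree M.formalDegree I) :=
  L.isGradedDerivation_extension_coordDerivation I

theorem coordSec_mem (I : Fin M.p ⊕ Fin M.r) :
    L.coordSec I ∈ M.grade ⊤ (coordDegree M.formalDegree I) :=
  L.extension_mem_grade (isHomogeneous_coordinate I)

theorem onInner_coordSec (I : Fin M.p ⊕ Fin M.r) : L.onInner (L.coordSec I) = coordinate I := by
  rw [coordSec, onInner_extension]
  rcases I with i | j
  exacts [mapCoeff_C _ _, mapCoeff_X _ _]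

theorem restrict_pderiv_cutoff (i : Fin M.p) :
    SmoothFun.restrict L.inner_le_outer (SmoothFun.pderiv i L.cutoff) = 0 := by
  ext w
  rw [SmoothFun.restrict_apply, SmoothFun.pderiv_apply,
    SmoothFun.fderiv_extend (F := fun x => L.bump x) fun _ => rfl]
  have : (fun x => L.bump x) =ᶠ[nhds w.1] fun _ => 1 := L.bump.eventuallyEq_one_of_mem_ball w.2
  rw [this.fderiv_eq]
  simp

/-- On the smaller ball the cutoff is constantly `1`, so its derivative drops out and the duality of
coordinates and coordinate derivations remains. -/
theorem onInner_frame_coordSec (I J : Fin M.p ⊕ Fin M.r) :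
    L.onInner ((L.frame I).1 (L.coordSec J)) = if I = J then 1 else 0 := by
  change L.onInner (L.extension (coordDerivation I (L.onOuter (L.extension (coordinate J))))) = _
  rw [onInner_extension, onOuter_extension, coordDerivation_mul (isHomogeneous_C _),
    sgn_zero_right, one_smul, coordDerivation_coordinate, mapCoeff_add, mapCoeff_mul]
  have h1 : (coordDerivation I (C L.cutoff : Series M.formalDegree _)).mapCoeff
      (SmoothFun.restrict L.inner_le_outer) = 0 := by
    rcases I with i | j
    · have : coordDerivation (Sum.inl i) (C L.cutoff : Series M.formalDegree _) =
          C (SmoothFun.pderiv i L.cutoff) := mapDerivation_C _ _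
      rw [this, mapCoeff_C, restrict_pderiv_cutoff, map_zero]
    · have : coordDerivation (Sum.inr j) (C L.cutoff : Series M.formalDegree _) = 0 :=
        pderivX_C _ _
      rw [this]
      exact (mapCoeffHom _).map_zero
  rw [h1, zero_mul, zero_add]
  split_ifs with h
  · rw [mul_one, mapCoeff_C]
    have : SmoothFun.restrict L.inner_le_outer L.cutoff = 1 := by
      ext w
      simp [cutoff, L.bump_eq_one w.2]
    rw [this, map_one]
  · rw [mul_zero]
    exact (mapCoeffHom _).map_zero

/-- The values of the coordinates at a point. -/
def coordValue (w : EuclideanSpace ℝ (Fin M.p)) : Fin M.p ⊕ Fin M.r → ℝ := Sum.elim (fun i => w i) 0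

/-- First order expansion of a section at a point of the smaller ball. -/
theorem exists_first_order_expansion (f : M.sec ⊤) (w : L.inner) :
    ∃ (c : ℝ) (h : Fin M.p ⊕ Fin M.r → M.sec ⊤), M.res (le_top : L.core ≤ ⊤) f = M.res le_top
      (algebraMap ℝ _ c +
        ∑ I, (L.coordSec I - algebraMap ℝ _ (coordValue w.1 I)) * h I) := by
  let w' : L.outer := ⟨w, L.inner_le_outer w.2⟩
  let F := L.onOuter f
  obtain ⟨h, hh⟩ := SmoothFun.exists_cutoff_mul_eq L.bump.contDiff L.tsupport_bump
    (F.coeff 0) w'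
  -- Hadamard's lemma expands the constant coefficient in the ordinary coordinates; what is left has
  -- no constant term and is a combination of the formal variables.
  obtain ⟨k, hk⟩ := exists_eq_sum_X_mul (C L.cutoff * F - C (L.cutoff * F.coeff 0)) (by simp)
  refine ⟨L.bump w * F.coeff 0 w', Sum.elim (fun i => L.extension (C (h i)))
    (fun j => L.extension (k j)), ?_⟩
  rw [← L.onInner_eq_iff]
  have hF : L.onInner f = (C L.cutoff * F).mapCoeff (SmoothFun.restrict L.inner_le_outer) := by
    rw [onInner_eq]
    ext α x
    simp [F, cutoff, L.bump_eq_one x.2]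
  rw [hF, sub_eq_iff_eq_add'.1 hk, mapCoeff_add, mapCoeff_sum, map_add, map_sum,
    Fintype.sum_sum_type]
  simp only [Sum.elim_inl, Sum.elim_inr, coordValue, Pi.zero_apply, map_zero, sub_zero, map_mul,
    map_sub, AlgHom.commutes, onInner_coordSec, onInner_extension]
  rw [← add_assoc]
  congr 1
  · simp only [algebraMap_eq_C, coordinate, Sum.elim_inl, mapCoeff_C, ← map_sub, ← map_mul,
      ← map_sum, ← map_add]
    congr 1
    ext x
    have := hh ⟨x, L.inner_le_outer x.2⟩
    have hsum : ∀ t : Fin M.p → SmoothFun L.inner, (∑ i, t i) x = ∑ i, t i x := fun t =>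
      map_sum (SmoothFun.eval x) t _
    simp only [SmoothFun.restrict_apply, ContMDiffMap.coe_mul, ContMDiffMap.coe_add,
      ContMDiffMap.coe_sub, Pi.mul_apply, Pi.add_apply, Pi.sub_apply, hsum, SmoothFun.coord_apply]
    exact this
  · exact Finset.sum_congr rfl fun j _ => by rw [mapCoeff_mul, mapCoeff_X]; rfl

/-- A homogeneous derivation that kills all coordinates vanishes. -/
theorem vectEqOn_zero_of_coordSec {a : Z2n n} {X : M.Vect ⊤} (hX : M.IsHomVect X a)
    (h : ∀ I, M.res (le_top : L.core ≤ ⊤) (X.1 (L.coordSec I)) = 0) :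
    VectEqOn L.core X 0 := by
  have h' : ∀ I, L.onInner (X.1 (L.coordSec I)) = 0 := fun I => by
    rw [← map_zero L.onInner, L.onInner_eq_iff, h I, map_zero]
  -- Applying `X` to the first order expansion of `f` at `w` leaves `∑ ± (x_I - x_I(w)) * X (h_I)`,
  -- as `X` kills constants and coordinates. Each first factor raises the order by one, so induction
  -- reaches every order.
  have key : ∀ (w : L.inner) (k : ℕ) (f : M.sec ⊤), L.onInner (X.1 f) ∈
      orderGE M.formalDegree (RingHom.ker (SmoothFun.eval w)) k := by
    intro w k
    induction k with
    | zero => exact fun f α => by simp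
    | succ k ih =>
      intro f
      obtain ⟨c, g, hg⟩ := L.exists_first_order_expansion f w
      rw [L.onInner_eq_iff.2 (res_vect_apply_congr X hg), map_add, vect_apply_algebraMap, zero_add,
        map_sum, map_sum]
      refine sum_mem fun I _ => ?_
      have hmem : L.coordSec I - algebraMap ℝ _ (coordValue w.1 I) ∈
          M.grade ⊤ (coordDegree M.formalDegree I) := by
        refine sub_mem (L.coordSec_mem I) ?_
        rcases I with i | j
        · exact algebraMap_mem_grade _
        · simp [coordValue]
      rw [hX.leibniz hmem, map_sub, vect_apply_algebraMap, sub_zero, map_add, map_mul, h',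
        zero_mul, zero_add, map_zsmul, map_mul, map_sub, onInner_coordSec, AlgHom.commutes]
      refine zsmul_mem ?_ _
      rcases I with i | j
      · have : (coordinate (Sum.inl i) - algebraMap ℝ _ (coordValue w.1 (Sum.inl i)) :
            Series M.formalDegree (SmoothFun L.inner)) =
            C (SmoothFun.coord i - algebraMap ℝ _ (w.1 i)) := by
          rw [algebraMap_eq_C, map_sub]
          rfl
        rw [this]
        refine C_mul_mem_orderGE ?_ (ih _)
        rw [RingHom.mem_ker, SmoothFun.eval_apply]
        change w.1 i - w.1 i = 0
        exact sub_self _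
      · have : (coordinate (Sum.inr j) - algebraMap ℝ _ (coordValue w.1 (Sum.inr j)) :
            Series M.formalDegree (SmoothFun L.inner)) = Series.X j := by
          simp [coordValue, coordinate]
        rw [this]
        exact X_mul_mem_orderGE j (ih _)
  intro f
  rw [vect_zero_apply, ← L.onInner_eq_iff, map_zero]
  ext α w
  -- Order `|α| + 1` places the coefficient of `ξ^α` in the first power of the ideal of `w`, so it
  -- vanishes at the arbitrary point `w`.
  have := key w (α.degree + 1) f α
  rw [Nat.add_sub_cancel_left, pow_one] at this
  exact this

/-- The coordinate vector fields span all vector fields near a point. -/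
theorem vectEqOn_sum_frame (X : M.Vect ⊤) :
    VectEqOn L.core X (∑ I, X.1 (L.coordSec I) • L.frame I) := by
  induction X using vect_induction with
  | hom a X hX =>
    -- The coefficient has degree `a + deg x_I`, the frame field `deg x_I`, and twice a degree is
    -- zero.
    have hS : M.IsHomVect (∑ I, X.1 (L.coordSec I) • L.frame I) a := .sum fun I _ => by
      have := (L.isHomVect_frame I).smul (hX.apply_mem (L.coordSec_mem I))
      rwa [add_assoc, Z2n.add_self, add_zero] at this
    have := L.vectEqOn_zero_of_coordSec (hX.sub hS) fun J => by
      rw [← map_zero (M.res (le_top : L.core ≤ ⊤)), ← L.onInner_eq_iff, vect_sub_apply, map_sub, coe_sum_vect, map_sum,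
        map_zero, sub_eq_zero]
      simp [onInner_frame_coordSec]
    intro f
    have hf := this f
    rwa [vect_sub_apply, map_sub, vect_zero_apply, map_zero, sub_eq_zero] at hf
  | add X Y hX hY =>
    intro f
    simp only [vect_add_apply, add_smul, Finset.sum_add_distrib, map_add, hX f, hY f]

end LocalModel

/-! ### The value of a section at the centre of a local model -/

namespace LocalModel

open Z2nRingedSpace Z2nManifold

variable {n : ℕ} {M : Z2nManifold.{u, v} n} (L : LocalModel M)

/-- The value of a section at the centre. -/
noncomputable def value : M.sec ⊤ →+* ℝ :=
  (SmoothFun.eval ⟨L.center, L.center_mem_inner⟩).comp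
    (Series.constCoeff.comp L.onInner.toRingHom)

theorem value_apply (f : M.sec ⊤) :
    L.value f = (L.onInner f).coeff 0 ⟨L.center, L.center_mem_inner⟩ := rfl

theorem value_congr {f g : M.sec ⊤} (h : M.res (le_top : L.core ≤ ⊤) f = M.res le_top g) :
    L.value f = L.value g := by
  have := L.onInner_eq_iff.2 h
  simp [value_apply, this]

theorem value_algebraMap (t : ℝ) : L.value (algebraMap ℝ _ t) = t := by
  rw [value_apply, AlgHom.commutes, Series.algebraMap_eq_C, Series.coeff_zero_C]
  rfl

/-- The constant monomial has degree zero. -/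
theorem value_of_mem_grade {f : M.sec ⊤} {γ : Z2n n} (hf : f ∈ M.grade ⊤ γ) (hγ : γ ≠ 0) :
    L.value f = 0 := by
  have : (L.onInner f).coeff 0 = 0 := by
    refine L.chart.isHomogeneous_expand L.inner_subset hf 0 ?_
    simpa [expDegree] using hγ.symm
  simp [value_apply, this]

/-- Evaluation factors through any neighbourhood of `m` on which `f` is invertible, and ring
homomorphisms preserve units. This translates `VanishesAt` in the non-degeneracy axiom into real
numbers. -/
theorem value_ne_zero_of_germIsUnit {m : M.carrier} (hm : m ∈ L.core)
    (hc : L.chart.homeo m = L.center) {f : M.sec ⊤} (hf : M.GermIsUnit f m) : L.value f ≠ 0 := by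
  obtain ⟨V, hV, hmV, hu⟩ := hf
  let W : Opens (EuclideanSpace ℝ (Fin M.p)) :=
    ⟨L.inner ∩ (L.chart.homeo.target ∩ L.chart.homeo.symm ⁻¹' V),
      L.inner.isOpen.inter (L.chart.homeo.isOpen_inter_preimage_symm V.isOpen)⟩
  have hW : W ≤ L.inner := fun x hx => hx.1
  have hWt : (W : Set _) ⊆ L.chart.homeo.target := fun x hx => hx.2.1
  have hWV : chartPreimage L.chart.homeo W ≤ V := fun y hy => by
    have := hy.2.2.2
    rwa [Set.mem_preimage, L.chart.homeo.left_inv hy.1] at this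
  have hcW : L.center ∈ W := by
    refine ⟨L.center_mem_inner, L.inner_subset L.center_mem_inner, ?_⟩
    rw [Set.mem_preimage, ← hc, L.chart.homeo.left_inv hm.1]
    exact hmV
  have h1 : IsUnit (L.chart.expand W hWt f) := by
    have := (hu.map (M.res hWV)).map (L.chart.pullback W hWt).symm
    rwa [M.res_res] at this
  have h2 := (h1.map (Series.constCoeff)).map (SmoothFun.eval ⟨L.center, hcW⟩)
  rw [L.chart.expand_restrict L.inner_subset hWt hW] at h2
  exact h2.ne_zero

end LocalModel

/-! ### The pairing -/

namespace RiemannianZ2nMetric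

open Z2nRingedSpace Z2nManifold

variable {n : ℕ} {M : Z2nManifold.{u, v} n} (g : RiemannianZ2nMetric M)

/-- The pairing as a linear map in its first argument. -/
def pairLeft (Y : M.Vect ⊤) : M.Vect ⊤ →ₗ[M.sec ⊤] M.sec ⊤ where
  toFun X := g.pair ⊤ X Y
  map_add' X X' := g.pair_add_left ⊤ X X' Y
  map_smul' f X := g.pair_smul_left ⊤ f X Y

/-- The pairing as an additive map in its second argument. -/
def pairRight (X : M.Vect ⊤) : M.Vect ⊤ →+ M.sec ⊤ :=
  AddMonoidHom.mk' (g.pair ⊤ X) (g.pair_add_right ⊤ X)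

theorem pair_sum_left {ι : Type*} (s : Finset ι) (X : ι → M.Vect ⊤) (Y : M.Vect ⊤) :
    g.pair ⊤ (∑ i ∈ s, X i) Y = ∑ i ∈ s, g.pair ⊤ (X i) Y := map_sum (g.pairLeft Y) X s

theorem pair_sum_right {ι : Type*} (s : Finset ι) (X : M.Vect ⊤) (Y : ι → M.Vect ⊤) :
    g.pair ⊤ X (∑ i ∈ s, Y i) = ∑ i ∈ s, g.pair ⊤ X (Y i) := map_sum (g.pairRight X) Y s

theorem pair_sub_left (X X' Y : M.Vect ⊤) :
    g.pair ⊤ (X - X') Y = g.pair ⊤ X Y - g.pair ⊤ X' Y :=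
  (g.pairLeft Y).toAddMonoidHom.map_sub X X'

theorem pair_smul_right {a b : Z2n n} {X : M.Vect ⊤} (hX : M.IsHomVect X a) {f : M.sec ⊤}
    (hf : f ∈ M.grade ⊤ b) (Y : M.Vect ⊤) :
    g.pair ⊤ X (f • Y) = sgn a b • (f * g.pair ⊤ X Y) := by
  induction Y using vect_induction with
  | hom c Y hY =>
    rw [g.pair_symm ⊤ X _ a (b + c) hX (hY.smul hf), g.pair_smul_left,
      g.pair_symm ⊤ X Y a c hX hY, sgn_add_right, mul_smul_comm, smul_smul]
  | add Y Z hY hZ => rw [smul_add, g.pair_add_right, hY, hZ, g.pair_add_right, mul_add, smul_add]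

theorem pair_smul_right_of_mem_zero (X : M.Vect ⊤) {f : M.sec ⊤} (hf : f ∈ M.grade ⊤ 0)
    (Y : M.Vect ⊤) : g.pair ⊤ X (f • Y) = f * g.pair ⊤ X Y := by
  induction X using vect_induction with
  | hom c X hX => rw [g.pair_smul_right hX hf, sgn_zero_right, one_smul]
  | add X Z hX hZ => rw [g.pair_add_left, g.pair_add_left, hX, hZ, mul_add]

/-- Used to replace a solution of a linear system for the metric by one of its homogeneous
components. -/
theorem proj_pair_left (a b : Z2n n) (X : M.Vect ⊤) {Y : M.Vect ⊤} (hY : M.IsHomVect Y b) :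
    proj (a + b + g.deg) (g.pair ⊤ X Y) = g.pair ⊤ (vproj a X) Y := by
  conv_lhs => rw [← sum_vproj X, g.pair_sum_left]
  rw [map_sum, Finset.sum_eq_single a, proj_of_mem (g.pair_grade _ _ _ _ _ (isHomVect_vproj a X) hY)]
  · exact fun c _ hc => proj_of_mem_ne (g.pair_grade _ _ _ _ _ (isHomVect_vproj c X) hY)
      fun h => hc (add_right_cancel (add_right_cancel h))
  · simp

theorem res_pair_congr_left {V : Opens M.carrier} {X X' : M.Vect ⊤} (h : VectEqOn V X X')
    (Y : M.Vect ⊤) :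
    M.res (le_top : V ≤ ⊤) (g.pair ⊤ X Y) = M.res le_top (g.pair ⊤ X' Y) :=
  res_functional_congr (φ := (g.pairLeft Y).toAddMonoidHom) (fun f _ X => g.pair_smul_left ⊤ f X Y) h

theorem res_pair_congr_right {V : Opens M.carrier} (X : M.Vect ⊤) {Y Y' : M.Vect ⊤}
    (h : VectEqOn V Y Y') :
    M.res (le_top : V ≤ ⊤) (g.pair ⊤ X Y) = M.res le_top (g.pair ⊤ X Y') :=
  res_functional_congr (φ := g.pairRight X) (fun _ hf Y => g.pair_smul_right_of_mem_zero X hf Y) h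

/-- The components of the metric in a local model. -/
noncomputable def gram (L : LocalModel M) : Matrix (Fin M.p ⊕ Fin M.r) (Fin M.p ⊕ Fin M.r) (M.sec ⊤) :=
  fun I J => g.pair ⊤ (L.frame I) (L.frame J)

/-- The matrix of values of the components of the metric is invertible. -/
theorem det_value_gram_ne_zero (L : LocalModel M) {m : M.carrier} (hm : m ∈ L.core)
    (hc : L.chart.homeo m = L.center) : ((g.gram L).map L.value).det ≠ 0 := by
  intro h0
  -- A null vector `w` gives `X = ∑ w_I ∂_I`, whose pairings all vanish at `m`; non-degeneracy then
  -- forces the values `w_J` of `X (x_J)` to be zero.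
  obtain ⟨w, hw, hw0⟩ := Matrix.exists_vecMul_eq_zero_iff.2 h0
  let X : M.Vect ⊤ := ∑ I, algebraMap ℝ (M.sec ⊤) (w I) • L.frame I
  have h1 : ∀ Y, L.value (g.pair ⊤ X Y) = 0 := fun Y => by
    induction Y using vect_induction with
    | hom b Y hY =>
      have h2 : ∀ I, L.value (g.pair ⊤ (L.frame I) Y) =
          ∑ J, L.value (Y.1 (L.coordSec J)) * L.value (g.gram L I J) := fun I => by
        rw [L.value_congr (g.res_pair_congr_right (L.frame I) (L.vectEqOn_sum_frame Y)),
          g.pair_sum_right, map_sum]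
        refine Finset.sum_congr rfl fun J _ => ?_
        have hJ := hY.apply_mem (L.coordSec_mem J)
        rw [g.pair_smul_right (L.isHomVect_frame I) hJ, map_zsmul, map_mul]
        -- Signs disappear at a point: a coefficient of nonzero degree has value zero, and one of
        -- degree zero carries no sign.
        by_cases hb : b + Series.coordDegree M.formalDegree J = 0
        · rw [hb, sgn_zero_right, one_smul]
          rfl
        · rw [L.value_of_mem_grade hJ hb, zero_mul, zero_mul, smul_zero]
      have h3 : ∀ J, ∑ I, w I * L.value (g.gram L I J) = 0 := fun J => congrFun hw0 J
      simp only [X, g.pair_sum_left, g.pair_smul_left, map_sum, map_mul, L.value_algebraMap, h2,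
        Finset.mul_sum]
      rw [Finset.sum_comm]
      refine Finset.sum_eq_zero fun J _ => ?_
      simp_rw [mul_left_comm (w _), ← Finset.mul_sum, h3, mul_zero]
    | add Y Z hY hZ => rw [g.pair_add_right, map_add, hY, hZ, add_zero]
  have h2 := g.nondegenerate ⊤ m trivial X fun Y hY =>
    L.value_ne_zero_of_germIsUnit hm hc hY (h1 Y)
  refine hw (funext fun J => ?_)
  by_contra hJ
  -- Near `m`, `X (x_J)` is the constant `w J`; were it nonzero, the germ would be a unit.
  refine h2 (L.coordSec J) ⟨L.core, le_top, hm, ?_⟩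
  have h3 : M.res (le_top : L.core ≤ ⊤) (X.1 (L.coordSec J)) =
      M.res le_top (algebraMap ℝ _ (w J)) := by
    rw [← L.onInner_eq_iff, coe_sum_vect, map_sum]
    simp [L.onInner_frame_coordSec, Algebra.algebraMap_eq_smul_one]
  rw [h3]
  exact ((isUnit_iff_ne_zero.2 hJ).map (algebraMap ℝ (M.sec ⊤))).map _

/-- Near every point, the matrix of components of the metric is invertible. -/
theorem exists_local_inverse (m : M.carrier) :
    ∃ (L : LocalModel M) (V : Opens M.carrier) (_ : V ≤ L.core)
      (H : Matrix (Fin M.p ⊕ Fin M.r) (Fin M.p ⊕ Fin M.r) (M.sec ⊤)), m ∈ V ∧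
      (H * g.gram L).map (M.res (le_top : V ≤ ⊤)) = 1 ∧
      (g.gram L * H).map (M.res (le_top : V ≤ ⊤)) = 1 := by
  obtain ⟨L, -, hm, hc⟩ := LocalModel.exists_mem_core (Opens.mem_top m)
  -- The constant coefficients commute, so the determinant makes sense there. It is nonzero at the
  -- centre, hence on the larger ball of a smaller model `L'` in the same chart.
  let D : SmoothFun L.inner := (((g.gram L).map L.onInner).map Series.constCoeff).det
  have hD : D.extend L.center ≠ 0 := by
    have h1 := g.det_value_gram_ne_zero L hm hc
    have h2 : ((g.gram L).map L.value) =
        (SmoothFun.eval ⟨L.center, L.center_mem_inner⟩).mapMatrix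
          (((g.gram L).map L.onInner).map Series.constCoeff) := rfl
    rw [h2, ← RingHom.map_det] at h1
    have h3 := SmoothFun.extend_coe D ⟨L.center, L.center_mem_inner⟩
    rw [h3]
    exact h1
  have hO : (L.inner : Set _) ∩ D.extend ⁻¹' {0}ᶜ ∈ nhds L.center :=
    Filter.inter_mem (L.inner.isOpen.mem_nhds L.center_mem_inner)
      ((SmoothFun.contDiffAt_extend D ⟨_, L.center_mem_inner⟩).continuousAt.preimage_mem_nhds
        (isOpen_compl_singleton.mem_nhds hD))
  obtain ⟨ε, hε, hεO⟩ := Metric.mem_nhds_iff.1 hO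
  have h3 : 3 * (ε / 3) = ε := by ring
  let L' : LocalModel M := ⟨L.chart, L.center, ε / 3, by positivity, by
    rw [h3]
    exact fun x hx => L.inner_subset (hεO hx).1⟩
  have hO' : (L'.outer : Set _) ⊆ (L.inner : Set _) ∩ D.extend ⁻¹' {0}ᶜ := by
    change Metric.ball L.center (3 * (ε / 3)) ⊆ _
    rwa [h3]
  have hle : L'.outer ≤ L.inner := fun x hx => (hO' hx).1
  have hres : ∀ f, L'.onOuter f = (L.onInner f).mapCoeff (SmoothFun.restrict hle) := fun f =>
    L.chart.expand_restrict L.inner_subset L'.outer_subset hle f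
  let G' := (g.gram L).map L'.onOuter
  have hG' : IsUnit G' := by
    refine Series.isUnit_matrix_of_isUnit_constCoeff ((Matrix.isUnit_iff_isUnit_det _).2 ?_)
    have h4 : G'.map Series.constCoeff = (SmoothFun.restrict hle).mapMatrix
        (((g.gram L).map L.onInner).map Series.constCoeff) := by
      ext1 I J
      simp [G', hres]
    rw [h4, ← RingHom.map_det]
    refine SmoothFun.isUnit_of_ne_zero fun w => ?_
    have := (hO' w.2).2
    rw [SmoothFun.restrict_apply]
    rwa [Set.mem_preimage, Set.mem_compl_singleton_iff,
      ← Subtype.coe_mk (p := (· ∈ L.inner)) w.1 (hle w.2), SmoothFun.extend_coe] at this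
  obtain ⟨⟨G₀, H', h5, h6⟩, rfl : G₀ = _⟩ := hG'
  have hin : ∀ f, L'.onInner f =
      Series.mapCoeffHom (SmoothFun.restrict L'.inner_le_outer) (L'.onOuter f) := L'.onInner_eq
  have hex : ∀ I J, L'.onInner (L'.extension (H' I J)) =
      Series.mapCoeffHom (SmoothFun.restrict L'.inner_le_outer) (H' I J) := fun I J =>
    L'.onInner_extension _
  have hone : ∀ I J, L'.onInner ((1 : Matrix _ _ (M.sec ⊤)) I J) =
      Series.mapCoeffHom (SmoothFun.restrict L'.inner_le_outer)
        ((1 : Matrix (Fin M.p ⊕ Fin M.r) (Fin M.p ⊕ Fin M.r) _) I J) := fun I J => by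
    rw [Matrix.one_apply, Matrix.one_apply]
    split_ifs <;> simp
  -- The frame stays that of `L`; the smaller model only provides the neighbourhood and the cutoff
  -- that turns the inverse into global sections.
  refine ⟨L, L'.core, chartPreimage_mono _ (L'.inner_le_outer.trans hle), H'.map L'.extension,
    ⟨hm.1, ?_⟩, ?_, ?_⟩
  · change L.chart.homeo m ∈ L'.inner
    rw [hc]
    exact L'.center_mem_inner
  · rw [← Matrix.map_one (M.res (le_top : L'.core ≤ ⊤)) (map_zero _) (map_one _)]
    ext1 I J
    rw [Matrix.map_apply, Matrix.map_apply, ← L'.onInner_eq_iff, hone, ← h6, Matrix.mul_apply,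
      Matrix.mul_apply, map_sum, map_sum]
    exact Finset.sum_congr rfl fun K _ => by
      rw [map_mul, map_mul, Matrix.map_apply, hex, hin]
      rfl
  · rw [← Matrix.map_one (M.res (le_top : L'.core ≤ ⊤)) (map_zero _) (map_one _)]
    ext1 I J
    rw [Matrix.map_apply, Matrix.map_apply, ← L'.onInner_eq_iff, hone, ← h5, Matrix.mul_apply,
      Matrix.mul_apply, map_sum, map_sum]
    exact Finset.sum_congr rfl fun K _ => by
      rw [map_mul, map_mul, Matrix.map_apply, hex, hin]
      rfl

/-- A vector field that pairs to zero with everything vanishes. -/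
theorem vectEqOn_zero_of_pair {V : Opens M.carrier} {X : M.Vect ⊤}
    (h : ∀ Z, M.res (le_top : V ≤ ⊤) (g.pair ⊤ X Z) = 0) : VectEqOn V X 0 := by
  intro f
  refine sec_ext fun m hm => ?_
  obtain ⟨L, V', hV', H, hm', -, hGH⟩ := g.exists_local_inverse m
  let W := V ⊓ V'
  have hWV : W ≤ V := inf_le_left
  have hWL : W ≤ L.core := inf_le_right.trans hV'
  let ρ := M.res (le_top : W ≤ ⊤)
  have hρ : ∀ {s t : M.sec ⊤} {U : Opens M.carrier}, W ≤ U →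
      M.res (le_top : U ≤ ⊤) s = M.res le_top t → ρ s = ρ t := fun hU h => res_congr _ hU h
  -- The row of coefficients of `X` in the frame is annihilated by the Gram matrix, whose right
  -- inverse then shows that it is zero.
  have hc0 : (fun I => ρ (X.1 (L.coordSec I))) ᵥ* (g.gram L).map ρ = 0 := by
    funext J
    have h1 : ρ (g.pair ⊤ X (L.frame J)) = ρ 0 := hρ hWV (by rw [h, map_zero])
    rw [hρ hWL (g.res_pair_congr_left (L.vectEqOn_sum_frame X) _), g.pair_sum_left, map_sum,
      map_zero] at h1
    rw [Pi.zero_apply, ← h1]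
    refine (Finset.sum_congr rfl fun I _ => ?_ :
      ∑ I, ρ (X.1 (L.coordSec I)) * ρ (g.gram L I J) = _)
    rw [g.pair_smul_left, map_mul]
    rfl
  have hGH' : (g.gram L).map ρ * H.map ρ = 1 := by
    rw [← Matrix.map_mul, ← Matrix.map_one ρ (map_zero _) (map_one _)]
    ext1 I J
    refine hρ inf_le_right ?_
    rw [← Matrix.map_apply (f := M.res (le_top : V' ≤ ⊤)), hGH,
      ← Matrix.map_one (M.res (le_top : V' ≤ ⊤)) (map_zero _) (map_one _), Matrix.map_apply]
  have hc : (fun I => ρ (X.1 (L.coordSec I))) = 0 := by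
    rw [← Matrix.vecMul_one (fun I => ρ (X.1 (L.coordSec I))), ← hGH', ← Matrix.vecMul_vecMul,
      hc0, Matrix.zero_vecMul]
  refine ⟨W, hWV, ⟨hm, hm'⟩, ?_⟩
  rw [M.res_res, M.res_res]
  change ρ _ = ρ _
  rw [hρ hWL (L.vectEqOn_sum_frame X f), coe_sum_vect, map_sum, vect_zero_apply, map_zero]
  refine Finset.sum_eq_zero fun I _ => ?_
  rw [vect_smul_apply, map_mul, congrFun hc I, Pi.zero_apply, zero_mul]

theorem vectEqOn_of_pair_left {V : Opens M.carrier} {X Y : M.Vect ⊤}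
    (h : ∀ Z, M.res (le_top : V ≤ ⊤) (g.pair ⊤ X Z) = M.res le_top (g.pair ⊤ Y Z)) :
    VectEqOn V X Y := fun f => by
  have := g.vectEqOn_zero_of_pair (V := V) (X := X - Y) (fun Z => by
    rw [g.pair_sub_left, map_sub, h, sub_self]) f
  rwa [vect_sub_apply, map_sub, vect_zero_apply, map_zero, sub_eq_zero] at this

/-- A common degree ensures that symmetry produces the same sign on both sides. -/
theorem vectEqOn_of_pair_right {V : Opens M.carrier} {X Y : M.Vect ⊤} {a : Z2n n}
    (hX : M.IsHomVect X a) (hY : M.IsHomVect Y a)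
    (h : ∀ Z, M.res (le_top : V ≤ ⊤) (g.pair ⊤ Z X) = M.res le_top (g.pair ⊤ Z Y)) :
    VectEqOn V X Y := by
  refine g.vectEqOn_of_pair_left fun Z => ?_
  induction Z using vect_induction with
  | hom b Z hZ =>
    rw [g.pair_symm _ _ _ _ _ hX hZ, g.pair_symm _ _ _ _ _ hY hZ, map_zsmul, map_zsmul, h]
  | add Z Z' hZ hZ' => rw [g.pair_add_right, g.pair_add_right, map_add, map_add, hZ, hZ']

theorem eq_of_vectEqOn_top {X Y : M.Vect ⊤} (h : VectEqOn ⊤ X Y) : X = Y :=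
  Subtype.ext <| LinearMap.ext fun f => by
    have := h f
    rwa [M.res_self, M.res_self] at this

/-- Local representability of homogeneous functionals. -/
theorem exists_local_representative (φ : M.Vect ⊤ →ₗ[M.sec ⊤] M.sec ⊤) {e : Z2n n}
    (hφ : ∀ b Z, M.IsHomVect Z b → φ Z ∈ M.grade ⊤ (b + e)) (m : M.carrier) :
    ∃ (V : Opens M.carrier) (X : M.Vect ⊤), m ∈ V ∧ M.IsHomVect X (e + g.deg) ∧
      ∀ Z, M.res (le_top : V ≤ ⊤) (g.pair ⊤ Z X) = M.res le_top (φ Z) := by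
  obtain ⟨L, V, hV, H, hm, hHG, -⟩ := g.exists_local_inverse m
  let δ := Series.coordDegree (p := M.p) M.formalDegree
  -- The sign comes from exchanging the frame field with a solution of degree `e + deg g`. After the
  -- exchange the coefficients form a row vector multiplied by the Gram matrix, and `ψ ᵥ* H` solves
  -- the system.
  let ψ : Fin M.p ⊕ Fin M.r → M.sec ⊤ := fun J => sgn (δ J) (e + g.deg) • φ (L.frame J)
  let X₀ : M.Vect ⊤ := ∑ I, (ψ ᵥ* H) I • L.frame I
  let ρ := M.res (le_top : V ≤ ⊤)
  have hX₀ : ∀ J, ρ (g.pair ⊤ X₀ (L.frame J)) = ρ (ψ J) := fun J => by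
    have h1 : g.pair ⊤ X₀ (L.frame J) = ((ψ ᵥ* H) ᵥ* g.gram L) J := by
      rw [g.pair_sum_left]
      change _ = ∑ I, (ψ ᵥ* H) I * g.gram L I J
      exact Finset.sum_congr rfl fun I _ => g.pair_smul_left _ _ _ _
    have h2 : ∀ K, ρ ((H * g.gram L) K J) = (1 : Matrix _ _ (M.sec V)) K J := fun K => by
      rw [← hHG]
      rfl
    rw [h1, Matrix.vecMul_vecMul]
    change ρ (∑ K, ψ K * (H * g.gram L) K J) = _
    simp only [map_sum, map_mul, h2]
    exact congrFun (Matrix.vecMul_one fun K => ρ (ψ K)) J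
  -- `H` is not known to be homogeneous, so `X₀` need not be. Its component of degree `e + deg g`
  -- still solves the system, because the right-hand sides `ψ J` have the matching degree.
  refine ⟨V, vproj (e + g.deg) X₀, hm, isHomVect_vproj _ _, ?_⟩
  have hframe : ∀ J, ρ (g.pair ⊤ (L.frame J) (vproj (e + g.deg) X₀)) = ρ (φ (L.frame J)) := by
    intro J
    have hJ := L.isHomVect_frame J
    have hψ : ψ J ∈ M.grade ⊤ (e + g.deg + δ J + g.deg) := by
      have h3 : e + g.deg + δ J + g.deg = δ J + e := by
        have := Z2n.add_self g.deg
        rw [add_right_comm, add_assoc e, this, add_zero, add_comm]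
      rw [h3]
      exact zsmul_mem (hφ _ _ hJ) _
    rw [g.pair_symm _ _ _ _ _ hJ (isHomVect_vproj _ _), ← g.proj_pair_left _ _ _ hJ, map_zsmul]
    change _ • M.res _ _ = _
    rw [res_proj]
    change _ • proj _ (ρ _) = _
    rw [hX₀]
    change _ • proj _ (M.res _ _) = _
    rw [← res_proj, proj_of_mem hψ, map_zsmul, smul_smul]
    exact (congrArg (· • ρ (φ (L.frame J))) (sgn_mul_self (δ J) (e + g.deg))).trans (one_smul _ _)
  intro Z
  -- Both sides are left linear and local in `Z`, so agreement on the frame suffices.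
  have hZ := fun f => res_congr le_top hV (L.vectEqOn_sum_frame Z f)
  have hφloc : ρ (φ Z) = ρ (φ (∑ I, Z.1 (L.coordSec I) • L.frame I)) :=
    res_functional_congr (φ := φ.toAddMonoidHom) (fun f _ X => φ.map_smul f X) hZ
  change ρ _ = ρ _
  rw [hφloc]
  refine (g.res_pair_congr_left hZ _).trans ?_
  change ρ _ = _
  rw [g.pair_sum_left, map_sum φ, map_sum ρ, map_sum ρ]
  refine Finset.sum_congr rfl fun I _ => ?_
  rw [g.pair_smul_left, map_mul, hframe, map_smul, smul_eq_mul, map_mul]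

/-- Representability of homogeneous functionals on vector fields by the metric. -/
theorem exists_representative (φ : M.Vect ⊤ →ₗ[M.sec ⊤] M.sec ⊤) {e : Z2n n}
    (hφ : ∀ b Z, M.IsHomVect Z b → φ Z ∈ M.grade ⊤ (b + e)) :
    ∃ X : M.Vect ⊤, M.IsHomVect X (e + g.deg) ∧ ∀ Z, g.pair ⊤ Z X = φ Z := by
  choose V X hm hX hXφ using g.exists_local_representative φ hφ
  have hglue : ∀ f : M.sec ⊤, ∃ t : M.sec ⊤, ∀ m : (⊤ : Opens M.carrier),
      M.res (le_top : V m.1 ≤ ⊤) t = M.res le_top ((X m.1).1 f) := fun f =>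
    exists_glue (fun m => V m.1) (fun _ => le_top) (fun m => hm m.1) _ fun m m' => by
      rw [M.res_res, M.res_res]
      -- Two local representatives have the same pairings on the overlap, hence coincide there.
      refine g.vectEqOn_of_pair_right (hX _) (hX _) (fun Z => ?_) f
      rw [res_congr le_top inf_le_left (hXφ m.1 Z), res_congr le_top inf_le_right (hXφ m'.1 Z)]
  choose T hT using hglue
  have ext : ∀ {s t : M.sec ⊤}, (∀ m, M.res (le_top : V m ≤ ⊤) s = M.res le_top t) → s = t :=
    fun h => sec_ext fun m _ => ⟨V m, le_top, hm m, h m⟩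
  have hT' : ∀ f m, M.res (le_top : V m ≤ ⊤) (T f) = M.res le_top ((X m).1 f) :=
    fun f m => hT f ⟨m, trivial⟩
  let D : M.sec ⊤ →ₗ[ℝ] M.sec ⊤ :=
    { toFun := T
      map_add' := fun f h => ext fun m => by simp only [hT', map_add]
      map_smul' := fun t f => ext fun m => by simp only [hT', map_smul, RingHom.id_apply] }
  have hD : IsGradedDerivation (M.grade ⊤) (e + g.deg) D :=
    { map_grade := fun α f hf => mem_grade_of_local fun m _ => ⟨V m, le_top, hm m, by
        change M.res _ (T f) ∈ _
        rw [hT']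
        exact M.res_grade _ _ _ ((hX m).apply_mem hf)⟩
      leibniz := fun α f h hf => ext fun m => by
        change M.res _ (T (f * h)) = M.res _ (T f * h + _ • (f * T h))
        simp only [map_add, map_mul, map_zsmul, hT', (hX m).leibniz hf] }
  refine ⟨Vect.of hD, hD, fun Z => ext fun m => ?_⟩
  rw [← hXφ m Z]
  exact g.res_pair_congr_right Z fun f => hT' f m

end RiemannianZ2nMetric

/-! ### The bracket of vector fields -/

namespace Z2nRingedSpace

variable {n : ℕ} {S : Z2nRingedSpace.{u, v} n} {U : Opens S.carrier}

/-- The graded commutator of vector fields. -/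
noncomputable def bracket (X Y : S.Vect U) : S.Vect U :=
  ∑ a, ∑ b, Vect.of (IsGradedDerivation.commutator (isHomVect_vproj a X) (isHomVect_vproj b Y))

theorem bracket_apply (X Y : S.Vect U) (f : S.sec U) : (bracket X Y).1 f =
    ∑ a, ∑ b, ((vproj a X).1 ((vproj b Y).1 f) - sgn a b • (vproj b Y).1 ((vproj a X).1 f)) := by
  simp only [bracket, coe_sum_vect]
  rfl

theorem vect_ext {X Y : S.Vect U} (h : ∀ f, X.1 f = Y.1 f) : X = Y :=
  Subtype.ext (LinearMap.ext h)

theorem bracket_add_left (X X' Y : S.Vect U) :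
    bracket (X + X') Y = bracket X Y + bracket X' Y := vect_ext fun f => by
  simp only [vect_add_apply, bracket_apply, map_add, ← Finset.sum_add_distrib]
  refine Finset.sum_congr rfl fun a _ => Finset.sum_congr rfl fun b _ => ?_
  rw [smul_add]
  abel

theorem bracket_add_right (X Y Y' : S.Vect U) :
    bracket X (Y + Y') = bracket X Y + bracket X Y' := vect_ext fun f => by
  simp only [vect_add_apply, bracket_apply, map_add, ← Finset.sum_add_distrib]
  refine Finset.sum_congr rfl fun a _ => Finset.sum_congr rfl fun b _ => ?_
  rw [smul_add]
  abel

variable {a b c k : Z2n n} {X Y : S.Vect U} {f : S.sec U}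

theorem bracket_apply_of_isHom (hX : S.IsHomVect X a) (hY : S.IsHomVect Y b) (f : S.sec U) :
    (bracket X Y).1 f = X.1 (Y.1 f) - sgn a b • Y.1 (X.1 f) := by
  rw [bracket_apply, Finset.sum_eq_single a, Finset.sum_eq_single b, vproj_of_isHom hX,
    vproj_of_isHom hY]
  · intro b' _ hb
    simp [vproj_of_isHom_ne hY hb.symm]
  · simp
  · intro a' _ ha
    simp [vproj_of_isHom_ne hX ha.symm]
  · simp

theorem IsHomVect.bracket (hX : S.IsHomVect X a) (hY : S.IsHomVect Y b) :
    S.IsHomVect (bracket X Y) (a + b) := by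
  have : (Z2nRingedSpace.bracket X Y).1 = X.1 ∘ₗ Y.1 - sgn a b • (Y.1 ∘ₗ X.1) :=
    LinearMap.ext (bracket_apply_of_isHom hX hY)
  unfold IsHomVect
  rw [this]
  exact IsGradedDerivation.commutator hX hY

theorem bracket_swap (hX : S.IsHomVect X a) (hY : S.IsHomVect Y b) :
    bracket Y X = (-sgn a b) • bracket X Y := vect_ext fun f => by
  rw [vect_zsmul_apply, bracket_apply_of_isHom hX hY, bracket_apply_of_isHom hY hX,
    sgn_comm b a, smul_sub, smul_smul, neg_mul, sgn_mul_self, neg_smul, neg_smul, one_smul]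
  abel

theorem bracket_smul_right (hX : S.IsHomVect X a) (hY : S.IsHomVect Y b) (hf : f ∈ S.grade U k) :
    bracket X (f • Y) = X.1 f • Y + sgn a k • (f • bracket X Y) := vect_ext fun h => by
  simp only [vect_add_apply, vect_zsmul_apply, vect_smul_apply,
    bracket_apply_of_isHom hX (hY.smul hf), bracket_apply_of_isHom hX hY, hX.leibniz hf, mul_sub,
    smul_sub, mul_smul_comm, smul_smul, sgn_add_right, add_sub_assoc]

theorem bracket_smul_left (hX : S.IsHomVect X a) (hY : S.IsHomVect Y b) (hf : f ∈ S.grade U k) :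
    bracket (f • X) Y = f • bracket X Y - sgn (k + a) b • (Y.1 f • X) := vect_ext fun h => by
  rw [vect_sub_apply, vect_zsmul_apply, vect_smul_apply, vect_smul_apply,
    bracket_apply_of_isHom (hX.smul hf) hY, bracket_apply_of_isHom hX hY, vect_smul_apply,
    vect_smul_apply, hY.leibniz hf, smul_add, smul_smul, sgn_add_left, sgn_comm b k, mul_right_comm,
    sgn_mul_self, one_mul, mul_sub, mul_smul_comm]
  abel

end Z2nRingedSpace

/-! ### The Koszul formula -/

namespace RiemannianZ2nMetric

open Z2nRingedSpace Z2nManifold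

variable {n : ℕ} {M : Z2nManifold.{u, v} n} (g : RiemannianZ2nMetric M)

/-- The right-hand side of the Koszul formula for `2⟨∇_X Y|Z⟩`, for vector fields of degrees
`a`, `b` and `c`. -/
noncomputable def koszul (a b c : Z2n n) (X Y Z : M.Vect ⊤) : M.sec ⊤ :=
  X.1 (g.pair ⊤ Y Z) + sgn a (b + c) • Y.1 (g.pair ⊤ Z X) - sgn c (a + b) • Z.1 (g.pair ⊤ X Y) +
    g.pair ⊤ (bracket X Y) Z - sgn b c • g.pair ⊤ (bracket X Z) Y -
    sgn a (b + c) • g.pair ⊤ (bracket Y Z) X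

/-! ### Algebra of the Koszul expression -/

variable {a b c k : Z2n n}

/-- With the degrees as separate parameters, additivity holds for inhomogeneous fields too, so the
expression can be summed over homogeneous components. -/
theorem koszul_add_left (X X' Y Z : M.Vect ⊤) :
    g.koszul a b c (X + X') Y Z = g.koszul a b c X Y Z + g.koszul a b c X' Y Z := by
  simp only [koszul, vect_add_apply, g.pair_add_left, g.pair_add_right, bracket_add_left, map_add,
    smul_add]
  abel

theorem koszul_add_mid (X Y Y' Z : M.Vect ⊤) :
    g.koszul a b c X (Y + Y') Z = g.koszul a b c X Y Z + g.koszul a b c X Y' Z := by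
  simp only [koszul, vect_add_apply, g.pair_add_left, g.pair_add_right, bracket_add_left,
    bracket_add_right, map_add, smul_add]
  abel

theorem koszul_add_right (X Y Z Z' : M.Vect ⊤) :
    g.koszul a b c X Y (Z + Z') = g.koszul a b c X Y Z + g.koszul a b c X Y Z' := by
  simp only [koszul, vect_add_apply, g.pair_add_left, g.pair_add_right, bracket_add_right, map_add,
    smul_add]
  abel

theorem koszul_zero_left (Y Z : M.Vect ⊤) : g.koszul a b c 0 Y Z = 0 := by
  have := g.koszul_add_left (a := a) (b := b) (c := c) 0 0 Y Z
  rwa [add_zero, left_eq_add] at this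

theorem koszul_zero_mid (X Z : M.Vect ⊤) : g.koszul a b c X 0 Z = 0 := by
  have := g.koszul_add_mid (a := a) (b := b) (c := c) X 0 0 Z
  rwa [add_zero, left_eq_add] at this

theorem koszul_zero_right (X Y : M.Vect ⊤) : g.koszul a b c X Y 0 = 0 := by
  have := g.koszul_add_right (a := a) (b := b) (c := c) X Y 0 0
  rwa [add_zero, left_eq_add] at this

theorem pair_zsmul_left (j : ℤ) (X Y : M.Vect ⊤) :
    g.pair ⊤ (j • X) Y = j • g.pair ⊤ X Y :=
  (g.pairLeft Y).toAddMonoidHom.map_zsmul j X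

variable {X Y Z : M.Vect ⊤} {f : M.sec ⊤}

theorem koszul_mem_grade (hX : M.IsHomVect X a) (hY : M.IsHomVect Y b) (hZ : M.IsHomVect Z c) :
    g.koszul a b c X Y Z ∈ M.grade ⊤ (a + b + c + g.deg) := by
  have e1 : a + (b + c + g.deg) = a + b + c + g.deg := by abel
  have e2 : b + (c + a + g.deg) = a + b + c + g.deg := by abel
  have e3 : c + (a + b + g.deg) = a + b + c + g.deg := by abel
  have e4 : a + c + b + g.deg = a + b + c + g.deg := by abel
  have e5 : b + c + a + g.deg = a + b + c + g.deg := by abel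
  refine sub_mem (sub_mem (add_mem (sub_mem (add_mem ?_ ?_) ?_) ?_) ?_) ?_
  · exact e1 ▸ hX.apply_mem (g.pair_grade ⊤ _ _ _ _ hY hZ)
  · exact zsmul_mem (e2 ▸ hY.apply_mem (g.pair_grade ⊤ _ _ _ _ hZ hX)) _
  · exact zsmul_mem (e3 ▸ hZ.apply_mem (g.pair_grade ⊤ _ _ _ _ hX hY)) _
  · exact g.pair_grade ⊤ _ _ _ _ (hX.bracket hY) hZ
  · exact zsmul_mem (e4 ▸ g.pair_grade ⊤ _ _ _ _ (hX.bracket hZ) hY) _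
  · exact zsmul_mem (e5 ▸ g.pair_grade ⊤ _ _ _ _ (hY.bracket hZ) hX) _

/-- The terms with `Y f` and `Z f` arise once from differentiating the metric and once from a
bracket, with opposite signs. -/
theorem koszul_smul_left (hX : M.IsHomVect X a) (hY : M.IsHomVect Y b) (hZ : M.IsHomVect Z c)
    (hf : f ∈ M.grade ⊤ k) :
    g.koszul (k + a) b c (f • X) Y Z = f * g.koszul a b c X Y Z := by
  simp only [koszul, bracket_smul_left hX hY hf, bracket_smul_left hX hZ hf, vect_smul_apply,
    g.pair_smul_right hZ hf, g.pair_smul_right (hY.bracket hZ) hf, g.pair_smul_left,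
    g.pair_sub_left, g.pair_zsmul_left, map_zsmul, hY.leibniz hf, hZ.leibniz hf, sgn_add_left,
    sgn_add_right, g.pair_symm ⊤ Z X c a hZ hX, sgn_comm c a, sgn_comm c b, sgn_comm b k,
    sgn_comm c k, mul_add, mul_sub, mul_smul_comm]
  -- Bilinearity reduces all signs to five independent ones; for each choice of `±1` the identity is
  -- one of abelian groups.
  rcases sgn_eq_one_or a b with h1 | h1 <;> rcases sgn_eq_one_or a c with h2 | h2 <;>
    rcases sgn_eq_one_or b c with h3 | h3 <;> rcases sgn_eq_one_or k b with h4 | h4 <;>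
    rcases sgn_eq_one_or k c with h5 | h5 <;>
    simp only [h1, h2, h3, h4, h5, mul_neg, mul_one, neg_neg, one_smul, neg_smul] <;> abel

/-- The terms with `Z f` cancel, while `X f` comes with the same sign from `X⟨fY|Z⟩` and from `[X,
fY]`; this doubled term becomes the Leibniz rule. -/
theorem koszul_smul_mid (hX : M.IsHomVect X a) (hY : M.IsHomVect Y b) (hZ : M.IsHomVect Z c)
    (hf : f ∈ M.grade ⊤ k) :
    g.koszul a (k + b) c X (f • Y) Z = X.1 f * g.pair ⊤ Y Z + X.1 f * g.pair ⊤ Y Z +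
      sgn a k • (f * g.koszul a b c X Y Z) := by
  simp only [koszul, bracket_smul_left hY hZ hf, bracket_smul_right hX hY hf, vect_smul_apply,
    g.pair_smul_right hX hf, g.pair_smul_right (hX.bracket hZ) hf, g.pair_smul_left,
    g.pair_sub_left, g.pair_add_left, g.pair_zsmul_left, map_zsmul, hX.leibniz hf, hZ.leibniz hf,
    sgn_add_left, sgn_add_right, g.pair_symm ⊤ Y X b a hY hX, sgn_comm c a, sgn_comm c b,
    sgn_comm b a, sgn_comm a k, sgn_comm c k, mul_add, mul_sub, mul_smul_comm]
  rcases sgn_eq_one_or a b with h1 | h1 <;> rcases sgn_eq_one_or a c with h2 | h2 <;>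
    rcases sgn_eq_one_or b c with h3 | h3 <;> rcases sgn_eq_one_or k a with h4 | h4 <;>
    rcases sgn_eq_one_or k c with h5 | h5 <;>
    simp only [h1, h2, h3, h4, h5, mul_neg, mul_one, neg_neg, one_smul, neg_smul] <;> abel

/-- The terms with `X f` and `Y f` cancel against those of the brackets; the remaining sign is that
of moving `f` past `X` and `Y`. -/
theorem koszul_smul_right (hX : M.IsHomVect X a) (hY : M.IsHomVect Y b) (hZ : M.IsHomVect Z c)
    (hf : f ∈ M.grade ⊤ k) :
    g.koszul a b (k + c) X Y (f • Z) = sgn k (a + b) • (f * g.koszul a b c X Y Z) := by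
  simp only [koszul, bracket_smul_right hX hZ hf, bracket_smul_right hY hZ hf, vect_smul_apply,
    g.pair_smul_right hY hf, g.pair_smul_right (hX.bracket hY) hf, g.pair_smul_left,
    g.pair_add_left, g.pair_zsmul_left, map_zsmul, hX.leibniz hf, hY.leibniz hf, sgn_add_left,
    sgn_add_right, g.pair_symm ⊤ Z Y c b hZ hY, sgn_comm c a, sgn_comm c b, sgn_comm a k,
    sgn_comm b k, mul_add, mul_sub, mul_smul_comm]
  rcases sgn_eq_one_or a b with h1 | h1 <;> rcases sgn_eq_one_or a c with h2 | h2 <;>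
    rcases sgn_eq_one_or b c with h3 | h3 <;> rcases sgn_eq_one_or k a with h4 | h4 <;>
    rcases sgn_eq_one_or k b with h5 | h5 <;>
    simp only [h1, h2, h3, h4, h5, mul_neg, mul_one, neg_neg, one_smul, neg_smul] <;> abel

/-- Graded antisymmetrization in `X, Y` cancels all terms except the one with `[X, Y]`. -/
theorem koszul_torsion (hX : M.IsHomVect X a) (hY : M.IsHomVect Y b) (hZ : M.IsHomVect Z c) :
    g.koszul a b c X Y Z - sgn a b • g.koszul b a c Y X Z =
      g.pair ⊤ (bracket X Y) Z + g.pair ⊤ (bracket X Y) Z := by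
  simp only [koszul, bracket_swap hX hY, g.pair_symm ⊤ Z X c a hZ hX, g.pair_symm ⊤ Z Y c b hZ hY,
    g.pair_symm ⊤ Y X b a hY hX, g.pair_zsmul_left, map_zsmul, sgn_add_right,
    sgn_comm c a, sgn_comm c b, sgn_comm b a]
  rcases sgn_eq_one_or a b with h1 | h1 <;> rcases sgn_eq_one_or a c with h2 | h2 <;>
    rcases sgn_eq_one_or b c with h3 | h3 <;>
    simp only [h1, h2, h3, mul_neg, mul_one, neg_neg, one_smul, neg_smul] <;> abel

/-- Graded symmetrization in `Y, Z` cancels all terms except the derivative along `X`. -/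
theorem koszul_compatible (hX : M.IsHomVect X a) (hY : M.IsHomVect Y b) (hZ : M.IsHomVect Z c) :
    g.koszul a b c X Y Z + sgn b c • g.koszul a c b X Z Y =
      X.1 (g.pair ⊤ Y Z) + X.1 (g.pair ⊤ Y Z) := by
  simp only [koszul, bracket_swap hY hZ, g.pair_symm ⊤ Z X c a hZ hX, g.pair_symm ⊤ Z Y c b hZ hY,
    g.pair_symm ⊤ Y X b a hY hX, g.pair_zsmul_left, map_zsmul, sgn_add_right,
    sgn_comm c a, sgn_comm c b, sgn_comm b a]
  rcases sgn_eq_one_or a b with h1 | h1 <;> rcases sgn_eq_one_or a c with h2 | h2 <;>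
    rcases sgn_eq_one_or b c with h3 | h3 <;>
    simp only [h1, h2, h3, mul_neg, mul_one, neg_neg, one_smul, neg_smul] <;> abel

/-! ### Existence: the Levi-Civita operator -/

theorem _root_.add_self_injective_of_real {E : Type*} [AddCommGroup E] [Module ℝ E] {x y : E}
    (h : x + x = y + y) : x = y := by
  rw [← two_smul ℝ, ← two_smul ℝ y] at h
  exact smul_right_injective E (two_ne_zero (α := ℝ)) h

/-- Vector fields with the same pairings with homogeneous vector fields are equal. -/
theorem ext_pair_left {V W : M.Vect ⊤}
    (h : ∀ c Z, M.IsHomVect Z c → g.pair ⊤ V Z + g.pair ⊤ V Z = g.pair ⊤ W Z + g.pair ⊤ W Z) :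
    V = W := by
  refine eq_of_vectEqOn_top (g.vectEqOn_of_pair_left fun Z => congrArg _ ?_)
  induction Z using vect_induction with
  | hom c Z hZ => exact add_self_injective_of_real (h c Z hZ)
  | add Z Z' hZ hZ' => rw [g.pair_add_right, g.pair_add_right, hZ, hZ']

/-- The functional `2⟨-|∇_X Y⟩` for vector fields `X` and `Y` of degrees `a` and `b`. -/
noncomputable def koszulFunctional (a b : Z2n n) (X Y : M.Vect ⊤) : M.Vect ⊤ →+ M.sec ⊤ :=
  AddMonoidHom.mk' (fun Z => ∑ c, sgn c (a + b) • g.koszul a b c X Y (vproj c Z)) fun Z Z' => by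
    simp only [map_add, koszul_add_right, smul_add, Finset.sum_add_distrib]

theorem koszulFunctional_apply (X Y : M.Vect ⊤) (hZ : M.IsHomVect Z c) :
    g.koszulFunctional a b X Y Z = sgn c (a + b) • g.koszul a b c X Y Z := by
  change ∑ c, sgn c (a + b) • g.koszul a b c X Y (vproj c Z) = _
  rw [Finset.sum_eq_single c, vproj_of_isHom hZ]
  · intro c' _ hc
    rw [vproj_of_isHom_ne hZ hc.symm, koszul_zero_right, smul_zero]
  · simp

/-- The sign `sgn c (a + b)` in the functional turns `⟨∇_X Y|Z⟩` into `⟨Z|∇_X Y⟩` and so absorbs the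
sign of `koszul_smul_right`. -/
theorem koszulFunctional_smul (hX : M.IsHomVect X a) (hY : M.IsHomVect Y b) (f : M.sec ⊤)
    (Z : M.Vect ⊤) :
    g.koszulFunctional a b X Y (f • Z) = f * g.koszulFunctional a b X Y Z := by
  induction f using sec_induction with
  | add f f' hf hf' => rw [add_smul f f' Z, map_add, hf, hf', add_mul]
  | hom k f hf =>
    induction Z using vect_induction with
    | add Z Z' hZ hZ' => rw [smul_add f Z Z', map_add, map_add, hZ, hZ', mul_add]
    | hom c Z hZ =>
      rw [g.koszulFunctional_apply _ _ (hZ.smul hf), g.koszulFunctional_apply _ _ hZ,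
        g.koszul_smul_right hX hY hZ hf, smul_smul, sgn_add_left k c (a + b), mul_right_comm,
        sgn_mul_self, one_mul, mul_smul_comm]

/-- Half of the Koszul functional is represented by the metric. The factor `2` is written as a sum
so that later identities need only additive manipulations. -/
theorem exists_koszul_of_isHom (hX : M.IsHomVect X a) (hY : M.IsHomVect Y b) :
    ∃ V : M.Vect ⊤, M.IsHomVect V (a + b) ∧ ∀ c Z, M.IsHomVect Z c →
      g.pair ⊤ V Z + g.pair ⊤ V Z = g.koszul a b c X Y Z := by
  let φ : M.Vect ⊤ →ₗ[M.sec ⊤] M.sec ⊤ :=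
    { toFun := fun Z => (2⁻¹ : ℝ) • g.koszulFunctional a b X Y Z
      map_add' := fun Z Z' => by rw [map_add, smul_add]
      map_smul' := fun f Z => by
        rw [g.koszulFunctional_smul hX hY, RingHom.id_apply, smul_eq_mul, mul_smul_comm] }
  have hφ : ∀ {c Z}, M.IsHomVect Z c →
      φ Z = (2⁻¹ : ℝ) • sgn c (a + b) • g.koszul a b c X Y Z := fun hZ =>
    congrArg _ (g.koszulFunctional_apply X Y hZ)
  obtain ⟨V, hV, h⟩ := g.exists_representative φ (e := a + b + g.deg) fun c Z hZ => by
    rw [hφ hZ, show c + (a + b + g.deg) = a + b + c + g.deg by abel]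
    exact Submodule.smul_mem _ _ (zsmul_mem (g.koszul_mem_grade hX hY hZ) _)
  -- The degree of the metric enters twice and cancels.
  rw [add_assoc, Z2n.add_self, add_zero] at hV
  refine ⟨V, hV, fun c Z hZ => ?_⟩
  rw [g.pair_symm ⊤ _ _ _ _ hV hZ, h, hφ hZ, ← two_smul ℝ,
    smul_comm (sgn _ _), smul_smul, mul_inv_cancel₀ two_ne_zero, one_smul, smul_smul,
    sgn_comm c, sgn_mul_self, one_smul]

/-- One formula for arbitrary `X` and `Y` determines the operator by its pairings, so its additivity
is inherited from the Koszul expression. -/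
theorem exists_koszul (X Y : M.Vect ⊤) :
    ∃ V : M.Vect ⊤, ∀ c Z, M.IsHomVect Z c → g.pair ⊤ V Z + g.pair ⊤ V Z =
      ∑ a, ∑ b, g.koszul a b c (vproj a X) (vproj b Y) Z := by
  choose V _ hV using fun a b =>
    g.exists_koszul_of_isHom (isHomVect_vproj a X) (isHomVect_vproj b Y)
  refine ⟨∑ a, ∑ b, V a b, fun c Z hZ => ?_⟩
  simp only [g.pair_sum_left, ← Finset.sum_add_distrib, hV _ _ c Z hZ]

/-- The operator of the Levi-Civita connection. -/
noncomputable def leviCivitaNabla (X Y : M.Vect ⊤) : M.Vect ⊤ := (g.exists_koszul X Y).choose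

theorem leviCivitaNabla_spec (X Y : M.Vect ⊤) (hZ : M.IsHomVect Z c) :
    g.pair ⊤ (g.leviCivitaNabla X Y) Z + g.pair ⊤ (g.leviCivitaNabla X Y) Z =
      ∑ a, ∑ b, g.koszul a b c (vproj a X) (vproj b Y) Z :=
  (g.exists_koszul X Y).choose_spec c Z hZ

theorem leviCivitaNabla_koszul (hX : M.IsHomVect X a) (hY : M.IsHomVect Y b)
    (hZ : M.IsHomVect Z c) :
    g.pair ⊤ (g.leviCivitaNabla X Y) Z + g.pair ⊤ (g.leviCivitaNabla X Y) Z =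
      g.koszul a b c X Y Z := by
  rw [g.leviCivitaNabla_spec X Y hZ, Finset.sum_eq_single a, Finset.sum_eq_single b,
    vproj_of_isHom hX, vproj_of_isHom hY]
  · intro b' _ hb
    rw [vproj_of_isHom_ne hY hb.symm, koszul_zero_mid]
  · simp
  · intro a' _ ha
    simp only [vproj_of_isHom_ne hX ha.symm, koszul_zero_left, Finset.sum_const_zero]
  · simp

theorem leviCivitaNabla_add_left (X X' Y : M.Vect ⊤) :
    g.leviCivitaNabla (X + X') Y = g.leviCivitaNabla X Y + g.leviCivitaNabla X' Y :=
  g.ext_pair_left fun c Z hZ => by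
    rw [g.pair_add_left, add_add_add_comm, g.leviCivitaNabla_spec _ _ hZ,
      g.leviCivitaNabla_spec _ _ hZ, g.leviCivitaNabla_spec _ _ hZ]
    simp only [map_add, koszul_add_left, Finset.sum_add_distrib]

theorem leviCivitaNabla_add_right (X Y Y' : M.Vect ⊤) :
    g.leviCivitaNabla X (Y + Y') = g.leviCivitaNabla X Y + g.leviCivitaNabla X Y' :=
  g.ext_pair_left fun c Z hZ => by
    rw [g.pair_add_left, add_add_add_comm, g.leviCivitaNabla_spec _ _ hZ,
      g.leviCivitaNabla_spec _ _ hZ, g.leviCivitaNabla_spec _ _ hZ]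
    simp only [map_add, koszul_add_mid, Finset.sum_add_distrib]

theorem isHomVect_leviCivitaNabla (hX : M.IsHomVect X a) (hY : M.IsHomVect Y b) :
    M.IsHomVect (g.leviCivitaNabla X Y) (a + b) := by
  obtain ⟨V, hV, h⟩ := g.exists_koszul_of_isHom hX hY
  rwa [show g.leviCivitaNabla X Y = V from g.ext_pair_left fun c Z hZ => by
    rw [h c Z hZ, g.leviCivitaNabla_koszul hX hY hZ]]

theorem leviCivitaNabla_smul_left (f : M.sec ⊤) (X Y : M.Vect ⊤) :
    g.leviCivitaNabla (f • X) Y = f • g.leviCivitaNabla X Y := by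
  induction f using sec_induction with
  | add f f' hf hf' => rw [add_smul f f' X, g.leviCivitaNabla_add_left, hf, hf', add_smul f f']
  | hom k f hf =>
    induction X using vect_induction with
    | add X X' hX hX' =>
      rw [smul_add f X X', g.leviCivitaNabla_add_left, g.leviCivitaNabla_add_left, hX, hX',
        smul_add f (g.leviCivitaNabla X Y)]
    | hom a X hX =>
      induction Y using vect_induction with
      | add Y Y' hY hY' =>
        rw [g.leviCivitaNabla_add_right, g.leviCivitaNabla_add_right, hY, hY',
          smul_add f (g.leviCivitaNabla X Y)]
      | hom b Y hY =>
        refine g.ext_pair_left fun c Z hZ => ?_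
        rw [g.leviCivitaNabla_koszul (hX.smul hf) hY hZ, g.koszul_smul_left hX hY hZ hf,
          g.pair_smul_left, ← mul_add, g.leviCivitaNabla_koszul hX hY hZ]

theorem leviCivitaNabla_leibniz (hX : M.IsHomVect X a) (hf : f ∈ M.grade ⊤ k) (Y : M.Vect ⊤) :
    g.leviCivitaNabla X (f • Y) = X.1 f • Y + sgn a k • (f • g.leviCivitaNabla X Y) := by
  induction Y using vect_induction with
  | add Y Y' hY hY' =>
    rw [smul_add f Y Y', g.leviCivitaNabla_add_right, g.leviCivitaNabla_add_right, hY, hY']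
    refine vect_ext fun h => ?_
    simp only [vect_add_apply, vect_zsmul_apply, vect_smul_apply, mul_add, zsmul_add]
    exact add_add_add_comm _ _ _ _
  | hom b Y hY =>
    refine g.ext_pair_left fun c Z hZ => ?_
    rw [g.leviCivitaNabla_koszul hX (hY.smul hf) hZ, g.koszul_smul_mid hX hY hZ hf,
      g.pair_add_left, g.pair_zsmul_left, g.pair_smul_left, g.pair_smul_left,
      ← g.leviCivitaNabla_koszul hX hY hZ, mul_add, zsmul_add]
    exact add_add_add_comm _ _ _ _

/-- The Levi-Civita connection. -/
noncomputable def leviCivita : AffineConnection M where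
  nabla := g.leviCivitaNabla
  nabla_grade _ _ _ _ hX hY := g.isHomVect_leviCivitaNabla hX hY
  nabla_add_left := g.leviCivitaNabla_add_left
  nabla_add_right := g.leviCivitaNabla_add_right
  nabla_smul_left := g.leviCivitaNabla_smul_left
  nabla_leibniz _ Y _ _ _ hX hf := g.leviCivitaNabla_leibniz hX hf Y

theorem leviCivita_isSymmetric : g.leviCivita.IsSymmetric := fun X Y a b hX hY => by
  have h : g.leviCivitaNabla X Y - sgn a b • g.leviCivitaNabla Y X = bracket X Y :=
    g.ext_pair_left fun c Z hZ => by
      rw [← g.koszul_torsion hX hY hZ, ← g.leviCivitaNabla_koszul hX hY hZ,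
        ← g.leviCivitaNabla_koszul hY hX hZ, g.pair_sub_left, g.pair_zsmul_left, smul_add]
      abel
  refine LinearMap.ext fun f => ?_
  have hf := congrArg (fun V : M.Vect ⊤ => V.1 f) h
  simp only [vect_sub_apply, vect_zsmul_apply, bracket_apply_of_isHom hX hY] at hf
  exact sub_eq_zero.2 hf

theorem leviCivita_isMetricCompatible : g.leviCivita.IsMetricCompatible g :=
  fun X Y Z a b hX hY => by
    induction Z using vect_induction with
    | add Z Z' hZ hZ' =>
      rw [g.pair_add_right, map_add, hZ, hZ', g.leviCivita.nabla_add_right, g.pair_add_right,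
        g.pair_add_right, smul_add]
      abel
    | hom c Z hZ =>
      refine add_self_injective_of_real ?_
      have hXZ : M.IsHomVect (g.leviCivita.nabla X Z) (a + c) :=
        g.leviCivita.nabla_grade X Z a c hX hZ
      have h1 : g.pair ⊤ (g.leviCivita.nabla X Y) Z + g.pair ⊤ (g.leviCivita.nabla X Y) Z = _ :=
        g.leviCivitaNabla_koszul hX hY hZ
      have h2 : g.pair ⊤ (g.leviCivita.nabla X Z) Y + g.pair ⊤ (g.leviCivita.nabla X Z) Y = _ :=
        g.leviCivitaNabla_koszul hX hZ hY
      rw [g.pair_symm ⊤ Y _ _ _ hY hXZ, smul_smul, sgn_add_right, sgn_comm b a, ← mul_assoc,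
        sgn_mul_self, one_mul, ← g.koszul_compatible hX hY hZ, ← h1, ← h2, smul_add]
      abel

/-! ### Uniqueness -/

variable {g} {D : AffineConnection M}

theorem _root_.AffineConnection.IsSymmetric.sub_eq_bracket (hD : D.IsSymmetric)
    (hX : M.IsHomVect X a) (hY : M.IsHomVect Y b) :
    D.nabla X Y - sgn a b • D.nabla Y X = bracket X Y := vect_ext fun f => by
  have := congrArg (fun T : M.sec ⊤ →ₗ[ℝ] M.sec ⊤ => T f) (hD X Y a b hX hY)
  simp only [vect_sub_apply, vect_zsmul_apply, bracket_apply_of_isHom hX hY]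
  exact sub_eq_zero.1 this

/-- The Koszul formula. -/
theorem pair_nabla_add_self (hs : D.IsSymmetric) (hm : D.IsMetricCompatible g)
    (hX : M.IsHomVect X a) (hY : M.IsHomVect Y b) (hZ : M.IsHomVect Z c) :
    g.pair ⊤ (D.nabla X Y) Z + g.pair ⊤ (D.nabla X Y) Z = g.koszul a b c X Y Z := by
  -- Compatibility expands the three derivatives and torsion-freeness the three brackets; all terms
  -- cancel except two copies of `⟨∇_X Y|Z⟩`.
  simp only [koszul, hm X Y Z a b hX hY, hm Y Z X b c hY hZ, hm Z X Y c a hZ hX,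
    ← hs.sub_eq_bracket hX hY, ← hs.sub_eq_bracket hX hZ, ← hs.sub_eq_bracket hY hZ,
    g.pair_sub_left, g.pair_zsmul_left,
    g.pair_symm ⊤ Y (D.nabla X Z) _ _ hY (D.nabla_grade X Z a c hX hZ),
    g.pair_symm ⊤ Z (D.nabla Y X) _ _ hZ (D.nabla_grade Y X b a hY hX),
    g.pair_symm ⊤ X (D.nabla Z Y) _ _ hX (D.nabla_grade Z Y c b hZ hY),
    sgn_add_right, sgn_comm c a, sgn_comm c b, sgn_comm b a]
  rcases sgn_eq_one_or a b with h1 | h1 <;> rcases sgn_eq_one_or a c with h2 | h2 <;>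
    rcases sgn_eq_one_or b c with h3 | h3 <;>
    simp only [h1, h2, h3, mul_neg, mul_one, neg_neg, one_smul, neg_smul] <;> abel

theorem eq_leviCivita (hs : D.IsSymmetric) (hm : D.IsMetricCompatible g) : D = g.leviCivita := by
  ext X Y : 3
  induction X using vect_induction with
  | add X X' hX hX' =>
    rw [D.nabla_add_left, g.leviCivita.nabla_add_left, hX, hX']
  | hom a X hX =>
    induction Y using vect_induction with
    | add Y Y' hY hY' =>
      rw [D.nabla_add_right, g.leviCivita.nabla_add_right, hY, hY']
    | hom b Y hY =>
      refine g.ext_pair_left fun c Z hZ => ?_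
      rw [pair_nabla_add_self hs hm hX hY hZ]
      exact (g.leviCivitaNabla_koszul hX hY hZ).symm

end RiemannianZ2nMetric

theorem theorem1 {n : ℕ} (M : Z2nManifold.{u, v} n) (g : RiemannianZ2nMetric M) :
    ∃! D : AffineConnection M, D.IsSymmetric ∧ D.IsMetricCompatible g :=
  ⟨g.leviCivita, ⟨g.leviCivita_isSymmetric, g.leviCivita_isMetricCompatible⟩,
    fun _ hD => RiemannianZ2nMetric.eq_leviCivita hD.1 hD.2⟩
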